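/- **Theorem 2 (Metastability of the disordered Curie–Weiss–Potts model).** Let $q\ge 2$ and let $(J_{ij})_{1\le i<j<\infty}$ be i.i.d. real random variables on a probability space $(\Omega,\mathcal F,\mathbb P)$ with $\mathbb E[J_{12}]=1$ and such that $0$ lies in the interior of $\{\lambda\in\mathbb R:\mathbb E[e^{\lambda J_{12}}]<\infty\}$. On $\mathcal S_N=\{1,\dots,q\}^N$ put $$H_N(\sigma)=-\frac1N\sum_{1\le i<j\le N}J_{ij}\mathbf 1_{\{\sigma_i=\sigma_j\}},\qquad \widetilde H_N(\sigma)=-\frac1N\sum_{1\le i<j\le N}\mathbf 1_{\{\sigma_i=\sigma_j\}} .$$ For $\beta\ge0$ and a Hamiltonian $H$ on $\mathcal S_N$, let $\mu\propto e^{-\beta H}$ be its Gibbs measure and consider the discrete-time Markov chain on $\mathcal S_N$ with transition probabilities $\pi(\sigma,\eta)=(Nq)^{-1}e^{-\beta\max\{0,H(\eta)-H(\sigma)\}}$ if $\sigma,\eta$ differ in exactly one vertex, $\pi(\sigma,\eta)=0$ if they differ in more than one vertex, and $\pi(\sigma,\sigma)=1-\sum_{\eta\ne\sigma}\pi(\sigma,\eta)$.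 For $H=H_N$ this is the disordered (DCWP) chain, for $H=\widetilde H_N$ the mean-field (CWP) chain. Let $\tau_A=\inf\{t>0: \Sigma_t\in A\}$ and, for non-empty $A$, let $\mathrm P_{\mu|A}$ be the law of the chain started from $\mu$ conditioned on $A$. The chain is *$\rho$-metastable* with respect to non-empty, pairwise disjoint sets $M_i\subset\mathcal S_N$, $i\in I$, with union $M$, if $$|I|\;\frac{\max_{j\in I}\mathrm P_{\mu|M_j}[\tau_{M\setminus M_j}<\tau_{M_j}]}{\min_{\emptyset\ne X\subset\mathcal S_N\setminus M}\mathrm P_{\mu|X}[\tau_M<\tau_X]}\le\rho .$$ Let $\mathcal P=\{x\in[0,1]^q:\sum_kx_k=1\}$, $\mathcal P_N=\mathcal P\cap\frac1N\mathbb N_0^q$, and $\widetilde F_{\beta,q}(x)=-\frac12\|x\|_2^2+\frac1\beta\sum_k x_k\log x_k$ for $x\in\mathcal P$. Let $m_0=(1/q,\dots,1/q)$, and let $\beta_1(q)$ be the critical value above which local minima other than $m_0$ appear, that is, the infimum of all $\beta>0$ for which $\widetilde F_{\beta,q}$ has a local minimum on $\mathcal P$ other than $m_0$. For $1\le i\le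 q$ let $m_i\in\mathcal P$ have $i$-th coordinate $(1+(q-1)s)/q$ and all other coordinates $(1-s)/q$, where $s=s(\beta,q)$ is the largest solution of $\log(1+(q-1)s)-\log(1-s)=\beta s$. Let $\mathcal I_\beta=\{0,\dots,q\}$ if $\beta_1(q)<\beta<q$ and $\mathcal I_\beta=\{1,\dots,q\}$ if $\beta>\beta_1(q)$ and $\beta\ge q$. For $N\ge1$ and $i\in\mathcal I_\beta$ let $m_{i,N}\in\mathcal P_N$ be a point of $\mathcal P_N$ closest to $m_i$ in Euclidean distance (an arbitrary one if there are several), and let $\mathcal M_{i,N}$ be the set of all $\sigma\in\mathcal S_N$ whose vector of colour frequencies $\bigl(\frac1N|\{v:\sigma_v=k\}|\bigr)_{k=1}^q$ equals $m_{i,N}$. Let $\beta>\beta_1(q)$. Then: 1. there is $k_1=k_1(\beta,q)>0$ such that, for every choice of the $m_{i,N}$, the CWP chain is $e^{-k_1N}$-metastable with respect to $\{\mathcal M_{i,N}:i\in\mathcal I_\beta\}$ for all sufficiently large $N$; 2. for every choice of the $m_{i,N}$, every $k_1>0$ for which the CWP chain is $e^{-k_1N}$-metastable with respect to $\{\mathcal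 M_{i,N}:i\in\mathcal I_\beta\}$ for all sufficiently large $N$, and every $k_2\in(0,k_1)$: with $\mathbb P$-probability one, for all sufficiently large $N$ the DCWP chain is $e^{-k_2N}$-metastable with respect to the same sets $\{\mathcal M_{i,N}:i\in\mathcal I_\beta\}$. -/

import Mathlib

open MeasureTheory ProbabilityTheory Filter
open scoped NNReal ENNReal

noncomputable section

namespace Potts

/-! ### Configurations and Hamiltonians -/

/-- Configurations of `N` spins with `q` colours. -/
abbrev Config (N q : ℕ) : Type := Fin N → Fin q

/-- The Hamiltonian `-(1/N) ∑_{i<j} J_{ij} 1{σ_i = σ_j}` for a realisation `J` of the couplings.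
Vertices are numbered from `0`; only the entries `J i j` with `i < j` are used. -/
def hamiltonian {N q : ℕ} (J : ℕ → ℕ → ℝ) (σ : Config N q) : ℝ :=
  -(1 / (N : ℝ)) * ∑ i : Fin N, ∑ j : Fin N, if i < j ∧ σ i = σ j then J i j else 0

/-- The Hamiltonian of the mean-field model: all couplings are `1`. -/
def meanFieldHamiltonian {N q : ℕ} (σ : Config N q) : ℝ :=
  hamiltonian (fun _ _ => 1) σ

/-! ### Gibbs measure and Metropolis dynamics -/

/-- The partition function. -/
def partitionFunction {N q : ℕ} (β : ℝ≥0) (H : Config N q → ℝ) : ℝ :=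
  ∑ σ, Real.exp (-β * H σ)

/-- The Gibbs measure at inverse temperature `β`. -/
def gibbs {N q : ℕ} (β : ℝ≥0) (H : Config N q → ℝ) : Measure (Config N q) :=
  ∑ σ, ENNReal.ofReal (Real.exp (-β * H σ) / partitionFunction β H) • Measure.dirac σ

/-- The Metropolis transition probabilities between distinct configurations. -/
def flipProb {N q : ℕ} (β : ℝ≥0) (H : Config N q → ℝ) (σ η : Config N q) : ℝ :=
  if hammingDist σ η = 1 then ((N : ℝ) * q)⁻¹ * Real.exp (-β * max 0 (H η - H σ)) else 0

/-- The Glauber-Metropolis transition matrix. -/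
def transProb {N q : ℕ} (β : ℝ≥0) (H : Config N q → ℝ) (σ η : Config N q) : ℝ :=
  if σ = η then 1 - ∑ ζ ∈ Finset.univ.erase σ, flipProb β H σ ζ else flipProb β H σ η

theorem flipProb_nonneg {N q : ℕ} (β : ℝ≥0) (H : Config N q → ℝ) (σ η : Config N q) :
    0 ≤ flipProb β H σ η := by
  unfold flipProb
  split_ifs <;> positivity

theorem card_neighbours_le {N q : ℕ} (σ : Config N q) :
    (Finset.univ.filter fun η : Config N q => hammingDist σ η = 1).card ≤ N * q := by
  have hsub : (Finset.univ.filter fun η : Config N q => hammingDist σ η = 1) ⊆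
      Finset.univ.image fun p : Fin N × Fin q => Function.update σ p.1 p.2 := by
    intro η hη
    rw [Finset.mem_filter, hammingDist, Finset.card_eq_one] at hη
    obtain ⟨i, hi⟩ := hη.2
    refine Finset.mem_image.2 ⟨(i, η i), Finset.mem_univ _, ?_⟩
    funext j
    by_cases hj : j = i
    · subst hj; simp
    · have : j ∉ Finset.univ.filter fun k => σ k ≠ η k := by rw [hi]; simpa using hj
      simpa [Function.update_of_ne hj] using this
  calc _ ≤ _ := Finset.card_le_card hsub
    _ ≤ _ := Finset.card_image_le
    _ = N * q := by simp

theorem sum_flipProb_le_one {N q : ℕ} (β : ℝ≥0) (H : Config N q → ℝ) (σ : Config N q) :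
    ∑ ζ ∈ Finset.univ.erase σ, flipProb β H σ ζ ≤ 1 := by
  have hle : ∀ ζ, flipProb β H σ ζ ≤ if hammingDist σ ζ = 1 then ((N : ℝ) * q)⁻¹ else 0 := by
    intro ζ
    unfold flipProb
    split_ifs
    · refine mul_le_of_le_one_right (by positivity) (Real.exp_le_one_iff.2 ?_)
      have := mul_nonneg β.coe_nonneg (le_max_left 0 (H ζ - H σ))
      linarith
    · exact le_rfl
  calc ∑ ζ ∈ Finset.univ.erase σ, flipProb β H σ ζ
      ≤ ∑ ζ, flipProb β H σ ζ :=
        Finset.sum_le_sum_of_subset_of_nonneg (Finset.erase_subset _ _)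
          fun _ _ _ => flipProb_nonneg _ _ _ _
    _ ≤ ∑ ζ, if hammingDist σ ζ = 1 then ((N : ℝ) * q)⁻¹ else 0 :=
        Finset.sum_le_sum fun ζ _ => hle ζ
    _ = ((Finset.univ.filter fun η : Config N q => hammingDist σ η = 1).card : ℝ)
          * ((N : ℝ) * q)⁻¹ := by
        rw [← Finset.sum_filter, Finset.sum_const, nsmul_eq_mul]
    _ ≤ ((N : ℝ) * q) * ((N : ℝ) * q)⁻¹ := by
        gcongr
        exact_mod_cast card_neighbours_le σ
    _ ≤ 1 := mul_inv_le_one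

theorem transProb_nonneg {N q : ℕ} (β : ℝ≥0) (H : Config N q → ℝ) (σ η : Config N q) :
    0 ≤ transProb β H σ η := by
  unfold transProb
  split_ifs
  · linarith [sum_flipProb_le_one β H σ]
  · exact flipProb_nonneg _ _ _ _

theorem sum_transProb {N q : ℕ} (β : ℝ≥0) (H : Config N q → ℝ) (σ : Config N q) :
    ∑ η, transProb β H σ η = 1 := by
  rw [← Finset.add_sum_erase _ _ (Finset.mem_univ σ)]
  have : ∑ η ∈ Finset.univ.erase σ, transProb β H σ η =
      ∑ η ∈ Finset.univ.erase σ, flipProb β H σ η :=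
    Finset.sum_congr rfl fun η hη => if_neg (Finset.ne_of_mem_erase hη).symm
  rw [this]
  simp [transProb]

/-- The one-step transition kernel of the Metropolis chain. -/
def stepKernel {N q : ℕ} (β : ℝ≥0) (H : Config N q → ℝ) : Kernel (Config N q) (Config N q) :=
  Kernel.ofFunOfCountable fun σ => ∑ η, ENNReal.ofReal (transProb β H σ η) • Measure.dirac η

instance {N q : ℕ} (β : ℝ≥0) (H : Config N q → ℝ) : IsMarkovKernel (stepKernel β H) where
  isProbabilityMeasure σ := ⟨by
    change (∑ η, ENNReal.ofReal (transProb β H σ η) • Measure.dirac η) Set.univ = 1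
    simp only [Measure.coe_finsetSum, Finset.sum_apply, Measure.smul_apply, measure_univ,
      smul_eq_mul, mul_one]
    rw [← ENNReal.ofReal_sum_of_nonneg fun η _ => transProb_nonneg β H σ η, sum_transProb,
      ENNReal.ofReal_one]⟩

/-- The law, on the space of trajectories, of the Metropolis chain with initial distribution `ν`. -/
def chainLaw {N q : ℕ} (β : ℝ≥0) (H : Config N q → ℝ) (ν : Measure (Config N q)) :
    Measure (ℕ → Config N q) :=
  Kernel.trajMeasure (X := fun _ => Config N q) ν fun n =>
    (stepKernel β H).comap (fun h : (i : Finset.Iic n) → Config N q =>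
      h ⟨n, Finset.mem_Iic.2 le_rfl⟩) (by fun_prop)

/-- The first return time `inf {t > 0 : x_t ∈ A}`, equal to `⊤` if there is no such `t`. -/
def returnTime {S : Type*} (A : Set S) (x : ℕ → S) : ℕ∞ :=
  ⨅ (t : ℕ) (_ : 0 < t ∧ x t ∈ A), (t : ℕ∞)

/-- The probability that the chain, started from the Gibbs measure conditioned on `A`,
visits `B` before it returns to `A`. -/
def escapeProb {N q : ℕ} (β : ℝ≥0) (H : Config N q → ℝ) (A B : Set (Config N q)) : ℝ≥0∞ :=
  chainLaw β H (cond (gibbs β H) A) {x | returnTime B x < returnTime A x}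

/-- `ρ`-metastability of the Metropolis chain with respect to the collection `M i`, `i ∈ I`, of
non-empty, pairwise disjoint sets. In the denominator `X` runs through the non-empty sets of
configurations outside the union of the `M i`. -/
def IsMetastable {N q : ℕ} {ι : Type*} (β : ℝ≥0) (H : Config N q → ℝ)
    (I : Finset ι) (M : ι → Set (Config N q)) (ρ : ℝ) : Prop :=
  (∀ i ∈ I, (M i).Nonempty) ∧ (I : Set ι).PairwiseDisjoint M ∧
  (I.card : ℝ≥0∞) * (⨆ j ∈ I, escapeProb β H (M j) ((⋃ i ∈ I, M i) \ M j)) /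
      (⨅ (X : Set (Config N q)) (_ : X.Nonempty ∧ X ⊆ (⋃ i ∈ I, M i)ᶜ),
        escapeProb β H X (⋃ i ∈ I, M i))
    ≤ ENNReal.ofReal ρ

/-! ### Free energy and its local minima -/

/-- The limiting free energy of the mean-field model on the simplex. -/
def freeEnergy {q : ℕ} (β : ℝ) (x : Fin q → ℝ) : ℝ :=
  -(1 / 2) * ∑ k, x k ^ 2 + 1 / β * ∑ k, x k * Real.log (x k)

/-- The critical value `β₁(q)`: above it, and not below it, the free energy has local minima on
the simplex other than the uniform vector `(1/q, …, 1/q)`. -/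
def betaOne (q : ℕ) : ℝ :=
  sInf {β : ℝ | 0 < β ∧ ∃ x ∈ stdSimplex ℝ (Fin q), x ≠ (fun _ => 1 / (q : ℝ)) ∧
    IsLocalMinOn (freeEnergy β) (stdSimplex ℝ (Fin q)) x}

/-- The largest solution `s` of `log (1 + (q-1) s) - log (1 - s) = β s`. -/
def order (q : ℕ) (β : ℝ) : ℝ :=
  sSup {s : ℝ | 0 < 1 + ((q : ℝ) - 1) * s ∧ 0 < 1 - s ∧
    Real.log (1 + ((q : ℝ) - 1) * s) - Real.log (1 - s) = β * s}

/-- The points `m_0, m_1, …, m_q`; the colour `k : Fin q` belongs to the index `k.succ`. -/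
def minimum (q : ℕ) (β : ℝ) (i : Fin (q + 1)) (k : Fin q) : ℝ :=
  if i = 0 then 1 / (q : ℝ)
  else if k.succ = i then (1 + ((q : ℝ) - 1) * order q β) / q
  else (1 - order q β) / q

/-- The index set `{0, …, q}` if `β < q`, and `{1, …, q}` if `β ≥ q`. -/
def indexSet (q : ℕ) (β : ℝ) : Finset (Fin (q + 1)) :=
  if β < q then Finset.univ else Finset.univ.erase 0

/-! ### Metastable sets -/

/-- The vector of colour frequencies of a configuration. -/
def empirical {N q : ℕ} (σ : Config N q) (k : Fin q) : ℝ :=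
  ((Finset.univ.filter fun i => σ i = k).card : ℝ) / N

/-- The points of the simplex with coordinates in `ℕ / N`. -/
def latticeSimplex (N q : ℕ) : Set (Fin q → ℝ) :=
  {x | x ∈ stdSimplex ℝ (Fin q) ∧ ∀ k, ∃ n : ℕ, x k = (n : ℝ) / N}

/-- `m N i` is, for every `N ≥ 1` and `i` in the index set, a lattice point closest
(in Euclidean distance) to the minimum with index `i`. -/
def IsLatticeApprox (q : ℕ) (β : ℝ) (m : ℕ → Fin (q + 1) → Fin q → ℝ) : Prop :=
  ∀ N : ℕ, 1 ≤ N → ∀ i ∈ indexSet q β, m N i ∈ latticeSimplex N q ∧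
    ∀ y ∈ latticeSimplex N q,
      ∑ k, (m N i k - minimum q β i k) ^ 2 ≤ ∑ k, (y k - minimum q β i k) ^ 2

/-- The set of configurations whose vector of colour frequencies is `m N i`. -/
def metastableSet {q : ℕ} (m : ℕ → Fin (q + 1) → Fin q → ℝ) (N : ℕ) (i : Fin (q + 1)) :
    Set (Config N q) :=
  {σ | empirical σ = m N i}

/-- For all large `N`, the mean-field chain is `exp (-k N)`-metastable. -/
def MeanFieldMetastable (q : ℕ) (β : ℝ≥0) (m : ℕ → Fin (q + 1) → Fin q → ℝ) (k : ℝ) : Prop :=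
  ∃ N₀ : ℕ, ∀ N : ℕ, N₀ < N →
    IsMetastable β (meanFieldHamiltonian (N := N) (q := q)) (indexSet q β) (metastableSet m N)
      (Real.exp (-k * N))

/-- The event that the disordered chain with `N` spins is `exp (-k N)`-metastable. -/
def metastableEvent {Ω : Type*} (J : ℕ → ℕ → Ω → ℝ) (q : ℕ) (β : ℝ≥0)
    (m : ℕ → Fin (q + 1) → Fin q → ℝ) (k : ℝ) (N : ℕ) : Set Ω :=
  {ω | IsMetastable β (hamiltonian (N := N) (q := q) fun i j => J i j ω) (indexSet q β)
    (metastableSet m N) (Real.exp (-k * N))}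

end Potts

end

noncomputable section

namespace Potts

/-! ### The law of the chain and first-hit decompositions -/

/-! The chain is reversible, so everything reduces to capacities. For disjoint A and B, with A
non-empty, the probability of visiting B before returning to A, started from μ conditioned on A, is
the minimum of the Dirichlet form over functions equal to 1 on A and 0 on B, divided by the weight
of A (`exists_escapeProb_eq`). The partition function cancels, and an edge has conductance exp(-β
max(H(σ), H(η))) / (Nq).

Disorder. If two Hamiltonians differ by at most δ everywhere, weights and conductances change by a
factor of at most exp(βδ), hence escape probabilities by exp(2βδ) and the metastability ratio by
exp(4βδ) (`IsMetastable.of_close`). At a fixed configuration the disordered and mean-field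
Hamiltonians differ by 1/N times a sum of at most N² independent centred variables. A Chernoff bound
of order exp(-cN²) for a deviation εN beats the q^N configurations, and Borel–Cantelli gives uniform
closeness (`ae_eventually_hamiltonian_close`). Any ε with 4βε ≤ k₁ - k₂ then gives part 2.

Mean field. The Hamiltonian depends only on the colour counts, and by Stirling the class with
frequencies x has weight exp(-βN F(x) + O(log N)) (`abs_log_classWeight`). For the numerator, the
indicator of a ball around m_j is a test function whose boundary lies in a shell where F exceeds
F(m_j) by a fixed amount (`exists_shell`), so escape is exponentially unlikely. For the denominator,
every configuration has a path to the metastable sets along which F rises by at most ε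
(`eventually_exists_descending_path`). As X need not be symmetric, the path is averaged over all
vertex permutations; Cauchy–Schwarz along it (`class_weight_le_of_path`) bounds the escape
probability below by exp(-βεN) up to a polynomial factor. Taking ε small compared with the shell
height gives part 1.

Both bounds rest on the fact that the local minima of F on the simplex are exactly the m_i in the
index set (`exists_eq_minimum`, `isLocalMinOn_minimum`). The one-colour energy is convex below 1/β
and concave above. So at a local minimum at most one coordinate exceeds 1/β and the others coincide,
which leaves the family `orderedPoint`; along it the derivative of F is a positive multiple of
`orderEq`. -/

theorem lintegral_stepKernel {N q : ℕ} (β : ℝ≥0) (H : Config N q → ℝ) (σ : Config N q)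
    (g : Config N q → ℝ≥0∞) :
    ∫⁻ η, g η ∂(stepKernel β H σ) = ∑ η, ENNReal.ofReal (transProb β H σ η) * g η := by
  change ∫⁻ η, g η ∂(∑ η, ENNReal.ofReal (transProb β H σ η) • Measure.dirac η) = _
  rw [lintegral_finsetSum_measure]
  simp

theorem chainLaw_zero {N q : ℕ} (β : ℝ≥0) (H : Config N q → ℝ) (ν : Measure (Config N q))
    [IsProbabilityMeasure ν] : (chainLaw β H ν).map (fun x => x 0) = ν := by
  have h : (fun x : ℕ → Config N q => x 0) =
      (fun y : (i : Finset.Iic 0) → Config N q => y ⟨0, by simp⟩) ∘ Preorder.frestrictLe 0 := rfl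
  rw [h, ← Measure.map_map (by fun_prop) (by fun_prop), chainLaw, Kernel.trajMeasure,
    Measure.map_comp _ _ (by fun_prop), Kernel.traj_map_frestrictLe, Kernel.partialTraj_self,
    Measure.id_comp, Measure.map_map (by fun_prop) (by fun_prop)]
  exact Measure.map_id

/-- One step of the chain: the last coordinate is integrated out. -/
theorem lintegral_chainLaw_succ {N q : ℕ} (β : ℝ≥0) (H : Config N q → ℝ)
    (ν : Measure (Config N q)) [IsProbabilityMeasure ν] (n : ℕ)
    (F : ((i : Finset.Iic n) → Config N q) → ℝ≥0∞) (g : Config N q → ℝ≥0∞) :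
    ∫⁻ x, F (Preorder.frestrictLe n x) * g (x (n + 1)) ∂(chainLaw β H ν) =
      ∫⁻ x, F (Preorder.frestrictLe n x) * ∫⁻ η, g η ∂(stepKernel β H (x n))
        ∂(chainLaw β H ν) := by
  have hF : Measurable F := measurable_of_countable F
  have hg : Measurable g := measurable_of_countable g
  have key := Kernel.map_frestrictLe_trajMeasure_compProd_eq_map_trajMeasure
    (X := fun _ => Config N q) (μ₀ := ν) (κ := fun n =>
    (stepKernel β H).comap (fun h : (i : Finset.Iic n) → Config N q =>
      h ⟨n, Finset.mem_Iic.2 le_rfl⟩) (by fun_prop)) (a := n)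
  have h1 : ∫⁻ x, F (Preorder.frestrictLe n x) * g (x (n + 1)) ∂(chainLaw β H ν) =
      ∫⁻ p, F p.1 * g p.2 ∂((chainLaw β H ν).map
        (fun x : ℕ → Config N q => (Preorder.frestrictLe n x, x (n + 1)))) := by
    rw [lintegral_map (by fun_prop) (by fun_prop)]
  rw [h1, chainLaw]
  erw [← key]
  rw [Measure.lintegral_compProd (by fun_prop), lintegral_map (by fun_prop) (by fun_prop)]
  refine lintegral_congr fun x => ?_
  exact lintegral_const_mul (μ := stepKernel β H (x n)) (F (Preorder.frestrictLe n x)) hg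

theorem indicator_one_congr {S T : Type*} {A : Set S} {B : Set T} {x : S} {y : T}
    (h : x ∈ A ↔ y ∈ B) : A.indicator (1 : S → ℝ≥0∞) x = B.indicator (1 : T → ℝ≥0∞) y := by
  classical
  simp only [Set.indicator_apply, Pi.one_apply, h]

/-- The chain killed in `C`, one step. -/
def killedStep {N q : ℕ} (β : ℝ≥0) (H : Config N q → ℝ) (C : Set (Config N q))
    (g : Config N q → ℝ≥0∞) : Config N q → ℝ≥0∞ :=
  Cᶜ.indicator fun σ => ∫⁻ η, g η ∂(stepKernel β H σ)

/-- Integrating out the last coordinate replaces `g` by its killed average, whose indicator absorbs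
the constraint at the preceding time. The very first step is not killed: return times ignore time 0,
and the chain may start inside `C`. -/
theorem lintegral_chainLaw_killed {N q : ℕ} (β : ℝ≥0) (H : Config N q → ℝ)
    (ν : Measure (Config N q)) [IsProbabilityMeasure ν] (C : Set (Config N q)) (n : ℕ)
    (g : Config N q → ℝ≥0∞) :
    ∫⁻ x, {x : ℕ → Config N q | ∀ s, 0 < s → s < n + 1 → x s ∉ C}.indicator 1 x * g (x (n + 1))
      ∂(chainLaw β H ν) =
    ∫⁻ σ, ∫⁻ η, (killedStep β H C)^[n] g η ∂(stepKernel β H σ) ∂ν := by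
  classical
  induction n generalizing g with
  | zero =>
    have := lintegral_chainLaw_succ β H ν 0 (fun _ => 1) g
    simp only [one_mul, zero_add] at this
    have h0 : {x : ℕ → Config N q | ∀ s, 0 < s → s < 0 + 1 → x s ∉ C} = Set.univ :=
      Set.eq_univ_of_forall fun x s h1 h2 => by omega
    simp only [h0, Set.indicator_univ, Pi.one_apply, one_mul, zero_add, this,
      Function.iterate_zero, id]
    conv_rhs => rw [← chainLaw_zero β H ν, lintegral_map (by
      exact measurable_of_countable _) (by fun_prop)]
  | succ n ih =>
    rw [Function.iterate_succ_apply, ← ih]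
    have := lintegral_chainLaw_succ β H ν (n + 1) (fun y =>
      {y : (i : Finset.Iic (n + 1)) → Config N q |
        ∀ s : Finset.Iic (n + 1), 0 < s.1 → y s ∉ C}.indicator 1 y) g
    convert this using 1
    · refine lintegral_congr fun x => ?_
      congr 1
      refine indicator_one_congr ⟨fun h s hs => h s hs ?_, fun h s hs hs' => h ⟨s, ?_⟩ hs⟩
      · have := Finset.mem_Iic.1 s.2
        omega
      · exact Finset.mem_Iic.2 (by omega)
    · refine lintegral_congr fun x => ?_
      by_cases h : x (n + 1) ∈ C
      · rw [killedStep, Set.indicator_of_notMem (s := Cᶜ) (not_not.2 h), mul_zero,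
          Set.indicator_of_notMem,
          zero_mul]
        intro h'
        exact h' ⟨n + 1, Finset.mem_Iic.2 le_rfl⟩ (by simp) h
      · rw [killedStep, Set.indicator_of_mem (Set.mem_compl h)]
        congr 1
        refine indicator_one_congr ⟨fun h' s hs => ?_, fun h' s hs hs' => h' ⟨s, ?_⟩ hs⟩
        · by_cases hs' : s.1 = n + 1
          · change x s.1 ∉ C
            rw [hs']; exact h
          · have := Finset.mem_Iic.1 s.2
            exact h' s hs (by omega)
        · exact Finset.mem_Iic.2 (by omega)

/-- A strictly smaller return time is finite, so there is a first positive visit to `B`, at time `n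
+ 1`. Disjointness excludes a simultaneous visit to `A`. -/
theorem returnTime_lt_iff {S : Type*} {A B : Set S} (hAB : Disjoint A B) (x : ℕ → S) :
    returnTime B x < returnTime A x ↔
      ∃ n, x (n + 1) ∈ B ∧ ∀ s, 0 < s → s < n + 1 → x s ∉ A ∪ B := by
  classical
  have hle : ∀ (C : Set S) (t : ℕ), 0 < t → x t ∈ C → returnTime C x ≤ t := fun C t h0 h =>
    iInf₂_le t ⟨h0, h⟩
  constructor
  · intro h
    have hex : ∃ t, 0 < t ∧ x t ∈ B := by
      by_contra hne
      push Not at hne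
      have : returnTime B x = ⊤ := by
        unfold returnTime
        simp only [iInf_eq_top]
        exact fun t ht => absurd ht.2 (hne t ht.1)
      rw [this] at h
      exact not_top_lt h
    obtain ⟨h0, hB⟩ := Nat.find_spec hex
    have hmin : ∀ s, s < Nat.find hex → ¬ (0 < s ∧ x s ∈ B) := fun s hs => Nat.find_min hex hs
    generalize Nat.find hex = t at *
    obtain ⟨n, rfl⟩ : ∃ n, t = n + 1 := ⟨t - 1, by omega⟩
    refine ⟨n, hB, fun s hs hsn hmem => ?_⟩
    rcases hmem with hA | hB'
    · have hlow : ((n + 1 : ℕ) : ℕ∞) ≤ returnTime B x := by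
        refine le_iInf₂ fun t ht => ?_
        by_contra hlt
        exact hmin t (by exact_mod_cast not_le.1 hlt) ht
      have := (hlow.trans_lt h).trans_le (hle A s hs hA)
      have : n + 1 < s := by exact_mod_cast this
      omega
    · exact hmin s hsn ⟨hs, hB'⟩
  · rintro ⟨n, hB, hn⟩
    refine (hle B (n + 1) (Nat.succ_pos _) hB).trans_lt ?_
    have hlow : ((n + 2 : ℕ) : ℕ∞) ≤ returnTime A x := by
      refine le_iInf₂ fun t ht => ?_
      by_contra hlt
      have hlt : t < n + 2 := by exact_mod_cast not_le.1 hlt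
      by_cases h : t = n + 1
      · subst h
        exact Set.disjoint_left.1 hAB ht.2 hB
      · exact hn t ht.1 (by omega) (Or.inl ht.2)
    refine lt_of_lt_of_le ?_ hlow
    exact_mod_cast Nat.lt_succ_self _

theorem chainLaw_returnTime_lt {N q : ℕ} (β : ℝ≥0) (H : Config N q → ℝ)
    (ν : Measure (Config N q)) [IsProbabilityMeasure ν] {A B : Set (Config N q)}
    (hAB : Disjoint A B) :
    chainLaw β H ν {x | returnTime B x < returnTime A x} =
      ∑' n, ∫⁻ σ, ∫⁻ η, (killedStep β H (A ∪ B))^[n] (B.indicator 1) η ∂(stepKernel β H σ) ∂ν := by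
  have hev : ∀ s, Measurable fun x : ℕ → Config N q => x s := fun s => measurable_pi_apply s
  have hset : {x : ℕ → Config N q | returnTime B x < returnTime A x} =
      ⋃ n, ({x | ∀ s, 0 < s → s < n + 1 → x s ∉ A ∪ B} ∩ {x | x (n + 1) ∈ B}) := by
    ext x
    simp only [Set.mem_ofPred_eq, returnTime_lt_iff hAB, Set.mem_iUnion, Set.mem_inter_iff]
    exact exists_congr fun n => and_comm
  have hm1 : ∀ n : ℕ, MeasurableSet
      {x : ℕ → Config N q | ∀ s, 0 < s → s < n + 1 → x s ∉ A ∪ B} := by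
    intro n
    simp only [Set.ofPred_forall]
    refine MeasurableSet.iInter fun s => MeasurableSet.iInter fun _ => MeasurableSet.iInter fun _ =>
      ?_
    exact measurableSet_preimage (hev s) (Set.toFinite (A ∪ B)ᶜ).measurableSet
  have hm2 : ∀ n : ℕ, MeasurableSet {x : ℕ → Config N q | x (n + 1) ∈ B} := fun n =>
    measurableSet_preimage (hev (n + 1)) (Set.toFinite B).measurableSet
  rw [hset, measure_iUnion _ fun n => (hm1 n).inter (hm2 n)]
  · refine tsum_congr fun n => ?_
    rw [← lintegral_chainLaw_killed, ← lintegral_indicator_one ((hm1 n).inter (hm2 n))]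
    refine lintegral_congr fun x => ?_
    rw [Set.inter_indicator_one]
    rfl
  · have key : ∀ m n : ℕ, m < n → Disjoint
        ({x : ℕ → Config N q | ∀ s, 0 < s → s < m + 1 → x s ∉ A ∪ B} ∩ {x | x (m + 1) ∈ B})
        ({x : ℕ → Config N q | ∀ s, 0 < s → s < n + 1 → x s ∉ A ∪ B} ∩ {x | x (n + 1) ∈ B}) := by
      intro m n hmn
      refine Set.disjoint_left.2 fun x hx hy => ?_
      exact hy.1 (m + 1) (Nat.succ_pos _) (by omega) (Or.inr hx.2)
    intro m n hmn
    rcases lt_or_gt_of_ne hmn with h | h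
    · exact key m n h
    · exact (key n m h).symm

/-! ### Reversibility and the Dirichlet principle -/

/-- The unnormalised Gibbs weight. -/
def weight {N q : ℕ} (β : ℝ≥0) (H : Config N q → ℝ) (σ : Config N q) : ℝ :=
  Real.exp (-β * H σ)

/-- The total weight of a set of configurations. -/
def setWeight {N q : ℕ} (β : ℝ≥0) (H : Config N q → ℝ) (A : Set (Config N q)) : ℝ :=
  ∑ σ, A.indicator (weight β H) σ

/-- The conductance of an edge of the Hamming graph. -/
def conductance {N q : ℕ} (β : ℝ≥0) (H : Config N q → ℝ) (σ η : Config N q) : ℝ :=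
  if hammingDist σ η = 1 then ((N : ℝ) * q)⁻¹ * Real.exp (-β * max (H σ) (H η)) else 0

/-- The unnormalised Dirichlet form of the chain. -/
def dirichletForm {N q : ℕ} (β : ℝ≥0) (H : Config N q → ℝ) (f : Config N q → ℝ) : ℝ :=
  1 / 2 * ∑ σ, ∑ η, conductance β H σ η * (f σ - f η) ^ 2

section

variable {N q : ℕ} (β : ℝ≥0) (H : Config N q → ℝ)

theorem weight_pos (σ : Config N q) : 0 < weight β H σ := Real.exp_pos _

theorem conductance_nonneg (σ η : Config N q) : 0 ≤ conductance β H σ η := by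
  unfold conductance
  split_ifs <;> positivity

theorem conductance_comm (σ η : Config N q) : conductance β H σ η = conductance β H η σ := by
  unfold conductance
  rw [hammingDist_comm, max_comm]

/-- Detailed balance: the energy paid by the Metropolis rate lifts `H σ` exactly to the larger of
the two energies, which is symmetric. -/
theorem weight_mul_flipProb (σ η : Config N q) :
    weight β H σ * flipProb β H σ η = conductance β H σ η := by
  unfold weight flipProb conductance
  split_ifs
  · rw [mul_left_comm, ← Real.exp_add]
    congr 2
    have : max (H σ) (H η) = H σ + max 0 (H η - H σ) := by
      rw [← max_add_add_left]; simp
    rw [this]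
    ring
  · simp

theorem dirichletForm_nonneg (f : Config N q → ℝ) : 0 ≤ dirichletForm β H f := by
  unfold dirichletForm
  have : 0 ≤ ∑ σ, ∑ η, conductance β H σ η * (f σ - f η) ^ 2 :=
    Finset.sum_nonneg fun σ _ => Finset.sum_nonneg fun η _ =>
      mul_nonneg (conductance_nonneg β H σ η) (sq_nonneg _)
  positivity

theorem weight_le_setWeight {A : Set (Config N q)} {σ : Config N q} (hσ : σ ∈ A) :
    weight β H σ ≤ setWeight β H A := by
  have := Finset.single_le_sum (f := fun σ => A.indicator (weight β H) σ)
    (fun σ _ => Set.indicator_nonneg (fun σ _ => (weight_pos β H σ).le) σ) (Finset.mem_univ σ)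
  simpa [setWeight, Set.indicator_of_mem hσ] using this

theorem setWeight_pos {A : Set (Config N q)} (hA : A.Nonempty) : 0 < setWeight β H A :=
  (weight_pos β H _).trans_le (weight_le_setWeight β H hA.some_mem)

theorem weight_mul_generator (g : Config N q → ℝ) (σ : Config N q) :
    weight β H σ * (g σ - ∑ η, transProb β H σ η * g η) =
      ∑ η, conductance β H σ η * (g σ - g η) := by
  have h1 : g σ - ∑ η, transProb β H σ η * g η = ∑ η, transProb β H σ η * (g σ - g η) := by
    simp only [mul_sub, Finset.sum_sub_distrib, ← Finset.sum_mul, sum_transProb, one_mul]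
  rw [h1, Finset.mul_sum]
  refine Finset.sum_congr rfl fun η _ => ?_
  by_cases h : σ = η
  · simp [h]
  · rw [transProb, if_neg h, ← mul_assoc, weight_mul_flipProb]

/-- Discrete Green formula, obtained by exchanging the ends of each edge. -/
theorem sum_mul_generator (f g : Config N q → ℝ) :
    ∑ σ, f σ * ∑ η, conductance β H σ η * (g σ - g η) =
      1 / 2 * ∑ σ, ∑ η, conductance β H σ η * ((f σ - f η) * (g σ - g η)) := by
  have h1 : ∑ σ, f σ * ∑ η, conductance β H σ η * (g σ - g η) =
      ∑ σ, ∑ η, conductance β H σ η * (f σ * (g σ - g η)) := by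
    simp only [Finset.mul_sum]
    refine Finset.sum_congr rfl fun σ _ => Finset.sum_congr rfl fun η _ => by ring
  have h2 : ∑ σ, ∑ η, conductance β H σ η * (f σ * (g σ - g η)) =
      ∑ σ, ∑ η, conductance β H σ η * (f η * (g η - g σ)) := by
    rw [Finset.sum_comm]
    refine Finset.sum_congr rfl fun σ _ => Finset.sum_congr rfl fun η _ => ?_
    rw [conductance_comm]
  have h3 : ∑ σ, ∑ η, conductance β H σ η * ((f σ - f η) * (g σ - g η)) =
      ∑ σ, ∑ η, conductance β H σ η * (f σ * (g σ - g η)) +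
      ∑ σ, ∑ η, conductance β H σ η * (f η * (g η - g σ)) := by
    rw [← Finset.sum_add_distrib]
    refine Finset.sum_congr rfl fun σ _ => ?_
    rw [← Finset.sum_add_distrib]
    exact Finset.sum_congr rfl fun η _ => by ring
  rw [h1, h3, ← h2]
  ring

/-- Cauchy–Schwarz for the Dirichlet form. -/
theorem sq_dirichlet_le (f g : Config N q → ℝ) :
    (1 / 2 * ∑ σ, ∑ η, conductance β H σ η * ((f σ - f η) * (g σ - g η))) ^ 2 ≤
      dirichletForm β H f * dirichletForm β H g := by
  have h := Finset.sum_mul_sq_le_sq_mul_sq (Finset.univ : Finset (Config N q × Config N q))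
    (fun p => √(conductance β H p.1 p.2) * (f p.1 - f p.2))
    (fun p => √(conductance β H p.1 p.2) * (g p.1 - g p.2))
  have e1 : ∀ f g : Config N q → ℝ, ∑ p : Config N q × Config N q,
      √(conductance β H p.1 p.2) * (f p.1 - f p.2) * (√(conductance β H p.1 p.2) *
        (g p.1 - g p.2)) = ∑ σ, ∑ η, conductance β H σ η * ((f σ - f η) * (g σ - g η)) := by
    intro f g
    rw [Fintype.sum_prod_type]
    refine Finset.sum_congr rfl fun σ _ => Finset.sum_congr rfl fun η _ => ?_
    have := Real.mul_self_sqrt (conductance_nonneg β H σ η)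
    linear_combination ((f σ - f η) * (g σ - g η)) * this
  have e2 : ∀ f : Config N q → ℝ, ∑ p : Config N q × Config N q,
      (√(conductance β H p.1 p.2) * (f p.1 - f p.2)) ^ 2 =
        ∑ σ, ∑ η, conductance β H σ η * (f σ - f η) ^ 2 := by
    intro f
    simp only [sq]
    exact e1 f f
  rw [e1, e2, e2] at h
  unfold dirichletForm
  linarith

/-- The equilibrium potential: the probability of hitting `B` before `A`. -/
theorem exists_harmonic {A B : Set (Config N q)} (hAB : Disjoint A B) :
    ∃ u : Config N q → ℝ, (∀ σ ∈ A, u σ = 0) ∧ (∀ σ ∈ B, u σ = 1) ∧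
      (∀ σ, 0 ≤ u σ) ∧
      (∀ σ ∉ A ∪ B, u σ = ∑ η, transProb β H σ η * u η) ∧
      ∀ (ν : Measure (Config N q)) [IsProbabilityMeasure ν],
        chainLaw β H ν {x | returnTime B x < returnTime A x} =
          ∫⁻ σ, ENNReal.ofReal (∑ η, transProb β H σ η * u η) ∂ν := by
  classical
  set Q : (Config N q → ℝ) → Config N q → ℝ := fun g =>
    (A ∪ B)ᶜ.indicator fun σ => ∑ η, transProb β H σ η * g η with hQ
  -- `b n σ` is the probability that the chain from `σ`, with time 0 counted, first meets `A ∪ B` at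
  -- time `n` and does so in `B`. The potential is the sum over `n`; its partial sums stay below 1
  -- by induction.
  set b : ℕ → Config N q → ℝ := fun n => Q^[n] (B.indicator 1) with hb
  have hb0 : b 0 = B.indicator 1 := rfl
  have hbs : ∀ n, b (n + 1) = Q (b n) := fun n => Function.iterate_succ_apply' Q n _
  have hQout : ∀ g, ∀ σ ∉ A ∪ B, Q g σ = ∑ η, transProb β H σ η * g η := fun g σ h =>
    Set.indicator_of_mem (s := (A ∪ B)ᶜ) h _
  have hQin : ∀ g, ∀ σ ∈ A ∪ B, Q g σ = 0 := fun g σ h =>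
    Set.indicator_of_notMem (s := (A ∪ B)ᶜ) (not_not.2 h) _
  have hnn : ∀ n σ, 0 ≤ b n σ := by
    intro n
    induction n with
    | zero => exact fun σ => Set.indicator_nonneg (fun _ _ => zero_le_one) σ
    | succ n ih =>
      intro σ
      rw [hbs]
      exact Set.indicator_nonneg (fun σ _ => Finset.sum_nonneg fun η _ =>
        mul_nonneg (transProb_nonneg β H σ η) (ih η)) σ
  have hPsum : ∀ (s : Finset ℕ) σ, ∑ n ∈ s, ∑ η, transProb β H σ η * b n η =
      ∑ η, transProb β H σ η * ∑ n ∈ s, b n η := by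
    intro s σ
    rw [Finset.sum_comm]
    simp only [Finset.mul_sum]
  have hpart : ∀ n σ, ∑ k ∈ Finset.range n, b k σ ≤ 1 := by
    intro n
    induction n with
    | zero => simp
    | succ n ih =>
      intro σ
      rw [Finset.sum_range_succ', hb0]
      by_cases h : σ ∈ A ∪ B
      · have : ∑ k ∈ Finset.range n, b (k + 1) σ = 0 :=
          Finset.sum_eq_zero fun k _ => by rw [hbs, hQin _ _ h]
        rw [this, zero_add]
        exact Set.indicator_le_self' (by simp) σ |>.trans (by simp)
      · have h2 : σ ∉ B := fun h' => h (Or.inr h')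
        rw [Set.indicator_of_notMem h2, add_zero]
        calc ∑ k ∈ Finset.range n, b (k + 1) σ
            = ∑ k ∈ Finset.range n, ∑ η, transProb β H σ η * b k η :=
              Finset.sum_congr rfl fun k _ => by rw [hbs, hQout _ _ h]
          _ = ∑ η, transProb β H σ η * ∑ k ∈ Finset.range n, b k η := hPsum _ _
          _ ≤ ∑ η, transProb β H σ η * 1 := Finset.sum_le_sum fun η _ =>
              mul_le_mul_of_nonneg_left (ih η) (transProb_nonneg β H σ η)
          _ = 1 := by simp [sum_transProb]
  have hsum : ∀ σ, Summable fun n => b n σ := fun σ =>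
    summable_of_sum_range_le (fun n => hnn n σ) (fun n => hpart n σ)
  have hPu : ∀ σ, HasSum (fun n => ∑ η, transProb β H σ η * b n η)
      (∑ η, transProb β H σ η * ∑' n, b n η) := fun σ =>
    hasSum_sum fun η _ => (hsum η).hasSum.mul_left _
  refine ⟨fun σ => ∑' n, b n σ, ?_, ?_, ?_, ?_, ?_⟩
  · intro σ hσ
    have : ∀ n, b n σ = 0 := by
      rintro (_ | n)
      · exact Set.indicator_of_notMem (Set.disjoint_left.1 hAB hσ) _
      · rw [hbs, hQin _ _ (Or.inl hσ)]
    simp [this]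
  · intro σ hσ
    change ∑' n, b n σ = 1
    rw [(hsum σ).tsum_eq_zero_add, hb0, Set.indicator_of_mem hσ]
    have : ∀ n, b (n + 1) σ = 0 := fun n => by rw [hbs, hQin _ _ (Or.inr hσ)]
    simp [this]
  · exact fun σ => tsum_nonneg fun n => hnn n σ
  · intro σ hσ
    change ∑' n, b n σ = _
    rw [(hsum σ).tsum_eq_zero_add, hb0, Set.indicator_of_notMem (fun h => hσ (Or.inr h)), zero_add,
      ← (hPu σ).tsum_eq]
    exact tsum_congr fun n => by rw [hbs, hQout _ _ hσ]
  · intro ν _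
    have hconv : ∀ (g : Config N q → ℝ), (∀ σ, 0 ≤ g σ) → ∀ σ,
        ∫⁻ η, ENNReal.ofReal (g η) ∂(stepKernel β H σ) =
          ENNReal.ofReal (∑ η, transProb β H σ η * g η) := by
      intro g hg σ
      rw [lintegral_stepKernel, ENNReal.ofReal_sum_of_nonneg fun η _ =>
        mul_nonneg (transProb_nonneg β H σ η) (hg η)]
      exact Finset.sum_congr rfl fun η _ =>
        (ENNReal.ofReal_mul (transProb_nonneg β H σ η)).symm
    have hk : ∀ n, (killedStep β H (A ∪ B))^[n] (B.indicator 1) =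
        fun σ => ENNReal.ofReal (b n σ) := by
      intro n
      induction n with
      | zero =>
        funext σ
        change B.indicator 1 σ = ENNReal.ofReal (B.indicator 1 σ)
        by_cases h : σ ∈ B <;> simp [h]
      | succ n ih =>
        rw [Function.iterate_succ_apply', ih]
        funext σ
        rw [hbs]
        by_cases h : σ ∈ A ∪ B
        · rw [hQin _ _ h, killedStep, Set.indicator_of_notMem (s := (A ∪ B)ᶜ) (not_not.2 h),
            ENNReal.ofReal_zero]
        · rw [hQout _ _ h, killedStep, Set.indicator_of_mem (s := (A ∪ B)ᶜ) h,
            hconv _ (hnn n)]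
    rw [chainLaw_returnTime_lt β H ν hAB, ← lintegral_tsum fun n =>
      (measurable_of_countable _).aemeasurable]
    refine lintegral_congr fun σ => ?_
    simp only [hk, hconv _ (hnn _)]
    rw [← (hPu σ).tsum_eq, ENNReal.ofReal_tsum_of_nonneg _ (hPu σ).summable]
    exact fun n => Finset.sum_nonneg fun η _ => mul_nonneg (transProb_nonneg β H σ η) (hnn n η)

theorem partitionFunction_pos [Nonempty (Config N q)] : 0 < partitionFunction β H :=
  Finset.sum_pos (fun _ _ => Real.exp_pos _) Finset.univ_nonempty

theorem lintegral_gibbs (g : Config N q → ℝ≥0∞) :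
    ∫⁻ σ, g σ ∂(gibbs β H) =
      ∑ σ, ENNReal.ofReal (weight β H σ / partitionFunction β H) * g σ := by
  rw [gibbs, lintegral_finsetSum_measure]
  simp [weight]

theorem gibbs_apply [Nonempty (Config N q)] (A : Set (Config N q)) :
    gibbs β H A = ENNReal.ofReal (setWeight β H A / partitionFunction β H) := by
  classical
  have hZ := partitionFunction_pos β H
  rw [← lintegral_indicator_one (Set.toFinite A).measurableSet, lintegral_gibbs, setWeight,
    Finset.sum_div, ENNReal.ofReal_sum_of_nonneg]
  · refine Finset.sum_congr rfl fun σ _ => ?_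
    by_cases h : σ ∈ A <;> simp [h]
  · exact fun σ _ => div_nonneg (Set.indicator_nonneg (fun σ _ => (weight_pos β H σ).le) σ) hZ.le

theorem lintegral_cond_gibbs {A : Set (Config N q)} (hA : A.Nonempty) (g : Config N q → ℝ)
    (hg : ∀ σ, 0 ≤ g σ) :
    ∫⁻ σ, ENNReal.ofReal (g σ) ∂(cond (gibbs β H) A) =
      ENNReal.ofReal ((∑ σ, A.indicator (fun σ => weight β H σ * g σ) σ) / setWeight β H A) := by
  classical
  have : Nonempty (Config N q) := ⟨hA.some⟩
  have hZ := partitionFunction_pos β H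
  have hW := setWeight_pos β H hA
  have hAm := (Set.toFinite A).measurableSet
  rw [ProbabilityTheory.cond, lintegral_smul_measure, gibbs_apply, ← lintegral_indicator hAm,
    lintegral_gibbs,
    ← ENNReal.ofReal_inv_of_pos (by positivity)]
  have h1 : ∑ σ, ENNReal.ofReal (weight β H σ / partitionFunction β H) *
      A.indicator (fun σ => ENNReal.ofReal (g σ)) σ =
      ENNReal.ofReal (∑ σ, A.indicator (fun σ => weight β H σ * g σ) σ /
        partitionFunction β H) := by
    rw [ENNReal.ofReal_sum_of_nonneg]
    · refine Finset.sum_congr rfl fun σ _ => ?_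
      by_cases h : σ ∈ A
      · simp only [Set.indicator_of_mem h]
        rw [← ENNReal.ofReal_mul (div_nonneg (weight_pos β H σ).le hZ.le)]
        congr 1
        ring
      · simp [h]
    · exact fun σ _ => div_nonneg (Set.indicator_nonneg (fun σ _ =>
        mul_nonneg (weight_pos β H σ).le (hg σ)) σ) hZ.le
  rw [h1, ← Finset.sum_div, smul_eq_mul, ← ENNReal.ofReal_mul (by positivity)]
  congr 1
  field_simp

theorem isProbabilityMeasure_cond_gibbs {A : Set (Config N q)} (hA : A.Nonempty) :
    IsProbabilityMeasure (cond (gibbs β H) A) := by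
  have : Nonempty (Config N q) := ⟨hA.some⟩
  refine cond_isProbabilityMeasure_of_finite ?_ ?_
  · rw [gibbs_apply, Ne, ENNReal.ofReal_eq_zero, not_le]
    exact div_pos (setWeight_pos β H hA) (partitionFunction_pos β H)
  · rw [gibbs_apply]
    exact ENNReal.ofReal_ne_top

/-- Dirichlet principle: the escape probability is the minimum of the Dirichlet form over the
functions that are `1` on `A` and `0` on `B`, divided by the weight of `A`. -/
theorem exists_escapeProb_eq {A B : Set (Config N q)} (hA : A.Nonempty) (hAB : Disjoint A B) :
    ∃ v : Config N q → ℝ, (∀ σ ∈ A, v σ = 1) ∧ (∀ σ ∈ B, v σ = 0) ∧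
      escapeProb β H A B = ENNReal.ofReal (dirichletForm β H v / setWeight β H A) ∧
      ∀ f : Config N q → ℝ, (∀ σ ∈ A, f σ = 1) → (∀ σ ∈ B, f σ = 0) →
        dirichletForm β H v ≤ dirichletForm β H f := by
  obtain ⟨u, huA, huB, hu0, hharm, hesc⟩ := exists_harmonic β H hAB
  have hprob := isProbabilityMeasure_cond_gibbs β H hA
  set v : Config N q → ℝ := fun σ => 1 - u σ with hv
  set cap := ∑ σ, A.indicator (fun σ => weight β H σ * ∑ η, transProb β H σ η * u η) σ with hcap
  have hPu : ∀ σ, 0 ≤ ∑ η, transProb β H σ η * u η := fun σ => Finset.sum_nonneg fun η _ =>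
    mul_nonneg (transProb_nonneg β H σ η) (hu0 η)
  have hPv : ∀ σ, ∑ η, transProb β H σ η * v η = 1 - ∑ η, transProb β H σ η * u η := by
    intro σ
    simp only [hv, mul_sub, mul_one, Finset.sum_sub_distrib, sum_transProb]
  -- By Green's formula and the harmonicity of `v` off `A ∪ B`, the pairing with `v` sees only the
  -- boundary values of `f`. Taking `f = v` identifies the energy of `v` with `cap`; for other `f`,
  -- Cauchy–Schwarz gives `cap ^ 2 ≤ D(f) * cap`, D being the Dirichlet form.
  have key : ∀ f : Config N q → ℝ, (∀ σ ∈ A, f σ = 1) → (∀ σ ∈ B, f σ = 0) →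
      1 / 2 * ∑ σ, ∑ η, conductance β H σ η * ((f σ - f η) * (v σ - v η)) = cap := by
    intro f hfA hfB
    rw [← sum_mul_generator, hcap]
    refine Finset.sum_congr rfl fun σ _ => ?_
    rw [← weight_mul_generator, hPv]
    by_cases h1 : σ ∈ A
    · rw [Set.indicator_of_mem h1, hfA σ h1]
      simp only [hv, huA σ h1]
      ring
    rw [Set.indicator_of_notMem h1]
    by_cases h2 : σ ∈ B
    · rw [hfB σ h2, zero_mul]
    · simp only [hv]
      rw [← hharm σ (by simp [h1, h2])]
      ring
  have hvA : ∀ σ ∈ A, v σ = 1 := fun σ h => by simp [hv, huA σ h]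
  have hvB : ∀ σ ∈ B, v σ = 0 := fun σ h => by simp [hv, huB σ h]
  have hDv : dirichletForm β H v = cap := by
    rw [← key v hvA hvB, dirichletForm]
    simp only [sq]
  refine ⟨v, hvA, hvB, ?_, fun f hfA hfB => ?_⟩
  · rw [escapeProb, hesc, lintegral_cond_gibbs β H hA _ hPu, hDv]
  · have h1 := sq_dirichlet_le β H f v
    rw [key f hfA hfB, hDv] at h1
    rw [hDv]
    have h0 : 0 ≤ cap := hDv ▸ dirichletForm_nonneg β H v
    rcases h0.eq_or_lt with h | h
    · rw [← h]
      exact dirichletForm_nonneg β H f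
    · nlinarith

end

/-! ### Stability of metastability under perturbations of the Hamiltonian -/

section

variable {N q : ℕ} (β : ℝ≥0) {H H' : Config N q → ℝ} {δ : ℝ}

theorem exp_neg_mul_le_of_sub_le {a b : ℝ} (h : a - b ≤ δ) :
    Real.exp (-β * b) ≤ Real.exp (β * δ) * Real.exp (-β * a) := by
  rw [← Real.exp_add, Real.exp_le_exp]
  nlinarith [β.coe_nonneg]

theorem setWeight_le_of_close (h : ∀ σ, |H σ - H' σ| ≤ δ) (A : Set (Config N q)) :
    setWeight β H' A ≤ Real.exp (β * δ) * setWeight β H A := by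
  classical
  unfold setWeight
  rw [Finset.mul_sum]
  refine Finset.sum_le_sum fun σ _ => ?_
  by_cases hσ : σ ∈ A
  · simp only [Set.indicator_of_mem hσ]
    exact exp_neg_mul_le_of_sub_le β (abs_le.1 (h σ)).2
  · simp [hσ]

theorem conductance_le_of_close (h : ∀ σ, |H σ - H' σ| ≤ δ) (σ η : Config N q) :
    conductance β H' σ η ≤ Real.exp (β * δ) * conductance β H σ η := by
  unfold conductance
  split_ifs
  · have hmax : max (H σ) (H η) - max (H' σ) (H' η) ≤ δ := by
      have h1 := (abs_le.1 (h σ)).2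
      have h2 := (abs_le.1 (h η)).2
      have h3 := le_max_left (H' σ) (H' η)
      have h4 := le_max_right (H' σ) (H' η)
      rw [sub_le_iff_le_add]
      exact max_le (by linarith) (by linarith)
    have := exp_neg_mul_le_of_sub_le β hmax
    calc ((N : ℝ) * q)⁻¹ * Real.exp (-β * max (H' σ) (H' η))
        ≤ ((N : ℝ) * q)⁻¹ * (Real.exp (β * δ) * Real.exp (-β * max (H σ) (H η))) := by gcongr
      _ = _ := by ring
  · simp

theorem dirichletForm_le_of_close (h : ∀ σ, |H σ - H' σ| ≤ δ) (f : Config N q → ℝ) :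
    dirichletForm β H' f ≤ Real.exp (β * δ) * dirichletForm β H f := by
  unfold dirichletForm
  rw [mul_left_comm, Finset.mul_sum]
  simp only [Finset.mul_sum]
  refine Finset.sum_le_sum fun σ _ => Finset.sum_le_sum fun η _ => ?_
  have := mul_le_mul_of_nonneg_right (conductance_le_of_close β h σ η) (sq_nonneg (f σ - f η))
  linarith

/-- The minimiser for `H` is a competitor for `H'`. One factor exp(βδ) comes from the Dirichlet
form, the other from the weight of `A` in the denominator. -/
theorem escapeProb_le_of_close (h : ∀ σ, |H σ - H' σ| ≤ δ) {A B : Set (Config N q)}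
    (hA : A.Nonempty) (hAB : Disjoint A B) :
    escapeProb β H' A B ≤ ENNReal.ofReal (Real.exp (2 * (β * δ))) * escapeProb β H A B := by
  obtain ⟨v, hvA, hvB, hv, -⟩ := exists_escapeProb_eq β H hA hAB
  obtain ⟨v', -, -, hv', hmin⟩ := exists_escapeProb_eq β H' hA hAB
  have h' : ∀ σ, |H' σ - H σ| ≤ δ := fun σ => by rw [abs_sub_comm]; exact h σ
  rw [hv, hv', ← ENNReal.ofReal_mul (Real.exp_pos _).le]
  refine ENNReal.ofReal_le_ofReal ?_
  have h1 : dirichletForm β H' v' ≤ Real.exp (β * δ) * dirichletForm β H v :=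
    (hmin v hvA hvB).trans (dirichletForm_le_of_close β h v)
  have h2 := setWeight_le_of_close β h' A
  have hW := setWeight_pos β H hA
  have hW' := setWeight_pos β H' hA
  rw [mul_div_assoc', div_le_div_iff₀ hW' hW, two_mul, Real.exp_add]
  have hD := dirichletForm_nonneg β H v
  calc dirichletForm β H' v' * setWeight β H A
      ≤ (Real.exp (β * δ) * dirichletForm β H v) * (Real.exp (β * δ) * setWeight β H' A) := by
        gcongr
    _ = _ := by ring

/-- The numerator and the denominator each move by at most exp(2βδ); the latter bound is uniform in
`X` and so passes to the infimum. -/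
theorem IsMetastable.of_close {ι : Type*} {I : Finset ι} {M : ι → Set (Config N q)} {ρ : ℝ}
    (hM : IsMetastable β H I M ρ) (h : ∀ σ, |H σ - H' σ| ≤ δ) :
    IsMetastable β H' I M (Real.exp (4 * (β * δ)) * ρ) := by
  obtain ⟨hne, hdisj, hle⟩ := hM
  refine ⟨hne, hdisj, ?_⟩
  set K : ℝ≥0∞ := ENNReal.ofReal (Real.exp (2 * (β * δ))) with hK
  have hK0 : K ≠ 0 := by rw [hK]; simp [Real.exp_pos]
  have hKtop : K ≠ ⊤ := ENNReal.ofReal_ne_top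
  have h' : ∀ σ, |H' σ - H σ| ≤ δ := fun σ => by rw [abs_sub_comm]; exact h σ
  set U := ⋃ i ∈ I, M i with hU
  have hnum : (⨆ j ∈ I, escapeProb β H' (M j) (U \ M j)) ≤
      K * ⨆ j ∈ I, escapeProb β H (M j) (U \ M j) := by
    refine iSup₂_le fun j hj => ?_
    refine (escapeProb_le_of_close β h (hne j hj) Set.disjoint_sdiff_right).trans ?_
    gcongr
    exact le_iSup₂ (f := fun j _ => escapeProb β H (M j) (U \ M j)) j hj
  have hden : K⁻¹ * (⨅ (X : Set (Config N q)) (_ : X.Nonempty ∧ X ⊆ Uᶜ), escapeProb β H X U) ≤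
      ⨅ (X : Set (Config N q)) (_ : X.Nonempty ∧ X ⊆ Uᶜ), escapeProb β H' X U := by
    refine le_iInf₂ fun X hX => ?_
    have h1 := escapeProb_le_of_close β h' (B := U) hX.1 (Set.disjoint_left.2 hX.2)
    rw [mul_comm, ← div_eq_mul_inv]
    refine ENNReal.div_le_of_le_mul' (le_trans ?_ h1)
    exact iInf₂_le X hX
  calc _ ≤ (I.card : ℝ≥0∞) * (K * ⨆ j ∈ I, escapeProb β H (M j) (U \ M j)) /
        (K⁻¹ * (⨅ (X : Set (Config N q)) (_ : X.Nonempty ∧ X ⊆ Uᶜ), escapeProb β H X U)) := by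
        gcongr
    _ = (K * K) * ((I.card : ℝ≥0∞) * (⨆ j ∈ I, escapeProb β H (M j) (U \ M j)) /
        (⨅ (X : Set (Config N q)) (_ : X.Nonempty ∧ X ⊆ Uᶜ), escapeProb β H X U)) := by
        rw [div_eq_mul_inv, ENNReal.mul_inv (Or.inl (ENNReal.inv_ne_zero.2 hKtop))
          (Or.inl (ENNReal.inv_ne_top.2 hK0)), inv_inv, div_eq_mul_inv]
        ring
    _ ≤ (K * K) * ENNReal.ofReal ρ := by gcongr
    _ = ENNReal.ofReal (Real.exp (4 * (β * δ)) * ρ) := by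
        rw [hK, ← ENNReal.ofReal_mul (Real.exp_pos _).le, ← Real.exp_add,
          ← ENNReal.ofReal_mul (Real.exp_pos _).le]
        congr 3
        ring

end

/-! ### Uniform concentration of the disordered Hamiltonian -/

/-- Chernoff bound for both tails with one exponent `l`. Bounding each factor by exp(lδ) lets `n`
replace the number of summands. -/
theorem measure_abs_sum_ge_le {Ω ι : Type*} [MeasurableSpace Ω] (P : Measure Ω)
    [IsProbabilityMeasure P] {X : ι → Ω → ℝ} (hind : iIndepFun X P) (hm : ∀ i, Measurable (X i))
    {l δ : ℝ} (hl : 0 ≤ l) (hδ : 0 ≤ δ)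
    (hInt : ∀ i, Integrable (fun ω => Real.exp (l * X i ω)) P)
    (hInt' : ∀ i, Integrable (fun ω => Real.exp (-l * X i ω)) P)
    (hmgf : ∀ i, mgf (X i) P l ≤ Real.exp (l * δ))
    (hmgf' : ∀ i, mgf (X i) P (-l) ≤ Real.exp (l * δ)) (s : Finset ι) {n ε : ℝ}
    (hs : (s.card : ℝ) ≤ n) :
    P.real {ω | ε ≤ |∑ i ∈ s, X i ω|} ≤ 2 * Real.exp (-l * (ε - δ * n)) := by
  have hprod : ∀ t : ℝ, (∀ i, mgf (X i) P t ≤ Real.exp (l * δ)) →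
      mgf (∑ i ∈ s, X i) P t ≤ Real.exp (l * δ * n) := by
    intro t ht
    rw [hind.mgf_sum hm]
    calc ∏ i ∈ s, mgf (X i) P t ≤ ∏ _i ∈ s, Real.exp (l * δ) :=
          Finset.prod_le_prod (fun i _ => mgf_nonneg) fun i _ => ht i
      _ = Real.exp (l * δ * s.card) := by
          rw [Finset.prod_const, ← Real.exp_nat_mul, mul_comm]
      _ ≤ _ := Real.exp_le_exp.2 (mul_le_mul_of_nonneg_left hs (by positivity))
  have hsub : {ω | ε ≤ |∑ i ∈ s, X i ω|} ⊆
      {ω | ε ≤ (∑ i ∈ s, X i) ω} ∪ {ω | (∑ i ∈ s, X i) ω ≤ -ε} := by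
    intro ω hω
    have hω : ε ≤ |∑ i ∈ s, X i ω| := hω
    rcases le_abs.1 hω with h | h
    · left
      simpa using h
    · right
      change (∑ i ∈ s, X i) ω ≤ -ε
      rw [Finset.sum_apply]
      linarith
  have h1 := measure_ge_le_exp_mul_mgf (X := ∑ i ∈ s, X i) (μ := P) ε hl
    (hind.integrable_exp_mul_sum hm fun i _ => hInt i)
  have h2 := measure_le_le_exp_mul_mgf (X := ∑ i ∈ s, X i) (μ := P) (-ε) (neg_nonpos.2 hl)
    (hind.integrable_exp_mul_sum hm fun i _ => hInt' i)
  have e1 : Real.exp (-l * (ε - δ * n)) = Real.exp (-l * ε) * Real.exp (l * δ * n) := by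
    rw [← Real.exp_add]; ring_nf
  have e2 : Real.exp (-(-l) * -ε) = Real.exp (-l * ε) := by ring_nf
  rw [e2] at h2
  calc P.real {ω | ε ≤ |∑ i ∈ s, X i ω|}
      ≤ _ := measureReal_mono hsub
    _ ≤ _ := measureReal_union_le _ _
    _ ≤ Real.exp (-l * ε) * mgf (∑ i ∈ s, X i) P l +
        Real.exp (-l * ε) * mgf (∑ i ∈ s, X i) P (-l) := add_le_add h1 h2
    _ ≤ Real.exp (-l * ε) * Real.exp (l * δ * n) + Real.exp (-l * ε) * Real.exp (l * δ * n) := by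
        gcongr
        · exact hprod _ hmgf
        · exact hprod _ hmgf'
    _ = _ := by rw [e1]; ring

/-- The moment generating function of the centred variable has value 1 and derivative 0 at the
origin, so near it it is at most 1 + δ|t| ≤ exp(δ|t|). -/
theorem exists_mgf_le {Ω : Type*} [MeasurableSpace Ω] (P : Measure Ω) [IsProbabilityMeasure P]
    {X : Ω → ℝ} (hmean : ∫ ω, X ω ∂P = 1) (hexp : (0 : ℝ) ∈ interior (integrableExpSet X P))
    {δ : ℝ} (hδ : 0 < δ) :
    ∃ l : ℝ, 0 < l ∧ l ∈ integrableExpSet X P ∧ -l ∈ integrableExpSet X P ∧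
      mgf (fun ω => X ω + -1) P l ≤ Real.exp (l * δ) ∧
      mgf (fun ω => X ω + -1) P (-l) ≤ Real.exp (l * δ) := by
  have hd : HasDerivAt (fun t => mgf (fun ω => X ω + -1) P t) 0 0 := by
    have h1 := (differentiableAt_mgf hexp).hasDerivAt
    rw [deriv_mgf_zero hexp, hmean] at h1
    have h2 : HasDerivAt (fun t : ℝ => Real.exp (t * -1)) (Real.exp (0 * -1) * (1 * -1)) 0 :=
      ((hasDerivAt_id (0 : ℝ)).mul_const (-1)).exp
    have h3 := h1.mul h2
    simp only [mgf_zero, zero_mul, Real.exp_zero, one_mul, mul_one] at h3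
    have e : (fun t => mgf (fun ω => X ω + -1) P t) =
        mgf X P * fun t => Real.exp (t * -1) := funext fun t => mgf_add_const _
    rw [e]
    exact h3.congr_deriv (by norm_num)
  have hlit := (hasDerivAt_iff_isLittleO.1 hd).bound hδ
  have hnhds : ∀ᶠ t : ℝ in nhds 0, t ∈ integrableExpSet X P := mem_interior_iff_mem_nhds.1 hexp
  have hall := hlit.and hnhds
  obtain ⟨r, hr, hball⟩ := Metric.eventually_nhds_iff.1 hall
  have hle : ∀ t : ℝ, |t| < r → mgf (fun ω => X ω + -1) P t ≤ Real.exp (|t| * δ) := by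
    intro t ht
    have h1 := (hball (y := t) (by simpa [Real.dist_eq] using ht)).1
    simp only [mgf_zero, sub_zero, smul_zero, Real.norm_eq_abs] at h1
    have h2 := (abs_le.1 h1).2
    have h3 := Real.add_one_le_exp (|t| * δ)
    linarith
  have habs : |r / 2| = r / 2 := abs_of_pos (by positivity)
  refine ⟨r / 2, by positivity, (hball (by simp [abs_of_pos hr, hr])).2,
    (hball (by simp [abs_of_pos hr, hr])).2, ?_, ?_⟩
  · have := hle (r / 2) (by rw [habs]; linarith)
    rwa [habs] at this
  · have := hle (-(r / 2)) (by rw [abs_neg, habs]; linarith)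
    rwa [abs_neg, habs] at this

theorem hamiltonian_sub_meanField {N q : ℕ} (J : ℕ → ℕ → ℝ) (σ : Config N q) :
    hamiltonian J σ - meanFieldHamiltonian σ =
      -(1 / (N : ℝ)) * ∑ p ∈ (Finset.univ : Finset {p : Fin N × Fin N // p.1 < p.2}).filter
        (fun p => σ p.1.1 = σ p.1.2), (J p.1.1 p.1.2 + -1) := by
  unfold meanFieldHamiltonian hamiltonian
  rw [← mul_sub, ← Finset.sum_sub_distrib]
  congr 1
  simp only [← Finset.sum_sub_distrib]
  rw [← Fintype.sum_prod_type' (f := fun i j : Fin N =>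
    (if i < j ∧ σ i = σ j then J i j else 0) - if i < j ∧ σ i = σ j then (1 : ℝ) else 0),
    Finset.sum_filter, ← Finset.sum_subtype (Finset.univ.filter fun x : Fin N × Fin N => x.1 < x.2)
    (by simp) (fun a => if σ a.1 = σ a.2 then J a.1 a.2 + -1 else 0), Finset.sum_filter]
  refine Finset.sum_congr rfl fun x _ => ?_
  by_cases h1 : x.1 < x.2 <;> by_cases h2 : σ x.1 = σ x.2 <;> simp [h1, h2, sub_eq_add_neg]

/-- Almost surely, the disordered Hamiltonian is uniformly `ε N`-close to the mean-field one. -/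
theorem ae_eventually_hamiltonian_close {Ω : Type*} [MeasurableSpace Ω] (P : Measure Ω)
    [IsProbabilityMeasure P] (J : ℕ → ℕ → Ω → ℝ)
    (hJ_meas : ∀ i j, i < j → Measurable (J i j))
    (hJ_indep : iIndepFun (fun p : {p : ℕ × ℕ // p.1 < p.2} => J p.1.1 p.1.2) P)
    (hJ_ident : ∀ i j, i < j → IdentDistrib (J i j) (J 0 1) P P)
    (hJ_mean : ∫ ω, J 0 1 ω ∂P = 1)
    (hJ_exp : (0 : ℝ) ∈ interior (integrableExpSet (J 0 1) P)) (q : ℕ) {ε : ℝ} (hε : 0 < ε) :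
    ∀ᵐ ω ∂P, ∀ᶠ N : ℕ in atTop, ∀ σ : Config N q,
      |hamiltonian (fun i j => J i j ω) σ - meanFieldHamiltonian σ| ≤ ε * N := by
  -- Half of `ε` pays for the moment generating functions of at most `N ^ 2` summands; the other
  -- half remains as the rate `l * ε / 2`.
  obtain ⟨l, hl, hi, hi', hm, hm'⟩ := exists_mgf_le P hJ_mean hJ_exp (half_pos hε)
  set bad : ℕ → Set Ω := fun N => ⋃ σ : Config N q, {ω | ε * N ^ 2 ≤
    |∑ p ∈ (Finset.univ : Finset {p : Fin N × Fin N // p.1 < p.2}).filter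
        (fun p => σ p.1.1 = σ p.1.2), (J p.1.1 p.1.2 ω + -1)|} with hbad
  have hprob : ∀ N : ℕ, P (bad N) ≤
      ENNReal.ofReal (2 * ((q : ℝ) ^ N * Real.exp (-(l * ε / 2) * N ^ 2))) := by
    intro N
    have hinj : Function.Injective (fun p : {p : Fin N × Fin N // p.1 < p.2} =>
        (⟨((p.1.1 : ℕ), (p.1.2 : ℕ)), p.2⟩ : {p : ℕ × ℕ // p.1 < p.2})) := by
      rintro ⟨⟨a, b⟩, h⟩ ⟨⟨c, d⟩, h'⟩ hpq
      simpa [Fin.ext_iff] using hpq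
    have hind : iIndepFun (fun (p : {p : Fin N × Fin N // p.1 < p.2}) ω =>
        J p.1.1 p.1.2 ω + -1) P :=
      (hJ_indep.precomp hinj).comp (fun _ x => x + -1) fun _ => by fun_prop
    have hid : ∀ p : {p : Fin N × Fin N // p.1 < p.2},
        IdentDistrib (fun ω => J p.1.1 p.1.2 ω + -1) (fun ω => J 0 1 ω + -1) P P := fun p =>
      (hJ_ident _ _ p.2).comp (u := fun x => x + -1) (by fun_prop)
    have hInt : ∀ t ∈ integrableExpSet (J 0 1) P, ∀ p : {p : Fin N × Fin N // p.1 < p.2},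
        Integrable (fun ω => Real.exp (t * (J p.1.1 p.1.2 ω + -1))) P := by
      intro t ht p
      have h1 : Integrable (fun ω => Real.exp (t * J p.1.1 p.1.2 ω)) P :=
        (((hJ_ident _ _ p.2).comp (u := fun x => Real.exp (t * x)) (by fun_prop)).integrable_iff).2
          ht
      refine (h1.mul_const (Real.exp (-t))).congr (ae_of_all _ fun ω => ?_)
      change Real.exp (t * J p.1.1 p.1.2 ω) * Real.exp (-t) = _
      rw [← Real.exp_add]
      ring_nf
    have hσ : ∀ σ : Config N q, P {ω | ε * N ^ 2 ≤
        |∑ p ∈ (Finset.univ : Finset {p : Fin N × Fin N // p.1 < p.2}).filter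
        (fun p => σ p.1.1 = σ p.1.2), (J p.1.1 p.1.2 ω + -1)|} ≤
        ENNReal.ofReal (2 * Real.exp (-(l * ε / 2) * N ^ 2)) := by
      intro σ
      rw [← ofReal_measureReal]
      refine ENNReal.ofReal_le_ofReal ?_
      have hcard : (((Finset.univ : Finset {p : Fin N × Fin N // p.1 < p.2}).filter
          (fun p => σ p.1.1 = σ p.1.2)).card : ℝ) ≤ (N : ℝ) ^ 2 := by
        have h1 := Finset.card_filter_le (Finset.univ : Finset {p : Fin N × Fin N // p.1 < p.2})
          (fun p => σ p.1.1 = σ p.1.2)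
        have h2 : Fintype.card {p : Fin N × Fin N // p.1 < p.2} ≤ N ^ 2 := by
          refine (Fintype.card_subtype_le _).trans ?_
          simp [sq]
        exact_mod_cast h1.trans h2
      refine (measure_abs_sum_ge_le P hind (fun p => (hJ_meas _ _ p.2).add_const _) hl.le
        (half_pos hε).le (hInt l hi) (hInt (-l) hi') (fun p => ?_) (fun p => ?_) _ hcard).trans
        (le_of_eq ?_)
      · rw [mgf_congr_of_identDistrib _ _ (hid p)]
        exact hm
      · rw [mgf_congr_of_identDistrib _ _ (hid p)]
        exact hm'
      · congr 2
        ring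
    calc P (bad N) ≤ ∑ σ : Config N q, _ := measure_iUnion_fintype_le P _
      _ ≤ ∑ _σ : Config N q, ENNReal.ofReal (2 * Real.exp (-(l * ε / 2) * N ^ 2)) :=
          Finset.sum_le_sum fun σ _ => hσ σ
      _ = ENNReal.ofReal (2 * ((q : ℝ) ^ N * Real.exp (-(l * ε / 2) * N ^ 2))) := by
          rw [Finset.sum_const, nsmul_eq_mul, Finset.card_univ]
          simp only [Fintype.card_pi, Fintype.card_fin, Finset.prod_const, Finset.card_univ]
          rw [← ENNReal.ofReal_natCast, ← ENNReal.ofReal_mul (by positivity)]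
          congr 1
          push_cast
          ring
  have hsum : Summable fun N : ℕ => 2 * ((q : ℝ) ^ N * Real.exp (-(l * ε / 2) * N ^ 2)) := by
    refine Summable.mul_left 2 ?_
    have hc : 0 < l * ε / 2 := by positivity
    have ht : Tendsto (fun N : ℕ => (q : ℝ) * Real.exp (-(l * ε / 2) * N)) atTop
        (nhds (q * 0)) := by
      refine Tendsto.const_mul _ (Real.tendsto_exp_atBot.comp ?_)
      exact tendsto_natCast_atTop_atTop.const_mul_atTop_of_neg (neg_lt_zero.2 hc)
    rw [mul_zero] at ht
    -- The term is the `N`-th power of q exp(-lεN/2), a base that tends to 0, so a geometric series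
    -- dominates.
    refine Summable.of_norm_bounded_eventually_nat summable_geometric_two ?_
    filter_upwards [ht.eventually_le_const (by norm_num : (0 : ℝ) < 1 / 2)] with N hN
    rw [Real.norm_of_nonneg (by positivity)]
    calc (q : ℝ) ^ N * Real.exp (-(l * ε / 2) * N ^ 2)
        = ((q : ℝ) * Real.exp (-(l * ε / 2) * N)) ^ N := by
          rw [mul_pow, ← Real.exp_nat_mul]
          ring_nf
      _ ≤ (1 / 2) ^ N := pow_le_pow_left₀ (by positivity) hN N
  have hBC := ae_eventually_notMem (μ := P) (s := bad) (ne_top_of_le_ne_top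
    (by rw [← ENNReal.ofReal_tsum_of_nonneg (fun N => by positivity) hsum]
        exact ENNReal.ofReal_ne_top) (ENNReal.tsum_le_tsum hprob))
  filter_upwards [hBC] with ω hω
  filter_upwards [hω, eventually_gt_atTop 0] with N hN hN0 σ
  have h1 : ω ∉ {ω | ε * N ^ 2 ≤
    |∑ p ∈ (Finset.univ : Finset {p : Fin N × Fin N // p.1 < p.2}).filter
        (fun p => σ p.1.1 = σ p.1.2), (J p.1.1 p.1.2 ω + -1)|} := fun h =>
    hN (Set.mem_iUnion.2 ⟨σ, h⟩)
  have h2 : |∑ p ∈ (Finset.univ : Finset {p : Fin N × Fin N // p.1 < p.2}).filter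
        (fun p => σ p.1.1 = σ p.1.2), (J p.1.1 p.1.2 ω + -1)| < ε * N ^ 2 := not_le.1 h1
  have hN0 : (0 : ℝ) < N := by exact_mod_cast hN0
  rw [hamiltonian_sub_meanField, abs_mul, abs_neg, abs_of_pos (by positivity : 0 < 1 / (N : ℝ)),
    one_div, inv_mul_le_iff₀ hN0]
  nlinarith

theorem ae_eventually_metastableEvent {Ω : Type*} [MeasurableSpace Ω] (P : Measure Ω)
    [IsProbabilityMeasure P] (J : ℕ → ℕ → Ω → ℝ)
    (hJ_meas : ∀ i j, i < j → Measurable (J i j))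
    (hJ_indep : iIndepFun (fun p : {p : ℕ × ℕ // p.1 < p.2} => J p.1.1 p.1.2) P)
    (hJ_ident : ∀ i j, i < j → IdentDistrib (J i j) (J 0 1) P P)
    (hJ_mean : ∫ ω, J 0 1 ω ∂P = 1)
    (hJ_exp : (0 : ℝ) ∈ interior (integrableExpSet (J 0 1) P)) {q : ℕ} {β : ℝ≥0}
    {m : ℕ → Fin (q + 1) → Fin q → ℝ} {k₁ k₂ : ℝ} (hk : k₂ < k₁)
    (hmf : MeanFieldMetastable q β m k₁) :
    ∀ᵐ ω ∂P, ∀ᶠ N : ℕ in atTop, ω ∈ metastableEvent J q β m k₂ N := by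
  -- This tolerance makes 4βε at most `k₁ - k₂`; the summand 1 avoids division by zero at `β = 0`.
  have hε : 0 < (k₁ - k₂) / (4 * (β + 1)) := by
    have := sub_pos.2 hk
    positivity
  obtain ⟨N₀, hN₀⟩ := hmf
  filter_upwards [ae_eventually_hamiltonian_close P J hJ_meas hJ_indep hJ_ident hJ_mean hJ_exp q hε]
    with ω hω
  filter_upwards [hω, eventually_gt_atTop N₀] with N hN hNN
  have h1 := (hN₀ N hNN).of_close β (H' := hamiltonian fun i j => J i j ω)
    (fun σ => by rw [abs_sub_comm]; exact hN σ)
  refine ⟨h1.1, h1.2.1, h1.2.2.trans (ENNReal.ofReal_le_ofReal ?_)⟩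
  rw [← Real.exp_add, Real.exp_le_exp]
  have hb : (β : ℝ) * ((k₁ - k₂) / (4 * (β + 1))) * 4 ≤ k₁ - k₂ := by
    have hβ := β.coe_nonneg
    rw [show (β : ℝ) * ((k₁ - k₂) / (4 * (β + 1))) * 4 = (k₁ - k₂) * (β / (β + 1)) by field_simp]
    have : (β : ℝ) / (β + 1) ≤ 1 := by rw [div_le_one (by positivity)]; linarith
    nlinarith [sub_pos.2 hk]
  have hN0 : (0 : ℝ) ≤ N := Nat.cast_nonneg N
  nlinarith

/-! ### One-dimensional analysis of the free energy -/

/-- The contribution of one colour to the free energy. -/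
def colourEnergy (β x : ℝ) : ℝ := -(1 / 2) * x ^ 2 + 1 / β * (x * Real.log x)

theorem freeEnergy_eq_sum {q : ℕ} (β : ℝ) (x : Fin q → ℝ) :
    freeEnergy β x = ∑ k, colourEnergy β (x k) := by
  simp only [freeEnergy, colourEnergy, Finset.sum_add_distrib, Finset.mul_sum]

theorem continuous_colourEnergy (β : ℝ) : Continuous (colourEnergy β) := by
  unfold colourEnergy
  have := Real.continuous_mul_log
  fun_prop

theorem continuous_freeEnergy {q : ℕ} (β : ℝ) : Continuous (freeEnergy (q := q) β) := by
  have h : freeEnergy (q := q) β = fun x => ∑ k, colourEnergy β (x k) :=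
    funext fun x => freeEnergy_eq_sum β x
  rw [h]
  exact continuous_finsetSum _ fun k _ => (continuous_colourEnergy β).comp (continuous_apply k)

theorem hasDerivAt_colourEnergy (β : ℝ) {x : ℝ} (hx : x ≠ 0) :
    HasDerivAt (colourEnergy β) (-x + 1 / β * (Real.log x + 1)) x := by
  unfold colourEnergy
  have h1 := (hasDerivAt_pow 2 x).const_mul (-(1 / 2) : ℝ)
  have h2 := (Real.hasDerivAt_mul_log hx).const_mul (1 / β)
  refine (h1.add h2).congr_deriv ?_
  norm_num
  ring

theorem hasDerivAt_deriv_colourEnergy (β : ℝ) {x : ℝ} (hx : x ≠ 0) :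
    HasDerivAt (fun x => -x + 1 / β * (Real.log x + 1)) (-1 + 1 / β * x⁻¹) x :=
  (hasDerivAt_id x).neg.add (((Real.hasDerivAt_log hx).add_const 1).const_mul (1 / β))

/-- The second derivative -1 + 1/(βx) changes sign at 1/β. This inflection point separates small
coordinates, in the convex range, from large ones, in the concave range. -/
theorem strictMonoOn_deriv_colourEnergy {β : ℝ} (hβ : 0 < β) :
    StrictMonoOn (fun x => -x + 1 / β * (Real.log x + 1)) (Set.Ioc 0 (1 / β)) := by
  refine strictMonoOn_of_deriv_pos (convex_Ioc _ _) (fun x hx => ?_) fun x hx => ?_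
  · exact (hasDerivAt_deriv_colourEnergy β hx.1.ne').continuousAt.continuousWithinAt
  · rw [interior_Ioc] at hx
    rw [(hasDerivAt_deriv_colourEnergy β hx.1.ne').deriv]
    have h0 := hx.1
    have : β * x < 1 := by rw [← lt_div_iff₀' hβ]; exact hx.2
    have h2 : 1 < 1 / β * x⁻¹ := by
      rw [← one_div, one_div_mul_one_div, lt_div_iff₀ (by positivity)]; linarith
    linarith

theorem strictAntiOn_deriv_colourEnergy {β : ℝ} (hβ : 0 < β) :
    StrictAntiOn (fun x => -x + 1 / β * (Real.log x + 1)) (Set.Ioi (1 / β)) := by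
  have hp : 0 < 1 / β := by positivity
  refine strictAntiOn_of_deriv_neg (convex_Ioi _) (fun x hx => ?_) fun x hx => ?_
  · exact (hasDerivAt_deriv_colourEnergy β (hp.trans hx).ne').continuousAt.continuousWithinAt
  · rw [interior_Ioi] at hx
    have h0 : 0 < x := hp.trans hx
    rw [(hasDerivAt_deriv_colourEnergy β h0.ne').deriv]
    have : 1 < β * x := by rw [← div_lt_iff₀' hβ]; exact hx
    have h2 : 1 / β * x⁻¹ < 1 := by
      rw [← one_div, one_div_mul_one_div, div_lt_iff₀ (by positivity)]; linarith
    linarith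

theorem convexOn_colourEnergy {β : ℝ} (hβ : 0 < β) :
    ConvexOn ℝ (Set.Icc 0 (1 / β)) (colourEnergy β) := by
  refine MonotoneOn.convexOn_of_deriv (convex_Icc _ _) (continuous_colourEnergy β).continuousOn
    ?_ ?_
  · intro x hx
    rw [interior_Icc] at hx
    exact (hasDerivAt_colourEnergy β hx.1.ne').differentiableAt.differentiableWithinAt
  · rw [interior_Icc]
    refine MonotoneOn.congr (f₁ := fun x => -x + 1 / β * (Real.log x + 1)) ?_ fun x hx => ?_
    · exact (strictMonoOn_deriv_colourEnergy hβ).monotoneOn.mono Set.Ioo_subset_Ioc_self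
    · exact (hasDerivAt_colourEnergy β hx.1.ne').deriv.symm

theorem strictConcaveOn_colourEnergy {β : ℝ} (hβ : 0 < β) :
    StrictConcaveOn ℝ (Set.Ioi (1 / β)) (colourEnergy β) := by
  have hp : 0 < 1 / β := by positivity
  refine StrictAntiOn.strictConcaveOn_of_deriv (convex_Ioi _)
    (continuous_colourEnergy β).continuousOn ?_
  rw [interior_Ioi]
  refine StrictAntiOn.congr (strictAntiOn_deriv_colourEnergy hβ) fun x hx => ?_
  exact (hasDerivAt_colourEnergy β (hp.trans hx).ne').deriv.symm

/-- The function whose zeros are the candidates for the order parameter. -/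
def orderEq (q : ℕ) (β s : ℝ) : ℝ :=
  Real.log (1 + ((q : ℝ) - 1) * s) - Real.log (1 - s) - β * s

/-- The polynomial `(1 + (q-1) s) (1 - s)`; the derivative of `orderEq` is `q / disc - β`. -/
def disc (q : ℕ) (s : ℝ) : ℝ := (1 + ((q : ℝ) - 1) * s) * (1 - s)

theorem orderEq_zero (q : ℕ) (β : ℝ) : orderEq q β 0 = 0 := by simp [orderEq]

/-! ### Zeros and slopes of the order-parameter equation -/

section

variable {q : ℕ} {β : ℝ}

theorem one_le_cast_sub_one (hq : 2 ≤ q) : (1 : ℝ) ≤ (q : ℝ) - 1 := by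
  have : (2 : ℝ) ≤ q := by exact_mod_cast hq
  linarith

theorem one_add_mul_pos (hq : 2 ≤ q) {s : ℝ} (hs : 0 ≤ s) : 0 < 1 + ((q : ℝ) - 1) * s := by
  have := one_le_cast_sub_one hq
  positivity

theorem disc_pos (hq : 2 ≤ q) {s : ℝ} (hs : 0 ≤ s) (hs1 : s < 1) : 0 < disc q s :=
  mul_pos (one_add_mul_pos hq hs) (by linarith)

theorem hasDerivAt_orderEq (hq : 2 ≤ q) {s : ℝ} (hs : 0 ≤ s) (hs1 : s < 1) :
    HasDerivAt (orderEq q β) (q / disc q s - β) s := by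
  have h1 := one_add_mul_pos hq hs
  have h2 : 0 < 1 - s := by linarith
  have e1 : HasDerivAt (fun s : ℝ => 1 + ((q : ℝ) - 1) * s) ((q : ℝ) - 1) s := by
    simpa using ((hasDerivAt_id s).const_mul ((q : ℝ) - 1)).const_add 1
  have e2 : HasDerivAt (fun s : ℝ => 1 - s) (-1) s := by
    simpa using (hasDerivAt_id s).const_sub 1
  have e3 : HasDerivAt (fun s : ℝ => β * s) β s := by
    simpa using (hasDerivAt_id s).const_mul β
  refine (((e1.log h1.ne').sub (e2.log h2.ne')).sub e3).congr_deriv ?_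
  unfold disc
  field_simp
  ring

theorem continuousOn_orderEq (hq : 2 ≤ q) : ContinuousOn (orderEq q β) (Set.Ico 0 1) := fun _ hs =>
  (hasDerivAt_orderEq hq hs.1 hs.2).continuousAt.continuousWithinAt

theorem exists_orderEq_slope (hq : 2 ≤ q) {x y : ℝ} (hx : 0 ≤ x) (hxy : x < y) (hy : y < 1) :
    ∃ r, x < r ∧ r < y ∧
      orderEq q β y - orderEq q β x = (q / disc q r - β) * (y - x) := by
  obtain ⟨r, hr, h⟩ := exists_hasDerivAt_eq_slope (orderEq q β) (fun s => q / disc q s - β) hxy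
    ((continuousOn_orderEq hq).mono fun s hs => ⟨hx.trans hs.1, hs.2.trans_lt hy⟩)
    fun s hs => hasDerivAt_orderEq hq (hx.trans hs.1.le) (hs.2.trans hy)
  refine ⟨r, hr.1, hr.2, ?_⟩
  rw [h, div_mul_cancel₀ _ (by linarith)]

/-- A zero of `orderEq` that is not a downward crossing is the last zero. -/
theorem orderEq_zero_unique (hq : 2 ≤ q) {s t : ℝ} (hs : 0 < s) (hst : s < t) (ht : t < 1)
    (h0 : orderEq q β s = 0) (h1 : orderEq q β t = 0) : q / disc q s - β < 0 := by
  obtain ⟨r₁, h₁, h₁', e₁⟩ := exists_orderEq_slope hq (β := β) le_rfl hs (hst.trans ht)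
  obtain ⟨r₂, h₂, h₂', e₂⟩ := exists_orderEq_slope hq (β := β) hs.le hst ht
  rw [orderEq_zero, h0, sub_self, eq_comm, mul_eq_zero, or_iff_left (by linarith)] at e₁
  rw [h0, h1, sub_self, eq_comm, mul_eq_zero, or_iff_left (by linarith)] at e₂
  have p₁ := disc_pos hq h₁.le (h₁'.trans (hst.trans ht))
  have p₂ := disc_pos hq (hs.trans h₂).le (h₂'.trans ht)
  have p := disc_pos hq hs.le (hst.trans ht)
  have hq1 := one_le_cast_sub_one hq
  have hqpos : (0 : ℝ) < q := by linarith
  have d₁ : disc q r₁ * β = q := by field_simp at e₁; linarith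
  have d₂ : disc q r₂ * β = q := by field_simp at e₂; linarith
  have hβ : 0 < β := by
    rcases pos_and_pos_or_neg_and_neg_of_mul_pos (d₁ ▸ hqpos : 0 < disc q r₁ * β) with h | h
    · exact h.2
    · linarith [h.1]
  have d : disc q r₁ = disc q r₂ := mul_right_cancel₀ hβ.ne' (d₁.trans d₂.symm)
  -- The critical points `r₁ < s < r₂` given by Rolle have equal `disc`. So the concave parabola
  -- `disc` is symmetric about their midpoint and larger at `s`, which makes the slope at `s`
  -- negative.
  have hsum : (q : ℝ) - 1 - 1 = ((q : ℝ) - 1) * (r₁ + r₂) := by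
    have : (r₂ - r₁) * ((q : ℝ) - 1 - 1 - ((q : ℝ) - 1) * (r₁ + r₂)) = 0 := by
      unfold disc at d
      linear_combination -d
    rcases mul_eq_zero.1 this with h | h <;> linarith
  have hlt : disc q r₁ < disc q s := by
    have : disc q s - disc q r₁ = (s - r₁) * (((q : ℝ) - 1) * (r₂ - s)) := by
      unfold disc
      linear_combination (s - r₁) * hsum
    have : 0 < (s - r₁) * (((q : ℝ) - 1) * (r₂ - s)) :=
      mul_pos (by linarith) (mul_pos (by linarith) (by linarith))
    linarith
  rw [sub_neg, div_lt_iff₀ p]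
  nlinarith

/-- After a negative value, `orderEq` crosses zero with positive slope. -/
theorem orderEq_slope_pos (hq : 2 ≤ q) {s t : ℝ} (hs : 0 < s) (hst : s < t) (ht : t < 1)
    (h0 : orderEq q β s < 0) (h1 : orderEq q β t = 0) : 0 < q / disc q t - β := by
  obtain ⟨r₁, h₁, h₁', e₁⟩ := exists_orderEq_slope hq (β := β) le_rfl hs (hst.trans ht)
  obtain ⟨r₂, h₂, h₂', e₂⟩ := exists_orderEq_slope hq (β := β) hs.le hst ht
  rw [orderEq_zero] at e₁
  rw [h1] at e₂
  have p₁ := disc_pos hq h₁.le (h₁'.trans (hst.trans ht))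
  have p₂ := disc_pos hq (hs.trans h₂).le (h₂'.trans ht)
  have p := disc_pos hq (hs.trans hst).le ht
  have hq1 := one_le_cast_sub_one hq
  have n₁ : q / disc q r₁ - β < 0 := by
    by_contra h
    push Not at h
    nlinarith
  have n₂ : 0 < q / disc q r₂ - β := by
    by_contra h
    push Not at h
    nlinarith
  have d : disc q r₂ < disc q r₁ := by
    by_contra h
    push Not at h
    have : (q : ℝ) / disc q r₂ ≤ q / disc q r₁ :=
      div_le_div_of_nonneg_left (by linarith) p₁ h
    linarith
  -- `disc` is smaller at `r₂` than at `r₁`, so the midpoint of `r₁` and `r₂` is already past the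
  -- vertex of the parabola. Hence `disc` keeps decreasing from `r₂` to `t` and the slope keeps
  -- growing.
  have hneg : (q : ℝ) - 1 - 1 < ((q : ℝ) - 1) * (r₁ + r₂) := by
    have : (r₂ - r₁) * ((q : ℝ) - 1 - 1 - ((q : ℝ) - 1) * (r₁ + r₂)) < 0 := by
      have e : (r₂ - r₁) * ((q : ℝ) - 1 - 1 - ((q : ℝ) - 1) * (r₁ + r₂)) =
        disc q r₂ - disc q r₁ := by unfold disc; ring
      linarith
    by_contra h
    push Not at h
    nlinarith
  have hlt : disc q t < disc q r₂ := by
    have e : disc q t - disc q r₂ = (t - r₂) * ((q : ℝ) - 1 - 1 - ((q : ℝ) - 1) * (r₂ + t)) := by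
      unfold disc; ring
    have : (t - r₂) * ((q : ℝ) - 1 - 1 - ((q : ℝ) - 1) * (r₂ + t)) < 0 :=
      mul_neg_of_pos_of_neg (by linarith) (by nlinarith)
    linarith
  have : (q : ℝ) / disc q r₂ < q / disc q t := div_lt_div_of_pos_left (by linarith) p hlt
  linarith

/-- For `β ≥ q`, a negative value of `orderEq` forces negativity near `0`. -/
theorem orderEq_neg_near_zero (hq : 2 ≤ q) {s : ℝ} (hs : 0 < s) (hs1 : s < 1) (hβ : (q : ℝ) ≤ β)
    (h0 : orderEq q β s < 0) : ∃ r, 0 < r ∧ r < 1 ∧ ∀ t, 0 < t → t < r → orderEq q β t < 0 := by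
  obtain ⟨r, h₁, h₁', e₁⟩ := exists_orderEq_slope hq (β := β) le_rfl hs hs1
  rw [orderEq_zero] at e₁
  have hr1 : r < 1 := h₁'.trans hs1
  have p₁ := disc_pos hq h₁.le hr1
  have hq1 := one_le_cast_sub_one hq
  have hβ0 : 0 < β := by linarith
  have n₁ : q / disc q r - β < 0 := by
    by_contra h
    push Not at h
    nlinarith
  have d₁ : (q : ℝ) < β * disc q r := by rw [← div_lt_iff₀ p₁]; linarith
  refine ⟨r, h₁, hr1, fun t ht htr => ?_⟩
  obtain ⟨w, hw, hw', e⟩ := exists_orderEq_slope hq (β := β) le_rfl ht (htr.trans hr1)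
  rw [orderEq_zero, sub_zero, sub_zero] at e
  rw [e]
  refine mul_neg_of_neg_of_pos ?_ ht
  have pw := disc_pos hq hw.le (hw'.trans (htr.trans hr1))
  rw [sub_neg, div_lt_iff₀ pw]
  have hwr : w < r := hw'.trans htr
  -- Concavity of `disc` in explicit form, interpolating between `disc q 0 = 1` and `disc q r`. At
  -- both ends β times `disc` is at least `q`, strictly so at `r`, hence it exceeds `q` in between.
  have e' : r * disc q w = (r - w) * 1 + w * disc q r + ((q : ℝ) - 1) * w * r * (r - w) := by
    unfold disc; ring
  have e2 : 0 ≤ ((q : ℝ) - 1) * w * r * (r - w) := by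
    have : 0 ≤ r - w := by linarith
    have : 0 ≤ (q : ℝ) - 1 := by linarith
    positivity
  have e3 : r * q < r * (β * disc q w) := by
    have : r * (β * disc q w) =
        β * (r - w) + w * (β * disc q r) + β * (((q : ℝ) - 1) * w * r * (r - w)) := by
      linear_combination β * e'
    have h3 : 0 ≤ β * (((q : ℝ) - 1) * w * r * (r - w)) := mul_nonneg hβ0.le e2
    have h4 : w * q < w * (β * disc q r) := mul_lt_mul_of_pos_left d₁ hw
    have h5 : (q : ℝ) * (r - w) ≤ β * (r - w) := mul_le_mul_of_nonneg_right hβ (by linarith)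
    nlinarith
  exact lt_of_mul_lt_mul_left e3 h₁.le

/-- The order parameter is the greatest zero of `orderEq`, and it is attained. -/
theorem order_spec (hq : 2 ≤ q) {s : ℝ} (hs : 0 < s) (hs1 : s < 1) (h0 : orderEq q β s < 0) :
    s < order q β ∧ order q β < 1 ∧ orderEq q β (order q β) = 0 ∧
      ∀ t, 0 < t → t < 1 → orderEq q β t = 0 → t ≤ order q β := by
  have hq1 := one_le_cast_sub_one hq
  set T := {s : ℝ | 0 < 1 + ((q : ℝ) - 1) * s ∧ 0 < 1 - s ∧
    Real.log (1 + ((q : ℝ) - 1) * s) - Real.log (1 - s) = β * s} with hT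
  have hβ0 : 0 < β := by
    by_contra h
    push Not at h
    have h1 : 0 ≤ Real.log (1 + ((q : ℝ) - 1) * s) := Real.log_nonneg (by nlinarith)
    have h2 : Real.log (1 - s) ≤ 0 := Real.log_nonpos (by linarith) (by linarith)
    unfold orderEq at h0
    nlinarith
  -- For `c ≤ t < 1` the term -log(1 - t) is at least β + 1 > βt. Zeros to the right of `s` are thus
  -- confined to a compact interval, where a greatest one exists.
  set c : ℝ := 1 - Real.exp (-β - 1) with hc
  have hpos : ∀ t, 0 < t → c ≤ t → t < 1 → 0 < orderEq q β t := by
    intro t ht hct ht1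
    have h1 : 0 ≤ Real.log (1 + ((q : ℝ) - 1) * t) := Real.log_nonneg (by nlinarith)
    have h2 : Real.log (1 - t) ≤ -β - 1 := by
      rw [Real.log_le_iff_le_exp (by linarith)]
      linarith
    unfold orderEq
    nlinarith
  have hsc : s < c := by
    by_contra h
    push Not at h
    linarith [hpos s hs h hs1]
  have hc1 : c < 1 := by have := Real.exp_pos (-β - 1); linarith
  have hcont : ContinuousOn (orderEq q β) (Set.Icc s c) :=
    (continuousOn_orderEq hq).mono fun x hx => ⟨hs.le.trans hx.1, hx.2.trans_lt hc1⟩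
  have hKne : (Set.Icc s c ∩ orderEq q β ⁻¹' {0}).Nonempty := by
    obtain ⟨x, hx, hx0⟩ := intermediate_value_Icc hsc.le hcont
      ⟨h0.le, (hpos c (hs.trans hsc) le_rfl hc1).le⟩
    exact ⟨x, hx, hx0⟩
  have hKc : IsCompact (Set.Icc s c ∩ orderEq q β ⁻¹' {0}) :=
    isCompact_Icc.of_isClosed_subset
      (hcont.preimage_isClosed_of_isClosed isClosed_Icc isClosed_singleton) Set.inter_subset_left
  obtain ⟨m, ⟨⟨hm1, hm2⟩, hm0⟩, hmax⟩ := hKc.exists_isGreatest hKne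
  have hm0 : orderEq q β m = 0 := hm0
  have hTm : ∀ t, t ∈ T ↔ 0 < 1 + ((q : ℝ) - 1) * t ∧ 0 < 1 - t ∧ orderEq q β t = 0 := by
    intro t
    simp only [hT, orderEq, sub_eq_zero]
    rfl
  have hgr : IsGreatest T m := by
    refine ⟨(hTm m).2 ⟨one_add_mul_pos hq (hs.le.trans hm1), by linarith, hm0⟩, fun t ht => ?_⟩
    obtain ⟨h1, h2, h3⟩ := (hTm t).1 ht
    -- The set defining `order` also contains 0 and possibly negative solutions; all of these lie
    -- below `s`.
    rcases le_or_gt t s with h | h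
    · exact h.trans hm1
    · refine hmax ⟨⟨h.le, ?_⟩, h3⟩
      by_contra hlt
      push Not at hlt
      linarith [hpos t (hs.trans h) hlt.le (by linarith)]
  have horder : order q β = m := hgr.csSup_eq
  rw [horder]
  refine ⟨lt_of_le_of_ne hm1 fun h => ?_, by linarith, hm0, fun t ht ht1 h => ?_⟩
  · rw [h] at h0
    linarith
  · exact hgr.2 ((hTm t).2 ⟨one_add_mul_pos hq ht.le, by linarith, h⟩)

end

/-! ### Local minima of the free energy on the simplex -/

/-- The point with one distinguished coordinate and order parameter `s`. -/
def orderedPoint {q : ℕ} (i : Fin q) (s : ℝ) : Fin q → ℝ := fun k =>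
  if k = i then (1 + ((q : ℝ) - 1) * s) / q else (1 - s) / q

theorem sum_orderedPoint {q : ℕ} (i : Fin q) (s : ℝ) (f : ℝ → ℝ) :
    ∑ k, f (orderedPoint i s k) =
      f ((1 + ((q : ℝ) - 1) * s) / q) + ((q : ℝ) - 1) * f ((1 - s) / q) := by
  rw [← Finset.add_sum_erase _ _ (Finset.mem_univ i)]
  have : ∑ k ∈ Finset.univ.erase i, f (orderedPoint i s k) =
      ∑ _k ∈ Finset.univ.erase i, f ((1 - s) / q) :=
    Finset.sum_congr rfl fun k hk => by
      rw [orderedPoint, if_neg (Finset.ne_of_mem_erase hk)]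
  rw [this, Finset.sum_const, Finset.card_erase_of_mem (Finset.mem_univ i), nsmul_eq_mul,
    Finset.card_univ, Fintype.card_fin, Nat.cast_sub (Fin.pos i), Nat.cast_one, orderedPoint,
    if_pos rfl]

theorem orderedPoint_mem {q : ℕ} (hq : 2 ≤ q) (i : Fin q) {s : ℝ} (hs : 0 ≤ s) (hs1 : s ≤ 1) :
    orderedPoint i s ∈ stdSimplex ℝ (Fin q) := by
  have h1 := one_add_mul_pos hq hs
  have hq0 : (0 : ℝ) < q := by exact_mod_cast (by omega : 0 < q)
  refine ⟨fun k => ?_, ?_⟩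
  · unfold orderedPoint
    split_ifs
    · positivity
    · exact div_nonneg (by linarith) hq0.le
  · rw [sum_orderedPoint i s fun x => x]
    field_simp
    ring

theorem orderedPoint_zero {q : ℕ} (i : Fin q) : orderedPoint i 0 = fun _ => 1 / (q : ℝ) := by
  funext k
  simp [orderedPoint]

theorem continuous_orderedPoint {q : ℕ} (i : Fin q) : Continuous (orderedPoint i) := by
  refine continuous_pi fun k => ?_
  unfold orderedPoint
  split_ifs <;> fun_prop

/-- This is the origin of `orderEq`: its sign decides whether the free energy rises or falls along
the segment from the uniform vector towards a vertex of the simplex. -/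
theorem hasDerivAt_freeEnergy_orderedPoint {q : ℕ} (hq : 2 ≤ q) {β : ℝ} (hβ : 0 < β) (i : Fin q)
    {s : ℝ} (hs : 0 ≤ s) (hs1 : s < 1) :
    HasDerivAt (fun s => freeEnergy β (orderedPoint i s))
      (((q : ℝ) - 1) / (q * β) * orderEq q β s) s := by
  have hq0 : (0 : ℝ) < q := by exact_mod_cast (by omega : 0 < q)
  have h1 := one_add_mul_pos hq hs
  have h2 : 0 < 1 - s := by linarith
  have e : (fun s => freeEnergy β (orderedPoint i s)) = fun s : ℝ =>
      colourEnergy β ((1 + ((q : ℝ) - 1) * s) / q) +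
        ((q : ℝ) - 1) * colourEnergy β ((1 - s) / q) := by
    funext s
    rw [freeEnergy_eq_sum, sum_orderedPoint]
  rw [e]
  have d1 : HasDerivAt (fun s : ℝ => (1 + ((q : ℝ) - 1) * s) / q) (((q : ℝ) - 1) / q) s := by
    simpa using (((hasDerivAt_id s).const_mul ((q : ℝ) - 1)).const_add 1).div_const (q : ℝ)
  have d2 : HasDerivAt (fun s : ℝ => (1 - s) / q) (-1 / q) s := by
    simpa using ((hasDerivAt_id s).const_sub 1).div_const (q : ℝ)
  have c1 := (hasDerivAt_colourEnergy β (div_pos h1 hq0).ne').comp s d1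
  have c2 := ((hasDerivAt_colourEnergy β (div_pos h2 hq0).ne').comp s d2).const_mul ((q : ℝ) - 1)
  refine (c1.add c2).congr_deriv ?_
  unfold orderEq
  rw [Real.log_div h1.ne' hq0.ne', Real.log_div h2.ne' hq0.ne']
  field_simp
  ring

/-- A negative `orderEq` to the right of `s` excludes a local minimum. -/
theorem not_isLocalMinOn_of_orderEq_neg {q : ℕ} (hq : 2 ≤ q) {β : ℝ} (hβ : 0 < β) (i : Fin q)
    {s r : ℝ} (hs : 0 ≤ s) (hsr : s < r) (hr : r < 1)
    (hneg : ∀ t, s < t → t < r → orderEq q β t < 0) :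
    ¬ IsLocalMinOn (freeEnergy β) (stdSimplex ℝ (Fin q)) (orderedPoint i s) := by
  intro hmin
  have hq1 := one_le_cast_sub_one hq
  have hd : ∀ t ∈ Set.Icc s r, HasDerivAt (fun s => freeEnergy β (orderedPoint i s))
      (((q : ℝ) - 1) / (q * β) * orderEq q β t) t := fun t ht =>
    hasDerivAt_freeEnergy_orderedPoint hq hβ i (hs.trans ht.1) (ht.2.trans_lt hr)
  have hanti : StrictAntiOn (fun s => freeEnergy β (orderedPoint i s)) (Set.Icc s r) := by
    refine strictAntiOn_of_deriv_neg (convex_Icc _ _)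
      (fun t ht => (hd t ht).continuousAt.continuousWithinAt) fun t ht => ?_
    rw [interior_Icc] at ht
    rw [(hd t (Set.Ioo_subset_Icc_self ht)).deriv]
    have : 0 < ((q : ℝ) - 1) / (q * β) := by
      have : (0 : ℝ) < q := by linarith
      have : 0 < (q : ℝ) - 1 := by linarith
      positivity
    exact mul_neg_of_pos_of_neg this (hneg t ht.1 ht.2)
  have htend : Tendsto (orderedPoint i) (nhdsWithin s (Set.Ioo s r))
      (nhdsWithin (orderedPoint i s) (stdSimplex ℝ (Fin q))) := by
    refine tendsto_nhdsWithin_of_tendsto_nhds_of_eventually_within _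
      ((continuous_orderedPoint i).tendsto s |>.mono_left nhdsWithin_le_nhds) ?_
    filter_upwards [self_mem_nhdsWithin] with t ht
    exact orderedPoint_mem hq i (hs.trans ht.1.le) (ht.2.trans hr).le
  have hev := htend.eventually hmin
  have hne : (nhdsWithin s (Set.Ioo s r)).NeBot := left_nhdsWithin_Ioo_neBot hsr
  obtain ⟨t, ht1, ht2⟩ := (hev.and self_mem_nhdsWithin).exists
  have := hanti (Set.left_mem_Icc.2 hsr.le) (Set.Ioo_subset_Icc_self ht2) ht2.1
  exact absurd ht1 (not_le.2 this)

/-- Moving mass between two coordinates does not decrease the energy at a local minimum. -/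
theorem eventually_pair_le {q : ℕ} {β : ℝ} {x : Fin q → ℝ} (hx : x ∈ stdSimplex ℝ (Fin q))
    (hmin : IsLocalMinOn (freeEnergy β) (stdSimplex ℝ (Fin q)) x) {k l : Fin q} (hkl : k ≠ l) :
    ∀ᶠ t in nhds (0 : ℝ), -x k ≤ t → t ≤ x l →
      colourEnergy β (x k) + colourEnergy β (x l) ≤
        colourEnergy β (x k + t) + colourEnergy β (x l - t) := by
  set y : ℝ → Fin q → ℝ := fun t => Function.update (Function.update x k (x k + t)) l (x l - t)
    with hy
  have hyk : ∀ t, y t k = x k + t := fun t => by simp [hy, Function.update_of_ne hkl]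
  have hyl : ∀ t, y t l = x l - t := fun t => by simp [hy]
  have hyo : ∀ t j, j ≠ k ∧ j ≠ l → y t j = x j := fun t j h => by
    simp [hy, Function.update_of_ne h.1, Function.update_of_ne h.2]
  have hsum : ∀ (f : ℝ → ℝ) t, ∑ j, f (y t j) - ∑ j, f (x j) =
      (f (x k + t) - f (x k)) + (f (x l - t) - f (x l)) := by
    intro f t
    rw [← Finset.sum_sub_distrib, Fintype.sum_eq_add k l hkl, hyk, hyl]
    intro j hj
    rw [hyo t j hj, sub_self]
  have hcont : Continuous y := by
    refine continuous_pi fun j => ?_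
    by_cases h1 : j = l
    · subst h1; simp only [hyl]; fun_prop
    by_cases h2 : j = k
    · subst h2; simp only [hyk]; fun_prop
    · simp only [fun t => hyo t j ⟨h2, h1⟩]; fun_prop
  have hy0 : y 0 = x := by
    funext j
    by_cases h1 : j = l
    · subst h1; simp [hyl]
    by_cases h2 : j = k
    · subst h2; simp [hyk]
    · exact hyo 0 j ⟨h2, h1⟩
  have h1 : ∀ᶠ z in nhds x, z ∈ stdSimplex ℝ (Fin q) → freeEnergy β x ≤ freeEnergy β z :=
    eventually_nhdsWithin_iff.1 hmin
  have h2 := (hy0 ▸ hcont.tendsto 0 : Tendsto y (nhds 0) (nhds x)).eventually h1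
  filter_upwards [h2] with t ht htk htl
  have hmem : y t ∈ stdSimplex ℝ (Fin q) := by
    refine ⟨fun j => ?_, ?_⟩
    · by_cases h1 : j = l
      · subst h1; rw [hyl]; linarith
      by_cases h2 : j = k
      · subst h2; rw [hyk]; linarith
      · rw [hyo t j ⟨h2, h1⟩]; exact hx.1 j
    · have := hsum (fun z => z) t
      rw [hx.2] at this
      linarith
  have h3 := ht hmem
  have h4 := hsum (colourEnergy β) t
  rw [freeEnergy_eq_sum, freeEnergy_eq_sum] at h3
  linarith

/-- The entropy x log x has slope -∞ at 0: moving mass `t` onto an empty colour gains t log(1/t)/β,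
more than the linear cost at the donor colour. -/
theorem pos_of_isLocalMinOn {q : ℕ} {β : ℝ} (hβ : 0 < β) {x : Fin q → ℝ}
    (hx : x ∈ stdSimplex ℝ (Fin q))
    (hmin : IsLocalMinOn (freeEnergy β) (stdSimplex ℝ (Fin q)) x) (k : Fin q) : 0 < x k := by
  refine lt_of_le_of_ne (hx.1 k) fun hk => ?_
  obtain ⟨l, -, hl⟩ : ∃ l ∈ Finset.univ, 0 < x l := by
    refine Finset.exists_lt_of_sum_lt (f := fun _ => (0 : ℝ)) ?_
    rw [hx.2]; simp
  have hkl : k ≠ l := fun h => by rw [← h, ← hk] at hl; exact lt_irrefl _ hl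
  have hev := eventually_pair_le hx hmin hkl
  set c := -x l + 1 / β * (Real.log (x l) + 1) with hc
  have hd : HasDerivAt (fun t => colourEnergy β (x l - t)) (c * -1) 0 := by
    have h1 : HasDerivAt (fun t => x l - t) (-1) 0 := by
      simpa using (hasDerivAt_id (0 : ℝ)).const_sub (x l)
    have h2 := hasDerivAt_colourEnergy β (x := x l - 0) (by simpa using hl.ne')
    rw [sub_zero] at h2
    exact HasDerivAt.comp (0 : ℝ) (h₂ := colourEnergy β) (by rw [sub_zero]; exact h2) h1
  have hb := (hasDerivAt_iff_isLittleO.1 hd).bound one_pos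
  -- `|c|` covers the slope at the donor, one unit the remainder of its linearisation, and one more
  -- unit makes the decrease strict.
  have hlog : ∀ᶠ t in nhdsWithin (0 : ℝ) (Set.Ioi 0), Real.log t < -β * (|c| + 2) :=
    Real.tendsto_log_nhdsGT_zero.eventually_lt_atBot _
  have hsmall : ∀ᶠ t in nhdsWithin (0 : ℝ) (Set.Ioi 0), t < x l :=
    (eventually_lt_nhds hl).filter_mono nhdsWithin_le_nhds
  obtain ⟨t, ⟨⟨⟨⟨h1, h2⟩, h3⟩, h4⟩, h5⟩⟩ :=
    (((((hev.filter_mono nhdsWithin_le_nhds).and (hb.filter_mono nhdsWithin_le_nhds)).and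
      hlog).and hsmall).and self_mem_nhdsWithin).exists
  have h5 : 0 < t := h5
  have h6 := h1 (by rw [← hk]; linarith) h4.le
  simp only [sub_zero, smul_eq_mul, one_mul, Real.norm_eq_abs, abs_of_pos h5] at h2
  have h7 := (abs_le.1 h2).2
  have h8 : colourEnergy β (x k + t) ≤ t / β * Real.log t := by
    rw [← hk, zero_add, colourEnergy]
    have e : 1 / β * (t * Real.log t) = t / β * Real.log t := by ring
    rw [e]
    nlinarith [sq_nonneg t]
  have h9 : colourEnergy β (x k) = 0 := by rw [← hk]; simp [colourEnergy]
  have h10 : t / β * Real.log t < t / β * (-β * (|c| + 2)) := by gcongr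
  have h11 : t / β * (-β * (|c| + 2)) = -t * (|c| + 2) := by field_simp
  have h12 := neg_abs_le c
  nlinarith

/-- The Lagrange condition. All coordinates being positive, mass may be moved between two colours in
either direction. -/
theorem first_order_of_isLocalMinOn {q : ℕ} {β : ℝ} (hβ : 0 < β) {x : Fin q → ℝ}
    (hx : x ∈ stdSimplex ℝ (Fin q))
    (hmin : IsLocalMinOn (freeEnergy β) (stdSimplex ℝ (Fin q)) x) (k l : Fin q) :
    -x k + 1 / β * (Real.log (x k) + 1) = -x l + 1 / β * (Real.log (x l) + 1) := by
  by_cases hkl : k = l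
  · rw [hkl]
  have hk := pos_of_isLocalMinOn hβ hx hmin k
  have hl := pos_of_isLocalMinOn hβ hx hmin l
  have hev := eventually_pair_le hx hmin hkl
  have hloc : IsLocalMin (fun t => colourEnergy β (x k + t) + colourEnergy β (x l - t)) 0 := by
    filter_upwards [hev, eventually_gt_nhds (neg_lt_zero.2 hk), eventually_lt_nhds hl]
      with t h1 h2 h3
    simpa using h1 h2.le h3.le
  have d1 : HasDerivAt (fun t => x k + t) 1 0 := by
    simpa using (hasDerivAt_id (0 : ℝ)).const_add (x k)
  have d2 : HasDerivAt (fun t => x l - t) (-1) 0 := by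
    simpa using (hasDerivAt_id (0 : ℝ)).const_sub (x l)
  have c1 := HasDerivAt.comp (0 : ℝ) (h₂ := colourEnergy β)
    (by rw [add_zero]; exact hasDerivAt_colourEnergy β hk.ne') d1
  have c2 := HasDerivAt.comp (0 : ℝ) (h₂ := colourEnergy β)
    (by rw [sub_zero]; exact hasDerivAt_colourEnergy β hl.ne') d2
  have := hloc.hasDerivAt_eq_zero (c1.add c2)
  linarith

/-- With two coordinates in the strictly concave range, transferring `t` or `-t` between them would
lower the energy on average, hence in at least one direction. -/
theorem eq_of_large_of_isLocalMinOn {q : ℕ} {β : ℝ} (hβ : 0 < β) {x : Fin q → ℝ}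
    (hx : x ∈ stdSimplex ℝ (Fin q))
    (hmin : IsLocalMinOn (freeEnergy β) (stdSimplex ℝ (Fin q)) x) {k l : Fin q}
    (hk : 1 / β < x k) (hl : 1 / β < x l) : k = l := by
  by_contra hkl
  have hev := eventually_pair_le hx hmin hkl
  have hp : 0 < 1 / β := by positivity
  obtain ⟨r, hr, hball⟩ := Metric.eventually_nhds_iff.1 hev
  set t := min (r / 2) (min ((x k - 1 / β) / 2) ((x l - 1 / β) / 2)) with ht
  have ht0 : 0 < t := by
    refine lt_min (by linarith) (lt_min (by linarith) (by linarith))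
  have htr : t < r := (min_le_left _ _).trans_lt (by linarith)
  have htk : t < x k - 1 / β :=
    ((min_le_right _ _).trans (min_le_left _ _)).trans_lt (by linarith)
  have htl : t < x l - 1 / β :=
    ((min_le_right _ _).trans (min_le_right _ _)).trans_lt (by linarith)
  have h1 := hball (y := t) (by simpa [abs_of_pos ht0] using htr) (by linarith) (by linarith)
  have h2 := hball (y := -t) (by simpa [abs_of_pos ht0] using htr) (by linarith) (by linarith)
  have hc := strictConcaveOn_colourEnergy hβ
  have key : ∀ z, t < z - 1 / β →
      colourEnergy β (z + t) + colourEnergy β (z - t) < 2 * colourEnergy β z := by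
    intro z hz
    have hz1 : z + t ∈ Set.Ioi (1 / β) := Set.mem_Ioi.2 (by linarith)
    have hz2 : z - t ∈ Set.Ioi (1 / β) := Set.mem_Ioi.2 (by linarith)
    have := hc.2 hz1 hz2 (by linarith) (by norm_num : (0 : ℝ) < 1 / 2)
      (by norm_num : (0 : ℝ) < 1 / 2) (by norm_num)
    simp only [smul_eq_mul] at this
    rw [show 1 / 2 * (z + t) + 1 / 2 * (z - t) = z by ring] at this
    linarith
  have k1 := key _ htk
  have k2 := key _ htl
  rw [sub_neg_eq_add, ← sub_eq_add_neg] at h2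
  linarith

/-- A local minimum is uniform, or has one distinguished coordinate. -/
theorem isLocalMinOn_structure {q : ℕ} (hq : 2 ≤ q) {β : ℝ} (hβ : 0 < β) {x : Fin q → ℝ}
    (hx : x ∈ stdSimplex ℝ (Fin q))
    (hmin : IsLocalMinOn (freeEnergy β) (stdSimplex ℝ (Fin q)) x) :
    x = (fun _ => 1 / (q : ℝ)) ∨
      ∃ i s, 0 < s ∧ s < 1 ∧ x = orderedPoint i s ∧ orderEq q β s = 0 := by
  have hpos := pos_of_isLocalMinOn hβ hx hmin
  have hq0 : (0 : ℝ) < q := by exact_mod_cast (by omega : 0 < q)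
  -- The first-order condition equates values of a derivative that is injective on the convex range.
  have heq : ∀ k l, x k ≤ 1 / β → x l ≤ 1 / β → x k = x l := fun k l hk hl =>
    (strictMonoOn_deriv_colourEnergy hβ).injOn ⟨hpos k, hk⟩ ⟨hpos l, hl⟩
      (first_order_of_isLocalMinOn hβ hx hmin k l)
  by_cases hlarge : ∃ i, 1 / β < x i
  · right
    obtain ⟨i, hi⟩ := hlarge
    have hsmall : ∀ k, k ≠ i → x k ≤ 1 / β := fun k hk => by
      by_contra h
      exact hk (eq_of_large_of_isLocalMinOn hβ hx hmin (not_le.1 h) hi)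
    obtain ⟨j, hj⟩ : ∃ j : Fin q, j ≠ i := by
      have : Nontrivial (Fin q) := Fin.nontrivial_iff_two_le.2 hq
      exact exists_ne i
    set s := 1 - q * x j with hs
    have hxk : ∀ k, k ≠ i → x k = (1 - s) / q := fun k hk => by
      rw [heq k j (hsmall k hk) (hsmall j hj), hs]
      field_simp
      ring
    have hsum : x i + ((q : ℝ) - 1) * ((1 - s) / q) = 1 := by
      have h := hx.2
      rwa [← Finset.add_sum_erase _ _ (Finset.mem_univ i),
        Finset.sum_congr rfl fun k hk => hxk k (Finset.ne_of_mem_erase hk), Finset.sum_const,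
        Finset.card_erase_of_mem (Finset.mem_univ i), nsmul_eq_mul, Finset.card_univ,
        Fintype.card_fin, Nat.cast_sub (by omega), Nat.cast_one] at h
    have hxi : x i = (1 + ((q : ℝ) - 1) * s) / q := by
      field_simp at hsum ⊢
      linarith
    have hxp : x = orderedPoint i s := by
      funext k
      unfold orderedPoint
      split_ifs with h
      · rw [h, hxi]
      · exact hxk k h
    have hdiff : x i - x j = s := by
      rw [hxi, hxk j hj]
      field_simp
      ring
    have hs0 : 0 < s := by
      have := hsmall j hj
      linarith
    have hs1 : s < 1 := by
      have := mul_pos hq0 (hpos j)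
      linarith
    refine ⟨i, s, hs0, hs1, hxp, ?_⟩
    have hfo := first_order_of_isLocalMinOn hβ hx hmin i j
    have h1 := one_add_mul_pos hq hs0.le
    rw [hxi, hxk j hj, Real.log_div h1.ne' hq0.ne', Real.log_div (by linarith) hq0.ne'] at hfo
    unfold orderEq
    field_simp at hfo
    have : (q : ℝ) * (Real.log (1 + ((q : ℝ) - 1) * s) - Real.log (1 - s) - β * s) = 0 := by
      linarith
    rcases mul_eq_zero.1 this with h | h
    · linarith
    · exact h
  · left
    push Not at hlarge
    funext k
    have hall : ∀ l, x l = x k := fun l => heq l k (hlarge l) (hlarge k)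
    have := hx.2
    rw [Finset.sum_congr rfl fun l _ => hall l, Finset.sum_const, Finset.card_univ,
      Fintype.card_fin, nsmul_eq_mul] at this
    field_simp
    linarith

/-- Over the reals the infimum of the empty set is 0, so non-emptiness is what makes `betaOne`
informative. At β = 8 log q a vertex has energy -1/2, below the energy -1/(2q) - 1/8 of the uniform
vector, so a global minimiser is not uniform. -/
theorem exists_mem_betaOne_set {q : ℕ} (hq : 2 ≤ q) :
    {β : ℝ | 0 < β ∧ ∃ x ∈ stdSimplex ℝ (Fin q), x ≠ (fun _ => 1 / (q : ℝ)) ∧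
      IsLocalMinOn (freeEnergy β) (stdSimplex ℝ (Fin q)) x}.Nonempty := by
  have hq2 : (2 : ℝ) ≤ q := by exact_mod_cast hq
  have hlog : 0 < Real.log q := Real.log_pos (by linarith)
  refine ⟨8 * Real.log q, by positivity, ?_⟩
  set i : Fin q := ⟨0, by omega⟩
  obtain ⟨x, hx, hmin⟩ := (isCompact_stdSimplex ℝ (Fin q)).exists_isMinOn
    ⟨orderedPoint i 1, orderedPoint_mem hq i zero_le_one le_rfl⟩
    (continuous_freeEnergy (8 * Real.log q)).continuousOn
  refine ⟨x, hx, fun h => ?_, hmin.localize⟩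
  have h1 := hmin (orderedPoint_mem hq i zero_le_one le_rfl)
  simp only [h] at h1
  have h1 : freeEnergy (8 * Real.log q) (fun _ : Fin q => 1 / (q : ℝ)) ≤
    freeEnergy (8 * Real.log q) (orderedPoint i 1) := h1
  rw [freeEnergy_eq_sum (x := orderedPoint i 1), sum_orderedPoint, freeEnergy_eq_sum] at h1
  have e1 : (1 + ((q : ℝ) - 1) * 1) / q = 1 := by field_simp; ring
  rw [e1, Finset.sum_const, Finset.card_univ, Fintype.card_fin, nsmul_eq_mul] at h1
  simp only [colourEnergy, sub_self, zero_div, one_div, Real.log_inv, Real.log_one] at h1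
  norm_num at h1
  have hq0 : (0 : ℝ) < q := by linarith
  field_simp at h1
  nlinarith

/-- Above the critical value, `orderEq` takes a negative value on `(0, 1)`. -/
theorem exists_orderEq_neg {q : ℕ} (hq : 2 ≤ q) {β : ℝ} (hβ : betaOne q < β) :
    0 < β ∧ ∃ s, 0 < s ∧ s < 1 ∧ orderEq q β s < 0 := by
  -- A non-uniform local minimum at a smaller `β'` provides a zero `s > 0`; raising the parameter to
  -- `β` lowers `orderEq` there by (β - β')s.
  obtain ⟨β', ⟨hβ', x, hx, hne, hmin⟩, hlt⟩ := exists_lt_of_csInf_lt (exists_mem_betaOne_set hq) hβ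
  refine ⟨hβ'.trans hlt, ?_⟩
  rcases isLocalMinOn_structure hq hβ' hx hmin with h | ⟨i, s, hs, hs1, -, h0⟩
  · exact absurd h hne
  · refine ⟨s, hs, hs1, ?_⟩
    unfold orderEq at h0 ⊢
    nlinarith

theorem minimum_zero (q : ℕ) (β : ℝ) : minimum q β 0 = fun _ => 1 / (q : ℝ) := by
  funext k
  simp [minimum]

theorem minimum_succ {q : ℕ} (β : ℝ) (i : Fin q) :
    minimum q β i.succ = orderedPoint i (order q β) := by
  funext k
  simp [minimum, orderedPoint, Fin.succ_ne_zero]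

theorem succ_mem_indexSet {q : ℕ} (β : ℝ) (i : Fin q) : i.succ ∈ indexSet q β := by
  unfold indexSet
  split_ifs <;> simp [Fin.succ_ne_zero]

theorem zero_mem_indexSet_iff {q : ℕ} {β : ℝ} : 0 ∈ indexSet q β ↔ β < q := by
  unfold indexSet
  split_ifs with h <;> simp [h]

/-- Every local minimum of the free energy is one of the points `minimum q β i`. -/
theorem exists_eq_minimum {q : ℕ} (hq : 2 ≤ q) {β : ℝ} (hβ : betaOne q < β) {x : Fin q → ℝ}
    (hx : x ∈ stdSimplex ℝ (Fin q))
    (hmin : IsLocalMinOn (freeEnergy β) (stdSimplex ℝ (Fin q)) x) :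
    ∃ i ∈ indexSet q β, x = minimum q β i := by
  obtain ⟨hβ0, s', hs', hs1', hneg⟩ := exists_orderEq_neg hq hβ
  obtain ⟨ho1, ho2, ho3, ho4⟩ := order_spec hq hs' hs1' hneg
  rcases isLocalMinOn_structure hq hβ0 hx hmin with h | ⟨i, s, hs, hs1, h, h0⟩
  · refine ⟨0, zero_mem_indexSet_iff.2 ?_, by rw [h, minimum_zero]⟩
    by_contra hle
    push Not at hle
    obtain ⟨r, hr, hr1, hr2⟩ := orderEq_neg_near_zero hq hs' hs1' hle hneg
    set i : Fin q := ⟨0, by omega⟩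
    refine not_isLocalMinOn_of_orderEq_neg hq hβ0 i le_rfl hr hr1 hr2 ?_
    rwa [orderedPoint_zero, ← h]
  · refine ⟨i.succ, succ_mem_indexSet β i, ?_⟩
    rw [minimum_succ, h]
    congr 1
    rcases (ho4 s hs hs1 h0).lt_or_eq with hlt | heq
    -- A zero before the last one is a downward crossing, so the free energy decreases just beyond
    -- it.
    · exfalso
      have hder := orderEq_zero_unique hq hs hlt ho2 h0 ho3
      have hsl := (hasDerivAt_orderEq (β := β) hq hs.le hs1)
      have hev := eventually_nhdsWithin_sign_eq_of_deriv_neg (f := orderEq q β) (x₀ := s)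
        (by rw [hsl.deriv]; exact hder) h0
      obtain ⟨r, hr, hball⟩ := Metric.eventually_nhds_iff.1 hev
      refine not_isLocalMinOn_of_orderEq_neg hq hβ0 i hs.le (r := min (s + r) ((s + 1) / 2))
        (lt_min (by linarith) (by linarith)) ((min_le_right _ _).trans_lt (by linarith))
        (fun t ht ht' => ?_) (h ▸ hmin)
      have h2 := hball (y := t) (by
        rw [Real.dist_eq, abs_of_pos (by linarith)]
        linarith [min_le_left (s + r) ((s + 1) / 2)])
      rw [sign_neg (by linarith : s - t < 0)] at h2
      exact sign_eq_neg_one_iff.1 h2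
    · exact heq

/-- Jensen's inequality in the convex range; it permits replacing small coordinates by their
average. -/
theorem card_mul_colourEnergy_le {ι : Type*} {β : ℝ} (hβ : 0 < β) (t : Finset ι)
    (ht : t.Nonempty) (y : ι → ℝ) (hy : ∀ k ∈ t, y k ∈ Set.Icc 0 (1 / β)) :
    (t.card : ℝ) * colourEnergy β ((∑ k ∈ t, y k) / t.card) ≤ ∑ k ∈ t, colourEnergy β (y k) := by
  have hc : (0 : ℝ) < t.card := by exact_mod_cast Finset.card_pos.2 ht
  have := (convexOn_colourEnergy hβ).map_sum_le (t := t) (w := fun _ => 1 / (t.card : ℝ)) (p := y)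
    (fun _ _ => by positivity) (by simp [hc.ne']) hy
  simp only [smul_eq_mul, ← Finset.mul_sum] at this
  rw [one_div, inv_mul_eq_div, inv_mul_eq_div, le_div_iff₀ hc] at this
  linarith

theorem minimum_mem {q : ℕ} (hq : 2 ≤ q) {β : ℝ} (hβ : betaOne q < β) (i : Fin (q + 1)) :
    minimum q β i ∈ stdSimplex ℝ (Fin q) := by
  obtain ⟨-, s, hs, hs1, hneg⟩ := exists_orderEq_neg hq hβ
  obtain ⟨ho1, ho2, -, -⟩ := order_spec hq hs hs1 hneg
  induction i using Fin.cases with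
  | zero =>
    rw [minimum_zero, ← orderedPoint_zero ⟨0, by omega⟩]
    exact orderedPoint_mem hq _ le_rfl zero_le_one
  | succ i =>
    rw [minimum_succ]
    exact orderedPoint_mem hq _ (hs.trans ho1).le ho2.le

theorem minimum_injective {q : ℕ} (hq : 2 ≤ q) {β : ℝ} (hβ : betaOne q < β) :
    Function.Injective (minimum q β) := by
  obtain ⟨-, s, hs, hs1, hneg⟩ := exists_orderEq_neg hq hβ
  obtain ⟨ho1, ho2, -, -⟩ := order_spec hq hs hs1 hneg
  have ho : 0 < order q β := hs.trans ho1
  have hq0 : (0 : ℝ) < q := by exact_mod_cast (by omega : 0 < q)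
  have hq1 := one_le_cast_sub_one hq
  have h0 : ∀ i : Fin q, minimum q β 0 ≠ minimum q β i.succ := by
    intro i h
    have := congrFun h i
    rw [minimum_zero, minimum_succ, orderedPoint, if_pos rfl] at this
    field_simp at this
    nlinarith
  intro i j hij
  induction i using Fin.cases with
  | zero =>
    induction j using Fin.cases with
    | zero => rfl
    | succ j => exact absurd hij (h0 j)
  | succ i =>
    induction j using Fin.cases with
    | zero => exact absurd hij.symm (h0 i)
    | succ j =>
      by_contra hne
      have hne' : i ≠ j := fun h => hne (by rw [h])
      have := congrFun hij i
      rw [minimum_succ, minimum_succ, orderedPoint, orderedPoint, if_pos rfl, if_neg hne'] at this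
      field_simp at this
      nlinarith

/-- Near the uniform vector all coordinates are below 1/β when β < q, and Jensen suffices. Near an
ordered point, averaging all coordinates but the distinguished one reduces the claim to the
one-parameter family, where the second derivative is positive. -/
theorem isLocalMinOn_minimum {q : ℕ} (hq : 2 ≤ q) {β : ℝ} (hβ : betaOne q < β)
    {i : Fin (q + 1)} (hi : i ∈ indexSet q β) :
    IsLocalMinOn (freeEnergy β) (stdSimplex ℝ (Fin q)) (minimum q β i) := by
  obtain ⟨hβ0, s', hs', hs1', hneg⟩ := exists_orderEq_neg hq hβ
  obtain ⟨ho1, ho2, ho3, -⟩ := order_spec hq hs' hs1' hneg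
  have hq0 : (0 : ℝ) < q := by exact_mod_cast (by omega : 0 < q)
  have hq1 := one_le_cast_sub_one hq
  induction i using Fin.cases with
  | zero =>
    have hlt := zero_mem_indexSet_iff.1 hi
    rw [minimum_zero]
    have hne : (Finset.univ : Finset (Fin q)).Nonempty := ⟨⟨0, by omega⟩, Finset.mem_univ _⟩
    have hnear : ∀ᶠ y : Fin q → ℝ in nhds (fun _ => 1 / (q : ℝ)), ∀ k, y k < 1 / β := by
      rw [eventually_all]
      intro k
      exact (continuous_apply k).continuousAt.eventually_lt continuousAt_const
        (one_div_lt_one_div_of_lt hβ0 hlt)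
    refine eventually_nhdsWithin_iff.2 ?_
    filter_upwards [hnear] with y hy hmem
    have := card_mul_colourEnergy_le hβ0 Finset.univ hne y fun k _ => ⟨hmem.1 k, (hy k).le⟩
    rw [hmem.2, Finset.card_univ, Fintype.card_fin] at this
    rw [freeEnergy_eq_sum, freeEnergy_eq_sum, Finset.sum_const, Finset.card_univ,
      Fintype.card_fin, nsmul_eq_mul]
    exact this
  | succ i =>
    rw [minimum_succ]
    set s := order q β with hs
    have hs0 : 0 < s := hs'.trans ho1
    have hslope := orderEq_slope_pos hq hs' ho1 ho2 hneg ho3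
    have hdp := disc_pos hq hs0.le ho2
    -- The upward crossing at `s` says β `disc q s` < q, and `1 - s ≤ disc q s`; so the small
    -- coordinates lie in the convex range.
    have hsmall : (1 - s) / q < 1 / β := by
      rw [div_lt_div_iff₀ hq0 hβ0, one_mul]
      have h1 : β * disc q s < q := by
        rw [← lt_div_iff₀ hdp]; linarith
      have h2 : 1 - s ≤ disc q s := by
        unfold disc
        nlinarith [mul_nonneg (mul_nonneg (by linarith : 0 ≤ (q : ℝ) - 1) hs0.le)
          (by linarith : 0 ≤ 1 - s)]
      nlinarith
    set ψ : ℝ → ℝ := fun s => freeEnergy β (orderedPoint i s) with hψ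
    have hder : ∀ t, 0 ≤ t → t < 1 →
        HasDerivAt ψ (((q : ℝ) - 1) / (q * β) * orderEq q β t) t := fun t h0 h1 =>
      hasDerivAt_freeEnergy_orderedPoint hq hβ0 i h0 h1
    have hloc : IsLocalMin ψ s := by
      have hev : deriv ψ =ᶠ[nhds s] fun t => ((q : ℝ) - 1) / (q * β) * orderEq q β t := by
        filter_upwards [eventually_gt_nhds hs0, eventually_lt_nhds ho2] with t h0 h1
        exact (hder t h0.le h1).deriv
      refine isLocalMin_of_deriv_deriv_pos ?_ ?_ (hder s hs0.le ho2).continuousAt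
      · rw [hev.deriv_eq, ((hasDerivAt_orderEq hq hs0.le ho2).const_mul _).deriv]
        have : 0 < ((q : ℝ) - 1) / (q * β) := div_pos (by linarith) (by positivity)
        positivity
      · rw [(hder s hs0.le ho2).deriv, ho3, mul_zero]
    -- This expression recovers the order parameter from the distinguished coordinate of `y`.
    have hcont : Continuous fun y : Fin q → ℝ => ((q : ℝ) * y i - 1) / ((q : ℝ) - 1) := by
      fun_prop
    have hval : ((q : ℝ) * orderedPoint i s i - 1) / ((q : ℝ) - 1) = s := by
      rw [orderedPoint, if_pos rfl]
      have : (q : ℝ) - 1 ≠ 0 := by linarith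
      field_simp
      ring
    have hev1 : ∀ᶠ y in nhds (orderedPoint i s),
        ψ s ≤ ψ (((q : ℝ) * y i - 1) / ((q : ℝ) - 1)) := by
      have := hcont.tendsto (orderedPoint i s)
      simp only [hval] at this
      exact this.eventually hloc
    have hev2 : ∀ᶠ y in nhds (orderedPoint i s), ∀ k, k ≠ i → y k < 1 / β := by
      rw [eventually_all]
      intro k
      by_cases hk : k = i
      · exact Eventually.of_forall fun y h => absurd hk h
      · have : ∀ᶠ y in nhds (orderedPoint i s), y k < 1 / β :=
          (continuous_apply k).continuousAt.eventually_lt continuousAt_const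
            (by simpa [orderedPoint, hk] using hsmall)
        exact this.mono fun y h _ => h
    refine eventually_nhdsWithin_iff.2 ?_
    filter_upwards [hev1, hev2] with y h1 h2 hmem
    refine h1.trans ?_
    have hcard : ((Finset.univ.erase i).card : ℝ) = (q : ℝ) - 1 := by
      rw [Finset.card_erase_of_mem (Finset.mem_univ i), Finset.card_univ, Fintype.card_fin,
        Nat.cast_sub (by omega), Nat.cast_one]
    have hne : (Finset.univ.erase i).Nonempty := by
      rw [← Finset.card_pos, ← Nat.cast_pos (α := ℝ), hcard]
      linarith
    have hJ := card_mul_colourEnergy_le hβ0 (Finset.univ.erase i) hne y fun k hk =>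
      ⟨hmem.1 k, (h2 k (Finset.ne_of_mem_erase hk)).le⟩
    have hsum := hmem.2
    rw [← Finset.add_sum_erase _ _ (Finset.mem_univ i)] at hsum
    have hq1' : (q : ℝ) - 1 ≠ 0 := by linarith
    rw [hcard, show ∑ k ∈ Finset.univ.erase i, y k = 1 - y i by linarith] at hJ
    simp only [hψ]
    rw [freeEnergy_eq_sum, sum_orderedPoint, freeEnergy_eq_sum,
      ← Finset.add_sum_erase _ _ (Finset.mem_univ i)]
    have e1 : (1 + ((q : ℝ) - 1) * (((q : ℝ) * y i - 1) / ((q : ℝ) - 1))) / q = y i := by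
      field_simp
      ring
    have e2 : (1 - ((q : ℝ) * y i - 1) / ((q : ℝ) - 1)) / q = (1 - y i) / ((q : ℝ) - 1) := by
      field_simp
      ring
    rw [e1, e2]
    linarith

/-- Around each minimum there is a shell on which the free energy is strictly larger. -/
theorem exists_shell {q : ℕ} (hq : 2 ≤ q) {β : ℝ} (hβ : betaOne q < β)
    {i : Fin (q + 1)} (hi : i ∈ indexSet q β) :
    ∃ r c : ℝ, 0 < r ∧ 0 < c ∧
      (∀ j, j ≠ i → 2 * r ≤ dist (minimum q β j) (minimum q β i)) ∧
      ∀ y ∈ stdSimplex ℝ (Fin q), r / 2 ≤ dist y (minimum q β i) → dist y (minimum q β i) ≤ r →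
        freeEnergy β (minimum q β i) + c ≤ freeEnergy β y := by
  set x := minimum q β i with hx
  obtain ⟨r₁, hr₁, hball⟩ := Metric.eventually_nhds_iff.1
    (eventually_nhdsWithin_iff.1 (isLocalMinOn_minimum hq hβ hi))
  obtain ⟨r₂, hr₂, hsep⟩ : ∃ r₂ : ℝ, 0 < r₂ ∧
      ∀ j, j ≠ i → 2 * r₂ ≤ dist (minimum q β j) x := by
    have hev : ∀ᶠ r in nhdsWithin (0 : ℝ) (Set.Ioi 0), ∀ j, j ≠ i →
        2 * r ≤ dist (minimum q β j) x := by
      rw [eventually_all]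
      intro j
      by_cases hj : j = i
      · exact Eventually.of_forall fun r h => absurd hj h
      · have hpos : 0 < dist (minimum q β j) x :=
          dist_pos.2 fun h => hj (minimum_injective hq hβ h)
        have : ∀ᶠ r in nhds (0 : ℝ), 2 * r < dist (minimum q β j) x :=
          (by fun_prop : Continuous fun r : ℝ => 2 * r).continuousAt.eventually_lt
            continuousAt_const (by simpa using hpos)
        exact (this.filter_mono nhdsWithin_le_nhds).mono fun r h _ => h.le
    obtain ⟨r, h1, h2⟩ := (hev.and self_mem_nhdsWithin).exists
    exact ⟨r, h2, h1⟩
  set r := min (r₁ / 2) r₂ with hr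
  have hr0 : 0 < r := lt_min (by linarith) hr₂
  have hrr₁ : r < r₁ := (min_le_left _ _).trans_lt (by linarith)
  have hrr₂ : r ≤ r₂ := min_le_right _ _
  set K := stdSimplex ℝ (Fin q) ∩ {y | r / 2 ≤ dist y x ∧ dist y x ≤ r} with hK
  have hKc : IsCompact K := (isCompact_stdSimplex ℝ (Fin q)).inter_right
    (isClosed_Icc.preimage (by fun_prop : Continuous fun y => dist y x))
  have hstrict : ∀ y ∈ K, freeEnergy β x < freeEnergy β y := by
    rintro y ⟨hy, hy1, hy2⟩
    have h1 : freeEnergy β x ≤ freeEnergy β y := hball (hy2.trans_lt hrr₁) hy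
    -- A shell point with the same energy would itself be a local minimum, hence one of the listed
    -- points; but all of those are off the shell.
    refine lt_of_le_of_ne h1 fun heq => ?_
    have hloc : IsLocalMinOn (freeEnergy β) (stdSimplex ℝ (Fin q)) y := by
      refine eventually_nhdsWithin_iff.2 (Metric.eventually_nhds_iff.2
        ⟨r₁ - r, by linarith, fun z hz hzm => ?_⟩)
      change freeEnergy β y ≤ freeEnergy β z
      rw [← heq]
      exact hball ((dist_triangle z y x).trans_lt (by linarith)) hzm
    obtain ⟨j, -, hj⟩ := exists_eq_minimum hq hβ hy hloc
    by_cases hji : j = i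
    · rw [hji] at hj
      rw [hj, dist_self] at hy1
      linarith
    · have := hsep j hji
      rw [← hj] at this
      linarith
  have hfin : ∃ c, 0 < c ∧ ∀ y ∈ K, freeEnergy β x + c ≤ freeEnergy β y := by
    rcases K.eq_empty_or_nonempty with h | h
    · exact ⟨1, one_pos, fun y hy => by simp [h] at hy⟩
    · obtain ⟨z, hz, hzmin⟩ := hKc.exists_isMinOn h (continuous_freeEnergy β).continuousOn
      refine ⟨freeEnergy β z - freeEnergy β x, sub_pos.2 (hstrict z hz), fun y hy => ?_⟩
      have : freeEnergy β z ≤ freeEnergy β y := hzmin hy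
      linarith
  obtain ⟨c, hc, hcK⟩ := hfin
  refine ⟨r, c, hr0, hc, fun j hj => ?_, fun y hy h1 h2 => hcK y ⟨hy, h1, h2⟩⟩
  linarith [hsep j hj]

/-- Within a sublevel set, every point of a compact set is chain connected to a local minimum. -/
theorem exists_chain_to_localMin {E : Type*} [MetricSpace E] {S : Set E} (hS : IsCompact S)
    {F : E → ℝ} (hF : ContinuousOn F S) {x : E} (hx : x ∈ S) {η : ℝ} (hη : 0 < η) :
    ∃ y ∈ S, IsLocalMinOn F S y ∧ Relation.ReflTransGen
      (fun a b => b ∈ S ∧ F b ≤ F x ∧ dist a b < η) x y := by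
  set R : E → E → Prop := fun a b => b ∈ S ∧ F b ≤ F x ∧ dist a b < η with hR
  set C := {y | Relation.ReflTransGen R x y} with hC
  have hCS : C ⊆ S ∩ {y | F y ≤ F x} := by
    intro y hy
    rcases Relation.ReflTransGen.cases_tail hy with h | ⟨z, -, h⟩
    · rw [h]
      exact ⟨hx, le_refl (F x)⟩
    · exact ⟨h.1, h.2.1⟩
  have hsub : IsCompact (S ∩ {y | F y ≤ F x}) :=
    hS.of_isClosed_subset (hF.preimage_isClosed_of_isClosed hS.isClosed isClosed_Iic)
      Set.inter_subset_left
  -- A limit of reachable points is within one jump of one of them, so it is reachable. A minimiser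
  -- over this compact set is a local minimum on `S`, since lower points within distance `η` would
  -- also be reachable.
  have hCcl : IsClosed C := by
    refine isClosed_of_closure_subset fun y hy => ?_
    have hyS := closure_minimal hCS hsub.isClosed hy
    obtain ⟨c, hc, hcy⟩ := Metric.mem_closure_iff.1 hy η hη
    exact Relation.ReflTransGen.tail hc ⟨hyS.1, hyS.2, by rwa [dist_comm]⟩
  have hCc : IsCompact C := hsub.of_isClosed_subset hCcl hCS
  obtain ⟨y, hy, hmin⟩ := hCc.exists_isMinOn ⟨x, Relation.ReflTransGen.refl⟩
    (hF.mono fun z hz => (hCS hz).1)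
  refine ⟨y, (hCS hy).1, ?_, hy⟩
  refine eventually_nhdsWithin_iff.2 (Metric.eventually_nhds_iff.2 ⟨η, hη, fun z hz hzS => ?_⟩)
  by_contra hlt
  have hlt : F z < F y := not_le.1 hlt
  have hzC : z ∈ C := Relation.ReflTransGen.tail hy
    ⟨hzS, hlt.le.trans (hCS hy).2, by rwa [dist_comm]⟩
  exact absurd (hmin hzC) (not_le.2 hlt)

/-! ### Colour counts and classes of configurations -/

section

variable {N q : ℕ}

/-- The number of vertices of each colour. -/
def colourCount (σ : Config N q) : Fin q → Fin (N + 1) := fun k =>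
  ⟨(Finset.univ.filter fun i => σ i = k).card,
    Nat.lt_succ_of_le ((Finset.card_filter_le _ _).trans (by simp))⟩

theorem colourCount_val (σ : Config N q) (k : Fin q) :
    (colourCount σ k : ℕ) = (Finset.univ.filter fun i => σ i = k).card := rfl

theorem empirical_eq (σ : Config N q) (k : Fin q) :
    empirical σ k = ((colourCount σ k : ℕ) : ℝ) / N := rfl

theorem empirical_congr {σ η : Config N q} (h : colourCount σ = colourCount η) :
    empirical σ = empirical η := by
  funext k
  rw [empirical_eq, empirical_eq, h]

theorem colourCount_eq_of_empirical_eq (hN : 0 < N) {σ η : Config N q}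
    (h : empirical σ = empirical η) : colourCount σ = colourCount η := by
  funext k
  have hk := congrFun h k
  have hN' : (N : ℝ) ≠ 0 := by exact_mod_cast hN.ne'
  rw [empirical_eq, empirical_eq, div_left_inj' hN'] at hk
  exact Fin.ext (by exact_mod_cast hk)

theorem sum_colourCount (σ : Config N q) : ∑ k, (colourCount σ k : ℕ) = N := by
  simp only [colourCount_val]
  rw [← Finset.card_eq_sum_card_fiberwise (f := σ) (s := Finset.univ) (t := Finset.univ)
    (by simp)]
  simp

theorem empirical_mem (hN : 0 < N) (σ : Config N q) : empirical σ ∈ stdSimplex ℝ (Fin q) := by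
  have hN' : (N : ℝ) ≠ 0 := by exact_mod_cast hN.ne'
  refine ⟨fun k => by rw [empirical_eq]; positivity, ?_⟩
  simp only [empirical_eq]
  rw [← Finset.sum_div, div_eq_one_iff_eq hN']
  exact_mod_cast sum_colourCount σ

/-! ### Vertex permutations acting on a class -/

theorem colourCount_comp_perm (σ : Config N q) (g : Equiv.Perm (Fin N)) :
    colourCount (σ ∘ g) = colourCount σ := by
  funext k
  refine Fin.ext ?_
  rw [colourCount_val, colourCount_val]
  refine Finset.card_bij (fun i _ => g i) (by simp) (fun _ _ _ _ h => g.injective h) fun i hi => ?_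
  exact ⟨g.symm i, by simpa using hi, by simp⟩

theorem exists_perm_of_colourCount_eq {σ η : Config N q} (h : colourCount η = colourCount σ) :
    ∃ g : Equiv.Perm (Fin N), σ ∘ g = η := by
  have e : ∀ c, Nonempty ({a // η a = c} ≃ {a // σ a = c}) := fun c => by
    refine Fintype.card_eq.1 ?_
    rw [Fintype.card_subtype, Fintype.card_subtype, ← colourCount_val, ← colourCount_val, h]
  refine ⟨Equiv.ofFiberEquiv fun c => (e c).some, ?_⟩
  funext a
  exact Equiv.ofFiberEquiv_map _ a

theorem hammingDist_comp_perm (σ η : Config N q) (g : Equiv.Perm (Fin N)) :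
    hammingDist (σ ∘ g) (η ∘ g) = hammingDist σ η := by
  unfold hammingDist
  refine Finset.card_bij (fun i _ => g i) (by simp) (fun _ _ _ _ h => g.injective h) fun i hi => ?_
  exact ⟨g.symm i, by simpa using hi, by simp⟩

/-- The configurations with the same colour counts as `σ`. -/
def colourClass (σ : Config N q) : Finset (Config N q) :=
  Finset.univ.filter fun η => colourCount η = colourCount σ

theorem mem_colourClass {σ η : Config N q} :
    η ∈ colourClass σ ↔ colourCount η = colourCount σ := by simp [colourClass]

theorem colourClass_card_pos (σ : Config N q) : 0 < (colourClass σ).card :=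
  Finset.card_pos.2 ⟨σ, mem_colourClass.2 rfl⟩

/-- The number of vertex permutations that fix `σ`. -/
def stabCount (σ : Config N q) : ℕ :=
  (Finset.univ.filter fun g : Equiv.Perm (Fin N) => σ ∘ g = σ).card

/-- The permutations carrying `σ` to `τ` form a coset of the stabiliser. -/
theorem card_perm_comp_eq {σ τ : Config N q} (h : colourCount τ = colourCount σ) :
    (Finset.univ.filter fun g : Equiv.Perm (Fin N) => σ ∘ g = τ).card = stabCount σ := by
  obtain ⟨g₀, rfl⟩ := exists_perm_of_colourCount_eq h
  refine Finset.card_bij (fun g _ => g * g₀⁻¹) (fun g hg => ?_)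
    (fun _ _ _ _ h => mul_right_cancel h)
    fun g hg => ⟨g * g₀, ?_, by simp⟩
  · have hg : σ ∘ g = σ ∘ g₀ := by simpa using hg
    simp only [Finset.mem_filter, Finset.mem_univ, true_and]
    rw [Equiv.Perm.coe_mul, ← Function.comp_assoc, hg, Function.comp_assoc, ← Equiv.Perm.coe_mul,
      mul_inv_cancel, Equiv.Perm.coe_one, Function.comp_id]
  · have hg : σ ∘ g = σ := by simpa using hg
    simp only [Finset.mem_filter, Finset.mem_univ, true_and]
    rw [Equiv.Perm.coe_mul, ← Function.comp_assoc, hg]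

theorem card_colourClass_mul_stabCount (σ : Config N q) :
    (colourClass σ).card * stabCount σ = N.factorial := by
  have h := Finset.card_eq_sum_card_fiberwise (f := fun g : Equiv.Perm (Fin N) => σ ∘ g)
    (s := Finset.univ) (t := colourClass σ)
    (fun g _ => Finset.mem_coe.2 (mem_colourClass.2 (colourCount_comp_perm σ g)))
  rw [Finset.sum_congr rfl fun τ hτ => card_perm_comp_eq (mem_colourClass.1 hτ), Finset.sum_const,
    smul_eq_mul, Finset.card_univ, Fintype.card_perm, Fintype.card_fin] at h
  exact h.symm

theorem stabCount_eq (σ : Config N q) :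
    stabCount σ = ∏ k, (colourCount σ k : ℕ).factorial := by
  rw [stabCount, ← Fintype.card_subtype, DomMulAct.stabilizer_card]
  refine Finset.prod_congr rfl fun k _ => ?_
  rw [Fintype.card_subtype, colourCount_val]

theorem stabCount_pos (σ : Config N q) : 0 < stabCount σ := by
  rw [stabCount_eq]
  exact Finset.prod_pos fun k _ => Nat.factorial_pos _

/-! ### Energy and entropy of a class -/

theorem sum_pairs_eq (σ : Config N q) :
    2 * ∑ i : Fin N, ∑ j : Fin N, (if i < j ∧ σ i = σ j then (1 : ℝ) else 0) + N =
      ∑ k, ((colourCount σ k : ℕ) : ℝ) ^ 2 := by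
  have h1 : ∑ k, ((colourCount σ k : ℕ) : ℝ) ^ 2 =
      ∑ i : Fin N, ∑ j : Fin N, if σ i = σ j then (1 : ℝ) else 0 := by
    have hc : ∀ k, ((colourCount σ k : ℕ) : ℝ) = ∑ i : Fin N, if σ i = k then (1 : ℝ) else 0 := by
      intro k
      rw [colourCount_val, Finset.sum_boole]
    simp only [hc, sq, Finset.sum_mul_sum]
    rw [Finset.sum_comm]
    refine Finset.sum_congr rfl fun i _ => ?_
    rw [Finset.sum_comm]
    refine Finset.sum_congr rfl fun j _ => ?_
    rw [Finset.sum_eq_single (σ i)]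
    · simp [eq_comm]
    · intro k _ hk
      simp [hk.symm]
    · simp
  have h2 : ∑ i : Fin N, ∑ j : Fin N, (if i < j ∧ σ i = σ j then (1 : ℝ) else 0) =
      ∑ i : Fin N, ∑ j : Fin N, (if j < i ∧ σ i = σ j then (1 : ℝ) else 0) := by
    rw [Finset.sum_comm]
    refine Finset.sum_congr rfl fun i _ => Finset.sum_congr rfl fun j _ => ?_
    simp only [eq_comm]
  have h3 : (N : ℝ) = ∑ i : Fin N, ∑ j : Fin N, (if i = j then (1 : ℝ) else 0) := by simp
  rw [h1, two_mul]
  nth_rewrite 2 [h2]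
  nth_rewrite 1 [h3]
  rw [← Finset.sum_add_distrib, ← Finset.sum_add_distrib]
  refine Finset.sum_congr rfl fun i _ => ?_
  rw [← Finset.sum_add_distrib, ← Finset.sum_add_distrib]
  refine Finset.sum_congr rfl fun j _ => ?_
  rcases lt_trichotomy i j with h | h | h
  · simp [h, h.not_gt, h.ne]
  · simp [h]
  · simp [h, h.not_gt, h.ne']

theorem meanFieldHamiltonian_eq (hN : 0 < N) (σ : Config N q) :
    meanFieldHamiltonian σ = -((N : ℝ) / 2) * ∑ k, empirical σ k ^ 2 + 1 / 2 := by
  have hN' : (N : ℝ) ≠ 0 := by exact_mod_cast hN.ne'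
  have h := sum_pairs_eq σ
  unfold meanFieldHamiltonian hamiltonian
  simp only [empirical_eq, div_pow]
  rw [← Finset.sum_div, ← h]
  field_simp
  ring

theorem meanFieldHamiltonian_congr (hN : 0 < N) {σ η : Config N q}
    (h : colourCount σ = colourCount η) : meanFieldHamiltonian σ = meanFieldHamiltonian η := by
  rw [meanFieldHamiltonian_eq hN, meanFieldHamiltonian_eq hN, empirical_congr h]

theorem le_log_factorial (n : ℕ) : n * Real.log n - n ≤ Real.log n.factorial := by
  rcases Nat.eq_zero_or_pos n with rfl | hn
  · simp
  have h := Real.pow_div_factorial_le_exp (x := (n : ℝ)) (by positivity) n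
  have hf : (0 : ℝ) < n.factorial := by exact_mod_cast Nat.factorial_pos n
  have hn' : (0 : ℝ) < n := by exact_mod_cast hn
  have := Real.log_le_log (by positivity) h
  rw [Real.log_exp, Real.log_div (by positivity) hf.ne', Real.log_pow] at this
  linarith

theorem log_factorial_le (n : ℕ) :
    Real.log n.factorial ≤ n * Real.log n - n + (Real.log (n + 1) + 1) := by
  -- With m = n + 1 the bound reads (m + 1) log m - m + 1; the shift keeps the induction away from
  -- log 0.
  have key : ∀ n : ℕ, Real.log (n + 1).factorial ≤
      ((n : ℝ) + 2) * Real.log ((n : ℝ) + 1) - n := by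
    intro n
    induction n with
    | zero => simp
    | succ n ih =>
      rw [Nat.factorial_succ, Nat.cast_mul, Real.log_mul (by positivity)
        (by exact_mod_cast (Nat.factorial_pos _).ne')]
      have hlog : ((n : ℝ) + 2) * (Real.log ((n : ℝ) + 2) - Real.log ((n : ℝ) + 1)) ≥ 1 := by
        rw [← Real.log_div (by positivity) (by positivity)]
        have := Real.one_sub_inv_le_log_of_pos (x := ((n : ℝ) + 2) / ((n : ℝ) + 1)) (by positivity)
        have e : 1 - (((n : ℝ) + 2) / ((n : ℝ) + 1))⁻¹ = 1 / ((n : ℝ) + 2) := by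
          field_simp
          ring
        rw [e] at this
        calc (1 : ℝ) = ((n : ℝ) + 2) * (1 / ((n : ℝ) + 2)) := by field_simp
          _ ≤ _ := by gcongr
      have e1 : ((n + 1 + 1 : ℕ) : ℝ) = (n : ℝ) + 2 := by push_cast; ring
      have e2 : ((n + 1 : ℕ) : ℝ) + 1 = (n : ℝ) + 2 := by push_cast; ring
      rw [e1, e2]
      push_cast
      nlinarith
  rcases n with _ | n
  · simp
  have h := key n
  have hmono : Real.log ((n : ℝ) + 1) ≤ Real.log ((n : ℝ) + 1 + 1) :=
    Real.log_le_log (by positivity) (by linarith)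
  push_cast
  nlinarith

/-- Stirling for the multinomial coefficient: `N` and each of the `q` counts contribute an error of
at most log(N + 1) + 1. Unused colours fit in because 0 log 0 = 0. -/
theorem log_card_colourClass (hN : 0 < N) (σ : Config N q) :
    |Real.log (colourClass σ).card + N * ∑ k, empirical σ k * Real.log (empirical σ k)| ≤
      (q + 1) * (Real.log (N + 1) + 1) := by
  have hN' : (0 : ℝ) < N := by exact_mod_cast hN
  have hcard : (0 : ℝ) < (colourClass σ).card := by exact_mod_cast colourClass_card_pos σ
  have hstab : (0 : ℝ) < stabCount σ := by exact_mod_cast stabCount_pos σ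
  have h1 : Real.log (colourClass σ).card + ∑ k, Real.log (colourCount σ k : ℕ).factorial =
      Real.log N.factorial := by
    rw [← card_colourClass_mul_stabCount σ, Nat.cast_mul, Real.log_mul hcard.ne' hstab.ne',
      stabCount_eq, Nat.cast_prod, Real.log_prod]
    exact fun k _ => by exact_mod_cast (Nat.factorial_pos _).ne'
  have hsum : ∑ k, ((colourCount σ k : ℕ) : ℝ) = N := by exact_mod_cast sum_colourCount σ
  have h2 : (N : ℝ) * ∑ k, empirical σ k * Real.log (empirical σ k) =
      ∑ k, ((colourCount σ k : ℕ) : ℝ) * Real.log (colourCount σ k : ℕ) - N * Real.log N := by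
    have e : (N : ℝ) * Real.log N = ∑ k, ((colourCount σ k : ℕ) : ℝ) * Real.log N := by
      rw [← Finset.sum_mul, hsum]
    rw [e, ← Finset.sum_sub_distrib, Finset.mul_sum]
    refine Finset.sum_congr rfl fun k _ => ?_
    rw [empirical_eq]
    rcases Nat.eq_zero_or_pos (colourCount σ k : ℕ) with h | h
    · simp [h]
    · have h' : (0 : ℝ) < (colourCount σ k : ℕ) := by exact_mod_cast h
      rw [Real.log_div h'.ne' hN'.ne']
      field_simp
  have hlow : ∑ k, (((colourCount σ k : ℕ) : ℝ) * Real.log (colourCount σ k : ℕ) -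
      (colourCount σ k : ℕ)) ≤ ∑ k, Real.log (colourCount σ k : ℕ).factorial :=
    Finset.sum_le_sum fun k _ => le_log_factorial _
  have hup : ∑ k, Real.log (colourCount σ k : ℕ).factorial ≤
      ∑ k, (((colourCount σ k : ℕ) : ℝ) * Real.log (colourCount σ k : ℕ) -
      (colourCount σ k : ℕ) + (Real.log (N + 1) + 1)) := by
    refine Finset.sum_le_sum fun k _ => (log_factorial_le _).trans ?_
    have : ((colourCount σ k : ℕ) : ℝ) ≤ N := by
      exact_mod_cast Nat.le_of_lt_succ (colourCount σ k).2
    gcongr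
  rw [Finset.sum_sub_distrib, hsum] at hlow
  rw [Finset.sum_add_distrib, Finset.sum_sub_distrib, hsum, Finset.sum_const, Finset.card_univ,
    Fintype.card_fin, nsmul_eq_mul] at hup
  have hN1 := le_log_factorial N
  have hN2 := log_factorial_le N
  have hl0 : 0 ≤ Real.log ((N : ℝ) + 1) := Real.log_nonneg (by linarith)
  have hq0 : (0 : ℝ) ≤ q := Nat.cast_nonneg q
  have : 0 ≤ (q : ℝ) * (Real.log (N + 1) + 1) := by positivity
  rw [h2, abs_le]
  constructor <;> linarith

/-- The total mean-field weight of the class of `σ`. -/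
def classWeight (β : ℝ≥0) (σ : Config N q) : ℝ :=
  (colourClass σ).card * weight β meanFieldHamiltonian σ

theorem classWeight_pos (β : ℝ≥0) (σ : Config N q) : 0 < classWeight β σ :=
  mul_pos (by exact_mod_cast colourClass_card_pos σ) (weight_pos _ _ _)

/-- The error in the free-energy approximation of the class weights. -/
def entropyError (β : ℝ≥0) (q N : ℕ) : ℝ := (q + 1) * (Real.log (N + 1) + 1) + β / 2

/-- Energy and entropy combine to -βN times the free energy. The term β/2 comes from the diagonal
pairs in the square of the counts. -/
theorem abs_log_classWeight (hN : 0 < N) {β : ℝ≥0} (hβ : 0 < β) (σ : Config N q) :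
    |Real.log (classWeight β σ) + β * N * freeEnergy β (empirical σ)| ≤ entropyError β q N := by
  have hβ' : (0 : ℝ) < β := hβ
  have hcard : (0 : ℝ) < (colourClass σ).card := by exact_mod_cast colourClass_card_pos σ
  have h := log_card_colourClass hN σ
  have e : Real.log (classWeight β σ) + β * N * freeEnergy β (empirical σ) =
      (Real.log (colourClass σ).card + N * ∑ k, empirical σ k * Real.log (empirical σ k)) -
        β / 2 := by
    unfold classWeight weight
    rw [Real.log_mul hcard.ne' (Real.exp_pos _).ne', Real.log_exp, meanFieldHamiltonian_eq hN,
      freeEnergy]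
    field_simp
    ring
  rw [e, entropyError]
  rw [abs_le] at h ⊢
  constructor <;> linarith

end

/-! ### Capacity bounds for the mean-field chain -/

section

variable {N q : ℕ} (β : ℝ≥0)

theorem conductance_comp_perm (hN : 0 < N) (σ η : Config N q) (g : Equiv.Perm (Fin N)) :
    conductance β meanFieldHamiltonian (σ ∘ g) (η ∘ g) =
      conductance β meanFieldHamiltonian σ η := by
  unfold conductance
  rw [hammingDist_comp_perm, meanFieldHamiltonian_congr hN (colourCount_comp_perm σ g),
    meanFieldHamiltonian_congr hN (colourCount_comp_perm η g)]

theorem sum_perm_comp (σ : Config N q) (F : Config N q → ℝ) :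
    ∑ g : Equiv.Perm (Fin N), F (σ ∘ g) = stabCount σ * ∑ τ ∈ colourClass σ, F τ := by
  rw [← Finset.sum_fiberwise_of_maps_to (t := colourClass σ)
    (g := fun g : Equiv.Perm (Fin N) => σ ∘ g)
    fun g _ => mem_colourClass.2 (colourCount_comp_perm σ g), Finset.mul_sum]
  refine Finset.sum_congr rfl fun τ hτ => ?_
  rw [Finset.sum_congr rfl fun g hg => by rw [(Finset.mem_filter.1 hg).2], Finset.sum_const,
    card_perm_comp_eq (mem_colourClass.1 hτ), nsmul_eq_mul]

/-- All permuted copies of an edge have the same conductance and start in the class of `σ`, each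
starting point occurring `stabCount σ` times. Averaging over permutations is what handles functions
`f` without symmetry. -/
theorem conductance_mul_sum_perm_le (hN : 0 < N) (σ η : Config N q) (f : Config N q → ℝ) :
    conductance β meanFieldHamiltonian σ η *
      ∑ g : Equiv.Perm (Fin N), (f (σ ∘ g) - f (η ∘ g)) ^ 2 ≤
        stabCount σ * (2 * dirichletForm β meanFieldHamiltonian f) := by
  set E : Config N q → ℝ := fun τ =>
    ∑ τ', conductance β meanFieldHamiltonian τ τ' * (f τ - f τ') ^ 2 with hE
  have hterm : ∀ τ τ', 0 ≤ conductance β meanFieldHamiltonian τ τ' * (f τ - f τ') ^ 2 :=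
    fun τ τ' => mul_nonneg (conductance_nonneg _ _ _ _) (sq_nonneg _)
  have hE0 : ∀ τ, 0 ≤ E τ := fun τ => Finset.sum_nonneg fun τ' _ => hterm τ τ'
  calc conductance β meanFieldHamiltonian σ η *
      ∑ g : Equiv.Perm (Fin N), (f (σ ∘ g) - f (η ∘ g)) ^ 2
      = ∑ g : Equiv.Perm (Fin N), conductance β meanFieldHamiltonian (σ ∘ g) (η ∘ g) *
          (f (σ ∘ g) - f (η ∘ g)) ^ 2 := by
        rw [Finset.mul_sum]
        exact Finset.sum_congr rfl fun g _ => by rw [conductance_comp_perm β hN]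
    _ ≤ ∑ g : Equiv.Perm (Fin N), E (σ ∘ g) := Finset.sum_le_sum fun g _ =>
        Finset.single_le_sum (fun τ' _ => hterm (σ ∘ g) τ') (Finset.mem_univ (η ∘ g))
    _ = stabCount σ * ∑ τ ∈ colourClass σ, E τ := sum_perm_comp σ E
    _ ≤ stabCount σ * ∑ τ, E τ := by
        refine mul_le_mul_of_nonneg_left ?_ (Nat.cast_nonneg _)
        exact Finset.sum_le_sum_of_subset_of_nonneg (Finset.subset_univ _) fun τ _ _ => hE0 τ
    _ = _ := by
        rw [dirichletForm, hE]
        ring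

/-- The conductance of an edge is 1/(Nq) times the weight of its end of higher energy, and class
size times stabiliser is N!. The minimum is below the class weight of that end. -/
theorem classWeight_mul_sum_perm_le (hN : 0 < N) (hq : 0 < q) {σ η : Config N q}
    (h : hammingDist σ η = 1) (f : Config N q → ℝ) :
    min (classWeight β σ) (classWeight β η) *
      ∑ g : Equiv.Perm (Fin N), (f (σ ∘ g) - f (η ∘ g)) ^ 2 ≤
        2 * N * q * N.factorial * dirichletForm β meanFieldHamiltonian f := by
  have key : ∀ σ η : Config N q, hammingDist σ η = 1 →
      meanFieldHamiltonian η ≤ meanFieldHamiltonian σ →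
      classWeight β σ * ∑ g : Equiv.Perm (Fin N), (f (σ ∘ g) - f (η ∘ g)) ^ 2 ≤
        2 * N * q * N.factorial * dirichletForm β meanFieldHamiltonian f := by
    intro σ η h hle
    have h1 := conductance_mul_sum_perm_le β hN σ η f
    have hN' : (0 : ℝ) < N := by exact_mod_cast hN
    have hq' : (0 : ℝ) < q := by exact_mod_cast hq
    have e : classWeight β σ =
        (N * q) * ((colourClass σ).card * conductance β meanFieldHamiltonian σ η) := by
      rw [conductance, if_pos h, max_eq_left hle, classWeight, weight]
      field_simp
    have hf : ((colourClass σ).card : ℝ) * stabCount σ = N.factorial := by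
      exact_mod_cast card_colourClass_mul_stabCount σ
    calc classWeight β σ * ∑ g : Equiv.Perm (Fin N), (f (σ ∘ g) - f (η ∘ g)) ^ 2
        = (N * q * (colourClass σ).card) * (conductance β meanFieldHamiltonian σ η *
          ∑ g : Equiv.Perm (Fin N), (f (σ ∘ g) - f (η ∘ g)) ^ 2) := by rw [e]; ring
      _ ≤ (N * q * (colourClass σ).card) *
          (stabCount σ * (2 * dirichletForm β meanFieldHamiltonian f)) := by gcongr
      _ = _ := by rw [← hf]; ring
  have hS : 0 ≤ ∑ g : Equiv.Perm (Fin N), (f (σ ∘ g) - f (η ∘ g)) ^ 2 :=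
    Finset.sum_nonneg fun _ _ => sq_nonneg _
  rcases le_total (meanFieldHamiltonian η) (meanFieldHamiltonian σ) with hle | hle
  · exact (mul_le_mul_of_nonneg_right (min_le_left _ _) hS).trans (key σ η h hle)
  · refine (mul_le_mul_of_nonneg_right (min_le_right _ _) hS).trans ?_
    have := key η σ (by rwa [hammingDist_comm]) hle
    simpa only [fun g : Equiv.Perm (Fin N) => show (f (η ∘ g) - f (σ ∘ g)) ^ 2 =
      (f (σ ∘ g) - f (η ∘ g)) ^ 2 by ring] using this

theorem one_le_mul_sum_sq {a : ℕ → ℝ} {L : ℕ} (h0 : a 0 = 1) (hL : a L = 0) :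
    1 ≤ (L : ℝ) * ∑ k ∈ Finset.range L, (a k - a (k + 1)) ^ 2 := by
  have h1 : ∑ k ∈ Finset.range L, (a k - a (k + 1)) = 1 := by
    rw [Finset.sum_range_sub', h0, hL, sub_zero]
  have h2 := sq_sum_le_card_mul_sum_sq (s := Finset.range L) (f := fun k => a k - a (k + 1))
  rw [h1, Finset.card_range] at h2
  linarith

/-- The weight of `X` in the class of the starting point of a path to the zero set of `f`, on which
the class weights do not drop below `B`, is controlled by the Dirichlet form. -/
theorem class_weight_le_of_path (hN : 0 < N) (hq : 0 < q) {X : Set (Config N q)}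
    {f : Config N q → ℝ} (hX : ∀ σ ∈ X, f σ = 1) {p : ℕ → Config N q} {L : ℕ}
    (hstep : ∀ k < L, hammingDist (p k) (p (k + 1)) = 1)
    (hend : ∀ g : Equiv.Perm (Fin N), f (p L ∘ g) = 0) {B : ℝ} (hB : 0 < B)
    (hlevel : ∀ k ≤ L, B ≤ classWeight β (p k)) :
    B * ∑ τ ∈ colourClass (p 0), X.indicator (weight β meanFieldHamiltonian) τ ≤
      classWeight β (p 0) * (2 * N * q * (L : ℝ) ^ 2 * dirichletForm β meanFieldHamiltonian f) := by
  classical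
  set D := dirichletForm β meanFieldHamiltonian f with hD
  set w := weight β meanFieldHamiltonian (p 0) with hw
  have hw0 : 0 < w := weight_pos _ _ _
  have hstab : (0 : ℝ) < stabCount (p 0) := by exact_mod_cast stabCount_pos (p 0)
  have hfac : ((colourClass (p 0)).card : ℝ) * stabCount (p 0) = N.factorial := by
    exact_mod_cast card_colourClass_mul_stabCount (p 0)
  have h1 : ∑ g : Equiv.Perm (Fin N), X.indicator (weight β meanFieldHamiltonian) (p 0 ∘ g) =
      stabCount (p 0) * ∑ τ ∈ colourClass (p 0),
        X.indicator (weight β meanFieldHamiltonian) τ := sum_perm_comp _ _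
  -- Along the permuted path `f` falls from 1 to 0 in `L` steps, so by Cauchy–Schwarz `L` times the
  -- sum of squared increments is at least 1.
  have h2 : ∀ g : Equiv.Perm (Fin N), X.indicator (weight β meanFieldHamiltonian) (p 0 ∘ g) ≤
      w * (L * ∑ k ∈ Finset.range L, (f (p k ∘ g) - f (p (k + 1) ∘ g)) ^ 2) := by
    intro g
    by_cases h : p 0 ∘ g ∈ X
    · rw [Set.indicator_of_mem h]
      have e : weight β meanFieldHamiltonian (p 0 ∘ g) = w := by
        rw [hw, weight, weight, meanFieldHamiltonian_congr hN (colourCount_comp_perm _ _)]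
      rw [e]
      exact le_mul_of_one_le_right hw0.le
        (one_le_mul_sum_sq (a := fun k => f (p k ∘ g)) (hX _ h) (hend g))
    · rw [Set.indicator_of_notMem h]
      have : 0 ≤ ∑ k ∈ Finset.range L, (f (p k ∘ g) - f (p (k + 1) ∘ g)) ^ 2 :=
        Finset.sum_nonneg fun _ _ => sq_nonneg _
      positivity
  have h3 : ∀ k ∈ Finset.range L,
      B * ∑ g : Equiv.Perm (Fin N), (f (p k ∘ g) - f (p (k + 1) ∘ g)) ^ 2 ≤
        2 * N * q * N.factorial * D := by
    intro k hk
    have hk := Finset.mem_range.1 hk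
    refine le_trans ?_ (classWeight_mul_sum_perm_le β hN hq (hstep k hk) f)
    refine mul_le_mul_of_nonneg_right (le_min (hlevel k hk.le) (hlevel (k + 1) hk))
      (Finset.sum_nonneg fun _ _ => sq_nonneg _)
  have h4 : B * (stabCount (p 0) * ∑ τ ∈ colourClass (p 0),
      X.indicator (weight β meanFieldHamiltonian) τ) ≤
      w * L * (L * (2 * N * q * N.factorial * D)) := by
    rw [← h1]
    calc B * ∑ g : Equiv.Perm (Fin N), X.indicator (weight β meanFieldHamiltonian) (p 0 ∘ g)
        ≤ B * ∑ g : Equiv.Perm (Fin N),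
          w * (L * ∑ k ∈ Finset.range L, (f (p k ∘ g) - f (p (k + 1) ∘ g)) ^ 2) := by
          gcongr with g
          exact h2 g
      _ = w * L * ∑ k ∈ Finset.range L,
          B * ∑ g : Equiv.Perm (Fin N), (f (p k ∘ g) - f (p (k + 1) ∘ g)) ^ 2 := by
          rw [← Finset.mul_sum, ← Finset.mul_sum, Finset.sum_comm, ← Finset.mul_sum]
          ring
      _ ≤ w * L * ∑ _k ∈ Finset.range L, (2 * N * q * N.factorial * D) := by
          exact mul_le_mul_of_nonneg_left (Finset.sum_le_sum h3) (by positivity)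
      _ = _ := by rw [Finset.sum_const, Finset.card_range, nsmul_eq_mul]
  rw [← hfac] at h4
  refine le_of_mul_le_mul_left ?_ hstab
  calc (stabCount (p 0) : ℝ) * (B * ∑ τ ∈ colourClass (p 0),
        X.indicator (weight β meanFieldHamiltonian) τ)
      = B * (stabCount (p 0) * ∑ τ ∈ colourClass (p 0),
        X.indicator (weight β meanFieldHamiltonian) τ) := by ring
    _ ≤ _ := h4
    _ = _ := by rw [classWeight]; ring

theorem setWeight_le_of_class_le {H : Config N q → ℝ} {X : Set (Config N q)} {B : ℝ} (hB : 0 ≤ B)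
    (h : ∀ σ ∈ X, ∑ τ ∈ colourClass σ, X.indicator (weight β H) τ ≤ B) :
    setWeight β H X ≤ ((N : ℝ) + 1) ^ q * B := by
  classical
  unfold setWeight
  rw [← Finset.sum_fiberwise (Finset.univ : Finset (Config N q)) colourCount
    fun σ => X.indicator (weight β H) σ]
  calc ∑ y, ∑ σ with colourCount σ = y, X.indicator (weight β H) σ
      ≤ ∑ _y : Fin q → Fin (N + 1), B := by
        refine Finset.sum_le_sum fun y _ => ?_
        by_cases hy : ∃ σ ∈ X, colourCount σ = y
        · obtain ⟨σ, hσ, rfl⟩ := hy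
          exact h σ hσ
        · refine le_of_eq_of_le (Finset.sum_eq_zero fun σ hσ => ?_) hB
          exact Set.indicator_of_notMem (fun hX => hy ⟨σ, hX, (Finset.mem_filter.1 hσ).2⟩) _
    _ = _ := by
        rw [Finset.sum_const, Finset.card_univ, nsmul_eq_mul]
        simp

theorem class_sum_le_classWeight (hN : 0 < N) (X : Set (Config N q)) (σ : Config N q) :
    ∑ τ ∈ colourClass σ, X.indicator (weight β meanFieldHamiltonian) τ ≤ classWeight β σ := by
  classical
  calc ∑ τ ∈ colourClass σ, X.indicator (weight β meanFieldHamiltonian) τ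
      ≤ ∑ _τ ∈ colourClass σ, weight β meanFieldHamiltonian σ := by
        refine Finset.sum_le_sum fun τ hτ => ?_
        have e : weight β meanFieldHamiltonian τ = weight β meanFieldHamiltonian σ := by
          rw [weight, weight, meanFieldHamiltonian_congr hN (mem_colourClass.1 hτ)]
        rw [← e]
        exact Set.indicator_le_self' (fun _ _ => (weight_pos _ _ _).le) τ
    _ = classWeight β σ := by rw [Finset.sum_const, nsmul_eq_mul, classWeight]

theorem setWeight_class (hN : 0 < N) (σ : Config N q) :
    setWeight β meanFieldHamiltonian {η : Config N q | empirical η = empirical σ} =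
      classWeight β σ := by
  classical
  have hset : ∀ τ, τ ∈ {η : Config N q | empirical η = empirical σ} ↔ τ ∈ colourClass σ :=
    fun τ => ⟨fun h => mem_colourClass.2 (colourCount_eq_of_empirical_eq hN h),
      fun h => empirical_congr (mem_colourClass.1 h)⟩
  unfold setWeight
  rw [← Finset.sum_subset (Finset.subset_univ (colourClass σ)) fun τ _ hτ =>
    Set.indicator_of_notMem (fun h => hτ ((hset τ).1 h)) _, classWeight, ← nsmul_eq_mul,
    ← Finset.sum_const]
  refine Finset.sum_congr rfl fun τ hτ => ?_
  rw [Set.indicator_of_mem ((hset τ).2 hτ), weight, weight,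
    meanFieldHamiltonian_congr hN (mem_colourClass.1 hτ)]

/-- The Dirichlet form of an indicator is bounded by the weight of its inner boundary. -/
theorem dirichletForm_indicator_le {H : Config N q → ℝ} {A S : Set (Config N q)}
    (hS : ∀ σ ∈ A, ∀ η ∉ A, hammingDist σ η = 1 → σ ∈ S) :
    dirichletForm β H (A.indicator 1) ≤ setWeight β H S := by
  classical
  -- Each crossing edge is charged to its end inside `A`. The at most `N * q` neighbours cancel the
  -- prefactor of the conductance.
  set a : Config N q → Config N q → ℝ := fun σ η =>
    S.indicator (weight β H) σ * if hammingDist σ η = 1 then ((N : ℝ) * q)⁻¹ else 0 with ha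
  have ha0 : ∀ σ η, 0 ≤ a σ η := fun σ η => mul_nonneg
    (Set.indicator_nonneg (fun _ _ => (weight_pos _ _ _).le) σ) (by split_ifs <;> positivity)
  have hsum : ∑ σ, ∑ η, a σ η ≤ setWeight β H S := by
    refine Finset.sum_le_sum fun σ _ => ?_
    rw [← Finset.mul_sum]
    refine mul_le_of_le_one_right (Set.indicator_nonneg (fun _ _ => (weight_pos _ _ _).le) σ) ?_
    rw [← Finset.sum_filter, Finset.sum_const, nsmul_eq_mul]
    calc _ ≤ ((N : ℝ) * q) * ((N : ℝ) * q)⁻¹ := by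
          gcongr
          exact_mod_cast card_neighbours_le σ
      _ ≤ 1 := mul_inv_le_one
  have hbd : ∀ σ ∈ A, ∀ η ∉ A, conductance β H σ η ≤ a σ η := by
    intro σ hσ η hη
    by_cases h : hammingDist σ η = 1
    · simp only [ha, conductance, if_pos h, Set.indicator_of_mem (hS σ hσ η hη h), weight]
      rw [mul_comm]
      refine mul_le_mul_of_nonneg_right (Real.exp_le_exp.2 ?_) (by positivity)
      exact mul_le_mul_of_nonpos_left (le_max_left _ _) (neg_nonpos.2 β.coe_nonneg)
    · rw [conductance, if_neg h]
      exact ha0 σ η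
  have hterm : ∀ σ η, conductance β H σ η *
      (A.indicator (1 : Config N q → ℝ) σ - A.indicator (1 : Config N q → ℝ) η) ^ 2 ≤
        a σ η + a η σ := by
    intro σ η
    by_cases h1 : σ ∈ A <;> by_cases h2 : η ∈ A
    · simp only [Set.indicator_of_mem h1, Set.indicator_of_mem h2, Pi.one_apply, sub_self]
      linarith [ha0 σ η, ha0 η σ]
    · simp only [Set.indicator_of_mem h1, Set.indicator_of_notMem h2, Pi.one_apply, sub_zero,
        one_pow, mul_one]
      linarith [ha0 η σ, hbd σ h1 η h2]
    · simp only [Set.indicator_of_notMem h1, Set.indicator_of_mem h2, Pi.one_apply, zero_sub,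
        neg_sq, one_pow, mul_one]
      rw [conductance_comm]
      linarith [ha0 σ η, hbd η h2 σ h1]
    · simp only [Set.indicator_of_notMem h1, Set.indicator_of_notMem h2, sub_self]
      linarith [ha0 σ η, ha0 η σ]
  have htot : ∑ σ, ∑ η, conductance β H σ η *
      (A.indicator (1 : Config N q → ℝ) σ - A.indicator (1 : Config N q → ℝ) η) ^ 2 ≤
        2 * setWeight β H S := by
    calc _ ≤ ∑ σ, ∑ η, (a σ η + a η σ) :=
          Finset.sum_le_sum fun σ _ => Finset.sum_le_sum fun η _ => hterm σ η
      _ = ∑ σ, ∑ η, a σ η + ∑ σ, ∑ η, a η σ := by simp only [Finset.sum_add_distrib]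
      _ = 2 * ∑ σ, ∑ η, a σ η := by rw [Finset.sum_comm (f := fun σ η => a η σ)]; ring
      _ ≤ _ := by linarith
  unfold dirichletForm
  linarith

end

/-! ### Paths of configurations -/

section

variable {N q : ℕ}

theorem exists_config_of_counts (n : Fin q → ℕ) (hn : ∑ k, n k = N) :
    ∃ σ : Config N q, ∀ k, (colourCount σ k : ℕ) = n k := by
  subst hn
  refine ⟨fun v => (finSigmaFinEquiv.symm v).1, fun k => ?_⟩
  rw [colourCount_val, ← Fintype.card_subtype, ← Fintype.card_fin (n k)]
  refine Fintype.card_congr ?_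
  calc {v // (finSigmaFinEquiv.symm v).1 = k}
      ≃ {p : (i : Fin q) × Fin (n i) // p.1 = k} :=
        finSigmaFinEquiv.symm.subtypeEquiv fun _ => Iff.rfl
    _ ≃ Fin (n k) := Equiv.sigmaSubtype k

/-- Round all `N * z k` down and give the at most `q` remaining vertices to one colour. -/
theorem exists_empirical_near (hN : 0 < N) (hq : 0 < q) {z : Fin q → ℝ}
    (hz : z ∈ stdSimplex ℝ (Fin q)) :
    ∃ σ : Config N q, dist (empirical σ) z ≤ q / N := by
  classical
  have hN' : (0 : ℝ) < N := by exact_mod_cast hN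
  set k₀ : Fin q := ⟨0, hq⟩
  set n : Fin q → ℕ := fun k => ⌊(N : ℝ) * z k⌋₊ with hn
  have hz0 : ∀ k, 0 ≤ (N : ℝ) * z k := fun k => mul_nonneg hN'.le (hz.1 k)
  have hle : ∀ k, (n k : ℝ) ≤ N * z k := fun k => Nat.floor_le (hz0 k)
  have hlt : ∀ k, (N : ℝ) * z k < n k + 1 := fun k => Nat.lt_floor_add_one _
  have hsumz : ∑ k, (N : ℝ) * z k = N := by rw [← Finset.mul_sum, hz.2, mul_one]
  have hS1 : (∑ k, (n k : ℝ)) ≤ N := hsumz ▸ Finset.sum_le_sum fun k _ => hle k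
  have hS2 : (N : ℝ) ≤ ∑ k, (n k : ℝ) + q := by
    have := Finset.sum_le_sum fun k (_ : k ∈ (Finset.univ : Finset (Fin q))) => (hlt k).le
    rw [hsumz, Finset.sum_add_distrib] at this
    simpa using this
  have hS1' : ∑ k, n k ≤ N := by exact_mod_cast hS1
  set r := N - ∑ k, n k with hr
  have hrr : (r : ℝ) ≤ q := by
    have : r ≤ q := by
      have : N ≤ ∑ k, n k + q := by exact_mod_cast hS2
      omega
    exact_mod_cast this
  obtain ⟨σ, hσ⟩ := exists_config_of_counts (N := N) (fun k => n k + if k = k₀ then r else 0) (by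
    rw [Finset.sum_add_distrib, Finset.sum_ite_eq' Finset.univ k₀, if_pos (Finset.mem_univ _)]
    omega)
  refine ⟨σ, (dist_pi_le_iff (by positivity)).2 fun k => ?_⟩
  rw [empirical_eq, hσ, Real.dist_eq]
  have e : ((n k + if k = k₀ then r else 0 : ℕ) : ℝ) / N - z k =
      (((n k + if k = k₀ then r else 0 : ℕ) : ℝ) - N * z k) / N := by field_simp
  rw [e, abs_div, abs_of_pos hN']
  gcongr
  have hq1 : (1 : ℝ) ≤ q := by exact_mod_cast hq
  have h1 := hle k
  have h2 := hlt k
  rw [abs_le]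
  split_ifs
  · push_cast
    have : (0 : ℝ) ≤ r := Nat.cast_nonneg r
    constructor <;> linarith
  · push_cast
    constructor <;> linarith

theorem colourCount_update (σ : Config N q) (v : Fin N) (l j : Fin q) :
    ((colourCount (Function.update σ v l) j : ℕ) : ℤ) =
      (colourCount σ j : ℕ) - (if j = σ v then 1 else 0) + if j = l then 1 else 0 := by
  have hc : ∀ η : Config N q, ((colourCount η j : ℕ) : ℤ) =
      ∑ i, if η i = j then (1 : ℤ) else 0 := by
    intro η
    rw [colourCount_val, Finset.sum_boole]
  have h : ((colourCount (Function.update σ v l) j : ℕ) : ℤ) - (colourCount σ j : ℕ) =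
      (if l = j then 1 else 0) - if σ v = j then (1 : ℤ) else 0 := by
    rw [hc, hc, ← Finset.sum_sub_distrib, Fintype.sum_eq_single v]
    · simp
    · intro i hi
      simp [Function.update_of_ne hi]
  simp only [eq_comm (a := j)]
  linarith

theorem hammingDist_update (σ : Config N q) (v : Fin N) {l : Fin q} (hl : l ≠ σ v) :
    hammingDist σ (Function.update σ v l) = 1 := by
  rw [hammingDist, Finset.card_eq_one]
  refine ⟨v, ?_⟩
  ext i
  simp only [Finset.mem_filter, Finset.mem_univ, true_and, Finset.mem_singleton]
  constructor
  · intro h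
    by_contra hi
    exact h (by rw [Function.update_of_ne hi])
  · rintro rfl
    simpa using hl.symm

theorem abs_colourCount_sub_le {σ η : Config N q} (h : hammingDist σ η = 1) (k : Fin q) :
    |((colourCount σ k : ℕ) : ℝ) - (colourCount η k : ℕ)| ≤ 1 := by
  have hc : ∀ η : Config N q, ((colourCount η k : ℕ) : ℝ) =
      ∑ i, if η i = k then (1 : ℝ) else 0 := by
    intro η
    rw [colourCount_val, Finset.sum_boole]
  rw [hammingDist, Finset.card_eq_one] at h
  obtain ⟨v, hv⟩ := h
  rw [hc, hc, ← Finset.sum_sub_distrib, Fintype.sum_eq_single v]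
  · split_ifs <;> norm_num
  · intro i hi
    have : i ∉ Finset.univ.filter fun j => σ j ≠ η j := by rw [hv]; simpa using hi
    have : σ i = η i := by simpa using this
    rw [this, sub_self]

theorem exists_colourCount_lt {σ τ : Config N q} (h : colourCount σ ≠ colourCount τ) :
    ∃ k, colourCount τ k < colourCount σ k := by
  by_contra hcon
  push Not at hcon
  have h1 : ∀ k ∈ (Finset.univ : Finset (Fin q)), (colourCount σ k : ℕ) ≤ colourCount τ k :=
    fun k _ => Fin.le_def.1 (hcon k)
  have h2 := (Finset.sum_eq_sum_iff_of_le h1).1 ((sum_colourCount σ).trans (sum_colourCount τ).symm)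
  exact h (funext fun k => Fin.ext (h2 k (Finset.mem_univ k)))

/-- From any configuration one can move to the class of `τ` by flips that bring each colour count
closer to that of `τ`. -/
theorem exists_monotone_path (σ τ : Config N q) :
    ∃ σ', colourCount σ' = colourCount τ ∧ Relation.ReflTransGen (fun a b => hammingDist a b = 1 ∧
      ∀ k, ((colourCount b k : ℤ) - (colourCount τ k : ℤ)).natAbs ≤
        ((colourCount σ k : ℤ) - (colourCount τ k : ℤ)).natAbs) σ σ' := by
  induction hd : ∑ k, ((colourCount σ k : ℤ) - (colourCount τ k : ℤ)).natAbs using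
    Nat.strong_induction_on generalizing σ with
  | _ d ih =>
    by_cases heq : colourCount σ = colourCount τ
    · exact ⟨σ, heq, Relation.ReflTransGen.refl⟩
    -- Recolouring a vertex from a surplus colour `k` to a deficit colour `l` lowers the total
    -- discrepancy, the induction variable.
    obtain ⟨k, hk⟩ := exists_colourCount_lt heq
    obtain ⟨l, hl⟩ := exists_colourCount_lt (Ne.symm heq)
    have hk' : (colourCount τ k : ℕ) < colourCount σ k := hk
    have hl' : (colourCount σ l : ℕ) < colourCount τ l := hl
    have hkl : l ≠ k := by rintro rfl; omega
    obtain ⟨v, hv⟩ : ∃ v, σ v = k := by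
      have : 0 < (colourCount σ k : ℕ) := by omega
      rw [colourCount_val, Finset.card_pos] at this
      obtain ⟨v, hv⟩ := this
      exact ⟨v, (Finset.mem_filter.1 hv).2⟩
    subst hv
    set η := Function.update σ v l with hη
    have hle : ∀ j, ((colourCount η j : ℤ) - (colourCount τ j : ℤ)).natAbs ≤
        ((colourCount σ j : ℤ) - (colourCount τ j : ℤ)).natAbs := by
      intro j
      have h := colourCount_update σ v l j
      rw [← hη] at h
      by_cases h1 : j = σ v
      · subst h1
        rw [if_pos rfl, if_neg hkl.symm] at h
        omega
      · by_cases h2 : j = l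
        · subst h2
          rw [if_neg h1, if_pos rfl] at h
          omega
        · rw [if_neg h1, if_neg h2] at h
          omega
    have hlt : ∑ j, ((colourCount η j : ℤ) - (colourCount τ j : ℤ)).natAbs < d := by
      rw [← hd]
      refine Finset.sum_lt_sum (fun j _ => hle j) ⟨σ v, Finset.mem_univ _, ?_⟩
      have h := colourCount_update σ v l (σ v)
      rw [← hη, if_pos rfl, if_neg hkl.symm] at h
      omega
    obtain ⟨σ', h1, h2⟩ := ih _ hlt η rfl
    refine ⟨σ', h1, Relation.ReflTransGen.head ⟨hammingDist_update σ v hkl, hle⟩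
      (Relation.ReflTransGen.mono (fun a b hab =>
        ⟨hab.1, fun j => (hab.2 j).trans (hle j)⟩) _ _ h2)⟩

theorem dist_empirical_le (hN : 0 < N) {σ η τ : Config N q}
    (h : ∀ k, ((colourCount η k : ℤ) - (colourCount τ k : ℤ)).natAbs ≤
        ((colourCount σ k : ℤ) - (colourCount τ k : ℤ)).natAbs) :
    dist (empirical η) (empirical τ) ≤ dist (empirical σ) (empirical τ) := by
  have hN' : (0 : ℝ) < N := by exact_mod_cast hN
  refine (dist_pi_le_iff dist_nonneg).2 fun k => le_trans ?_ (dist_le_pi_dist _ _ k)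
  rw [Real.dist_eq, Real.dist_eq]
  simp only [empirical_eq, ← sub_div, abs_div, abs_of_pos hN']
  refine div_le_div_of_nonneg_right ?_ hN'.le
  have := h k
  have e : ∀ a b : ℕ, |(a : ℝ) - b| = (((a : ℤ) - b).natAbs : ℝ) := by
    intro a b
    rw [Nat.cast_natAbs]
    push_cast
    rfl
  rw [e, e]
  exact_mod_cast this

/-- A path whose classes all satisfy `P` can be shortened to at most `(N + 1) ^ q` steps. -/
theorem exists_short_path (P : (Fin q → Fin (N + 1)) → Prop) {σ σ' : Config N q}
    (hσ : P (colourCount σ))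
    (h : Relation.ReflTransGen (fun a b => hammingDist a b = 1 ∧ P (colourCount b)) σ σ') :
    ∃ (L : ℕ) (p : ℕ → Config N q), L ≤ (N + 1) ^ q ∧ p 0 = σ ∧
      colourCount (p L) = colourCount σ' ∧
      (∀ k < L, hammingDist (p k) (p (k + 1)) = 1) ∧ ∀ k ≤ L, P (colourCount (p k)) := by
  classical
  -- Loops are erased among count vectors, of which there are `(N + 1) ^ q`. A simple path lifts
  -- back to configurations because a permutation aligns consecutive edges without changing Hamming
  -- distances or counts.
  set G : SimpleGraph (Fin q → Fin (N + 1)) :=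
    { Adj := fun x y => x ≠ y ∧ P x ∧ P y ∧ ∃ a b : Config N q, colourCount a = x ∧
        colourCount b = y ∧ hammingDist a b = 1
      symm := ⟨fun x y ⟨h1, h2, h3, a, b, h4, h5, h6⟩ =>
        ⟨h1.symm, h3, h2, b, a, h5, h4, by rwa [hammingDist_comm]⟩⟩
      loopless := ⟨fun x hx => hx.1 rfl⟩ } with hG
  have hreach : P (colourCount σ') ∧ G.Reachable (colourCount σ) (colourCount σ') := by
    induction h with
    | refl => exact ⟨hσ, SimpleGraph.Reachable.refl _⟩
    | tail _ hbc ih =>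
      rename_i b c _
      refine ⟨hbc.2, ?_⟩
      by_cases he : colourCount b = colourCount c
      · rw [← he]
        exact ih.2
      · exact ih.2.trans (SimpleGraph.Adj.reachable
          (⟨he, ih.1, hbc.2, b, c, rfl, rfl, hbc.1⟩ : G.Adj _ _))
  have hlift : ∀ (x y : Fin q → Fin (N + 1)) (w : G.Walk x y), P x → ∀ a : Config N q,
      colourCount a = x → ∃ p : ℕ → Config N q, p 0 = a ∧ colourCount (p w.length) = y ∧
        (∀ k < w.length, hammingDist (p k) (p (k + 1)) = 1) ∧
        ∀ k ≤ w.length, P (colourCount (p k)) := by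
    intro x y w
    induction w with
    | nil =>
      intro hx a ha
      exact ⟨fun _ => a, rfl, ha, fun k hk => by simp at hk, fun k _ => by rw [ha]; exact hx⟩
    | cons hadj w ih =>
      intro hx a ha
      obtain ⟨-, -, hy, a', b', ha', hb', hd⟩ := hadj
      obtain ⟨g, hg⟩ := exists_perm_of_colourCount_eq (ha.trans ha'.symm)
      obtain ⟨p, hp0, hpL, hps, hpP⟩ := ih hy (b' ∘ g) ((colourCount_comp_perm _ _).trans hb')
      refine ⟨fun k => Nat.casesOn k a p, rfl, ?_, ?_, ?_⟩
      · simpa using hpL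
      · rintro (_ | k) hk
        · change hammingDist a (p 0) = 1
          rw [hp0, ← hg, hammingDist_comp_perm]
          exact hd
        · exact hps k (by simpa using hk)
      · rintro (_ | k) hk
        · change P (colourCount a)
          rw [ha]
          exact hx
        · exact hpP k (by simpa using hk)
  obtain ⟨w⟩ := hreach.2
  obtain ⟨p, hp0, hpL, hps, hpP⟩ := hlift _ _ w.toPath.1 hσ σ rfl
  refine ⟨_, p, ?_, hp0, hpL, hps, hpP⟩
  have := w.toPath.2.length_lt
  simp only [Fintype.card_pi, Fintype.card_fin, Finset.prod_const, Finset.card_univ] at this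
  exact this.le

end

/-! ### Metastability of the mean-field chain -/

theorem exists_config_of_mem_latticeSimplex {N q : ℕ} (hN : 0 < N) {x : Fin q → ℝ}
    (hx : x ∈ latticeSimplex N q) : ∃ σ : Config N q, empirical σ = x := by
  have hN' : (N : ℝ) ≠ 0 := by exact_mod_cast hN.ne'
  obtain ⟨hx, hl⟩ := hx
  choose n hn using hl
  have hsum : ∑ k, n k = N := by
    have := hx.2
    simp only [hn] at this
    rw [← Finset.sum_div, div_eq_one_iff_eq hN'] at this
    exact_mod_cast this
  obtain ⟨σ, hσ⟩ := exists_config_of_counts n hsum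
  refine ⟨σ, funext fun k => ?_⟩
  rw [empirical_eq, hσ, hn]

/-- `dist` is the sup distance whereas the approximation is Euclidean; the comparison costs a factor
√q, here bounded by `q`. -/
theorem dist_latticeApprox_le {q : ℕ} (hq : 2 ≤ q) {β : ℝ} (hβ : betaOne q < β)
    {m : ℕ → Fin (q + 1) → Fin q → ℝ} (hm : IsLatticeApprox q β m) {N : ℕ} (hN : 0 < N)
    {i : Fin (q + 1)} (hi : i ∈ indexSet q β) :
    dist (m N i) (minimum q β i) ≤ (q : ℝ) ^ 2 / N := by
  obtain ⟨σ, hσ⟩ := exists_empirical_near hN (by omega) (minimum_mem hq hβ i)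
  have hmem : empirical σ ∈ latticeSimplex N q :=
    ⟨empirical_mem hN σ, fun k => ⟨_, empirical_eq σ k⟩⟩
  have hq1 : (1 : ℝ) ≤ q := by exact_mod_cast (by omega : 1 ≤ q)
  have h1 := (hm N hN i hi).2 _ hmem
  have h2 : ∑ k, (empirical σ k - minimum q β i k) ^ 2 ≤ q * ((q : ℝ) / N) ^ 2 := by
    calc ∑ k, (empirical σ k - minimum q β i k) ^ 2 ≤ ∑ _k : Fin q, ((q : ℝ) / N) ^ 2 := by
          refine Finset.sum_le_sum fun k _ => ?_
          rw [← sq_abs, ← Real.dist_eq]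
          exact pow_le_pow_left₀ dist_nonneg ((dist_le_pi_dist _ _ k).trans hσ) 2
      _ = _ := by simp
  refine (dist_pi_le_iff (by positivity)).2 fun k => ?_
  rw [Real.dist_eq]
  refine abs_le_of_sq_le_sq ?_ (by positivity)
  have h3 := Finset.single_le_sum (f := fun k => (m N i k - minimum q β i k) ^ 2)
    (fun k _ => sq_nonneg _) (Finset.mem_univ k)
  calc (m N i k - minimum q β i k) ^ 2 ≤ q * ((q : ℝ) / N) ^ 2 := h3.trans (h1.trans h2)
    _ ≤ (q : ℝ) ^ 2 * ((q : ℝ) / N) ^ 2 := by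
        gcongr
        nlinarith
    _ = ((q : ℝ) ^ 2 / N) ^ 2 := by ring

theorem eventually_sq_div_lt (q : ℕ) {η : ℝ} (hη : 0 < η) :
    ∀ᶠ N : ℕ in atTop, (q : ℝ) ^ 2 / N < η :=
  (tendsto_const_div_atTop_nhds_zero_nat _).eventually_lt_const hη

/-- From every configuration there is a path to the metastable sets along which the free energy
hardly exceeds its initial value. -/
theorem eventually_exists_descending_path {q : ℕ} (hq : 2 ≤ q) {β : ℝ} (hβ : betaOne q < β)
    {ε : ℝ} (hε : 0 < ε) :
    ∀ᶠ N : ℕ in atTop, ∀ m, IsLatticeApprox q β m → ∀ σ : Config N q,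
      ∃ i ∈ indexSet q β, ∃ σ' ∈ metastableSet m N i, Relation.ReflTransGen (fun a b =>
        hammingDist a b = 1 ∧ freeEnergy β (empirical b) ≤
          freeEnergy β (empirical σ) + ε) σ σ' := by
  have hq1 : (1 : ℝ) ≤ q := by exact_mod_cast (by omega : 1 ≤ q)
  obtain ⟨δ, hδ, huc⟩ := Metric.uniformContinuousOn_iff.1
    ((isCompact_stdSimplex ℝ (Fin q)).uniformContinuousOn_of_continuous
      (continuous_freeEnergy β).continuousOn) ε hε
  have hη : 0 < δ / 4 := by positivity
  filter_upwards [eventually_sq_div_lt q hη, eventually_gt_atTop 0] with N hNη hN m hm σ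
  have hN' : (0 : ℝ) < N := by exact_mod_cast hN
  have hqη : (q : ℝ) / N < δ / 4 := by
    refine lt_of_le_of_lt ?_ hNη
    gcongr
    nlinarith
  set R : Config N q → Config N q → Prop := fun a b =>
    hammingDist a b = 1 ∧ freeEnergy β (empirical b) ≤ freeEnergy β (empirical σ) + ε with hR
  -- The budget is four times δ/4: `a` is within two parts of `z` and `τ` within one, so the
  -- monotone path stays within three parts of `τ` and four of `z`, where uniform continuity
  -- applies.
  have step : ∀ (a τ : Config N q) (z : Fin q → ℝ), z ∈ stdSimplex ℝ (Fin q) →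
      freeEnergy β z ≤ freeEnergy β (empirical σ) → dist (empirical a) z < 2 * (δ / 4) →
      dist (empirical τ) z < δ / 4 →
      ∃ b, colourCount b = colourCount τ ∧ Relation.ReflTransGen R a b := by
    intro a τ z hz hFz ha hτ
    obtain ⟨b, hb, hpath⟩ := exists_monotone_path a τ
    refine ⟨b, hb, Relation.ReflTransGen.mono (fun c d hcd => ⟨hcd.1, ?_⟩) _ _ hpath⟩
    have h1 := dist_empirical_le hN hcd.2
    have h2 := dist_triangle (empirical d) (empirical τ) z
    have h3 := dist_triangle (empirical a) z (empirical τ)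
    rw [dist_comm z] at h3
    have h4 := huc _ (empirical_mem hN d) z hz (by linarith)
    rw [Real.dist_eq] at h4
    linarith [(abs_lt.1 h4).2]
  obtain ⟨y, hy, hymin, hchain⟩ := exists_chain_to_localMin (isCompact_stdSimplex ℝ (Fin q))
    (continuous_freeEnergy β).continuousOn (empirical_mem hN σ) hη
  have hconf : freeEnergy β y ≤ freeEnergy β (empirical σ) ∧
      ∃ a, dist (empirical a) y < δ / 4 ∧ Relation.ReflTransGen R σ a := by
    clear hymin hy
    induction hchain with
    | refl => exact ⟨le_rfl, σ, by rw [dist_self]; exact hη, Relation.ReflTransGen.refl⟩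
    | tail _ hbc ih =>
      rename_i b c _
      obtain ⟨-, a, ha, hpath⟩ := ih
      obtain ⟨hc, hFc, hd⟩ := hbc
      obtain ⟨τ, hτ⟩ := exists_empirical_near (N := N) hN (by omega) hc
      have hτ' := hτ.trans_lt hqη
      obtain ⟨b', hb', hpath'⟩ := step a τ c hc hFc
        (by linarith [dist_triangle (empirical a) b c]) hτ'
      exact ⟨hFc, b', by rw [empirical_congr hb']; exact hτ', hpath.trans hpath'⟩
  obtain ⟨hFy, a, ha, hpath⟩ := hconf
  obtain ⟨i, hi, rfl⟩ := exists_eq_minimum hq hβ hy hymin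
  obtain ⟨τ, hτ⟩ := exists_config_of_mem_latticeSimplex hN (hm N hN i hi).1
  obtain ⟨b, hb, hpath'⟩ := step a τ _ hy hFy (by linarith)
    (by rw [hτ]; exact (dist_latticeApprox_le hq hβ hm hN hi).trans_lt hNη)
  exact ⟨i, hi, b, (empirical_congr hb).trans hτ, hpath.trans hpath'⟩

/-- Lower bound for the escape probabilities from sets outside the metastable sets. -/
theorem eventually_le_escapeProb {q : ℕ} (hq : 2 ≤ q) {β : ℝ≥0} (hβ : betaOne q < β)
    {ε : ℝ} (hε : 0 < ε) :
    ∀ᶠ N : ℕ in atTop, ∀ m, IsLatticeApprox q β m → ∀ X : Set (Config N q), X.Nonempty →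
      X ⊆ (⋃ i ∈ indexSet q β, metastableSet m N i)ᶜ →
      ENNReal.ofReal ((2 * N * q * ((N : ℝ) + 1) ^ (3 * q) *
        Real.exp (β * N * ε + 2 * entropyError β q N))⁻¹) ≤
        escapeProb β meanFieldHamiltonian X (⋃ i ∈ indexSet q β, metastableSet m N i) := by
  have hβ0 : (0 : ℝ) < β := (exists_orderEq_neg hq hβ).1
  filter_upwards [eventually_exists_descending_path hq hβ hε, eventually_gt_atTop 0]
    with N hpath hN m hm X hX hXU
  set U := ⋃ i ∈ indexSet q β, metastableSet m N i with hU
  have hN' : (0 : ℝ) < N := by exact_mod_cast hN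
  have hq' : (0 : ℝ) < q := by exact_mod_cast (by omega : 0 < q)
  set E := entropyError β q N with hE
  obtain ⟨v, hvX, hvU, hesc, -⟩ := exists_escapeProb_eq β (meanFieldHamiltonian (N := N) (q := q))
    (B := U) hX (Set.disjoint_left.2 hXU)
  set D := dirichletForm β meanFieldHamiltonian v with hD
  have hD0 : 0 ≤ D := dirichletForm_nonneg _ _ _
  have hclass : ∀ σ ∈ X, ∑ τ ∈ colourClass σ, X.indicator (weight β meanFieldHamiltonian) τ ≤
      Real.exp (β * N * ε + 2 * E) * (2 * N * q * (((N : ℝ) + 1) ^ q) ^ 2 * D) := by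
    intro σ hσ
    obtain ⟨i, hi, σ', hσ', hp⟩ := hpath m hm σ
    obtain ⟨L, p, hL, hp0, hpL, hps, hpP⟩ := exists_short_path
      (fun y => freeEnergy β (fun k => ((y k : ℕ) : ℝ) / N) ≤ freeEnergy β (empirical σ) + ε)
      (σ := σ) (σ' := σ') (by change freeEnergy β (empirical σ) ≤ _; linarith) hp
    have hW : ∀ τ : Config N q, |Real.log (classWeight β τ) +
        β * N * freeEnergy β (empirical τ)| ≤ E := fun τ => abs_log_classWeight hN hβ0 τ
    have hW0 := classWeight_pos β σ
    have hlevel : ∀ k ≤ L, Real.exp (-(β * N * ε + 2 * E)) * classWeight β σ ≤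
        classWeight β (p k) := by
      intro k hk
      have h1 : freeEnergy β (empirical (p k)) ≤ freeEnergy β (empirical σ) + ε := hpP k hk
      have h2 := (abs_le.1 (hW (p k))).1
      have h3 := (abs_le.1 (hW σ)).2
      have h4 : (β : ℝ) * N * freeEnergy β (empirical (p k)) ≤
          β * N * (freeEnergy β (empirical σ) + ε) := by gcongr
      rw [← Real.log_le_log_iff (by positivity) (classWeight_pos β _),
        Real.log_mul (Real.exp_pos _).ne' hW0.ne', Real.log_exp]
      linarith
    have hend : ∀ g : Equiv.Perm (Fin N), v (p L ∘ g) = 0 := by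
      intro g
      refine hvU _ (Set.mem_biUnion hi ?_)
      change empirical (p L ∘ g) = m N i
      rw [empirical_congr ((colourCount_comp_perm _ _).trans hpL)]
      exact hσ'
    have key := class_weight_le_of_path β hN (by omega) hvX hps hend (by positivity) hlevel
    rw [hp0] at key
    set S := ∑ τ ∈ colourClass σ, X.indicator (weight β meanFieldHamiltonian) τ with hS
    have h5 : Real.exp (-(β * N * ε + 2 * E)) * S ≤ 2 * N * q * (L : ℝ) ^ 2 * D := by
      refine le_of_mul_le_mul_left ?_ hW0
      calc classWeight β σ * (Real.exp (-(β * N * ε + 2 * E)) * S)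
          = Real.exp (-(β * N * ε + 2 * E)) * classWeight β σ * S := by ring
        _ ≤ _ := key
    rw [Real.exp_neg, inv_mul_le_iff₀ (Real.exp_pos _)] at h5
    refine h5.trans ?_
    have hL' : (L : ℝ) ≤ ((N : ℝ) + 1) ^ q := by exact_mod_cast hL
    gcongr
  have hw := setWeight_le_of_class_le β (by positivity) hclass
  have hW := setWeight_pos β (meanFieldHamiltonian (N := N) (q := q)) hX
  rw [hesc]
  refine ENNReal.ofReal_le_ofReal ?_
  rw [le_div_iff₀ hW, inv_mul_le_iff₀ (by positivity)]
  refine hw.trans (le_of_eq ?_)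
  -- One power `q` counts the classes; the other two come from the squared path length.
  rw [show 3 * q = q + (q + q) by ring, pow_add, pow_add]
  ring

/-- Upper bound for the escape probabilities from the metastable sets. -/
theorem exists_eventually_escapeProb_le {q : ℕ} (hq : 2 ≤ q) {β : ℝ≥0} (hβ : betaOne q < β)
    {j : Fin (q + 1)} (hj : j ∈ indexSet q β) :
    ∃ c : ℝ, 0 < c ∧ ∀ᶠ N : ℕ in atTop, ∀ m, IsLatticeApprox q β m →
      (∀ i ∈ indexSet q β, i ≠ j → m N i ≠ m N j) ∧
      escapeProb β meanFieldHamiltonian (metastableSet m N j)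
        ((⋃ i ∈ indexSet q β, metastableSet m N i) \ metastableSet m N j) ≤
        ENNReal.ofReal (((N : ℝ) + 1) ^ q *
          Real.exp (-(β * N * c) + 2 * entropyError β q N)) := by
  have hβ0 : (0 : ℝ) < β := (exists_orderEq_neg hq hβ).1
  obtain ⟨r, c, hr, hc, hsep, hshell⟩ := exists_shell hq hβ hj
  set x := minimum q β j with hx
  -- The lattice point is only close to the minimum; half of the shell height `c` is given up for
  -- the energy difference.
  obtain ⟨δ, hδ, hcont⟩ := Metric.continuous_iff.1 (continuous_freeEnergy (q :=
    q) (β : ℝ)) x (c / 2)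
    (by positivity)
  refine ⟨c / 2, by positivity, ?_⟩
  filter_upwards [eventually_sq_div_lt q hδ, eventually_sq_div_lt q (half_pos hr),
    eventually_gt_atTop 0] with N hN1 hN2 hN m hm
  have hN' : (0 : ℝ) < N := by exact_mod_cast hN
  have hq1 : (1 : ℝ) ≤ q := by exact_mod_cast (by omega : 1 ≤ q)
  have hdj := dist_latticeApprox_le hq hβ hm hN hj
  have hfar : ∀ i ∈ indexSet q β, i ≠ j → r ≤ dist (m N i) x := by
    intro i hi hij
    have h1 := dist_latticeApprox_le hq hβ hm hN hi
    have h2 := hsep i hij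
    have h3 := dist_triangle (minimum q β i) (m N i) x
    rw [dist_comm (minimum q β i) (m N i)] at h3
    linarith
  refine ⟨fun i hi hij h => ?_, ?_⟩
  · have := hfar i hi hij
    rw [h] at this
    linarith
  obtain ⟨τ, hτ⟩ := exists_config_of_mem_latticeSimplex hN (hm N hN j hj).1
  set A : Set (Config N q) := {σ | dist (empirical σ) x < r} with hA
  set S : Set (Config N q) := {σ | r / 2 ≤ dist (empirical σ) x ∧ dist (empirical σ) x ≤ r} with hS
  set M := metastableSet m N j with hM
  have hMA : ∀ σ ∈ M, σ ∈ A := by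
    intro σ hσ
    have hσ : empirical σ = m N j := hσ
    change dist (empirical σ) x < r
    rw [hσ]
    linarith
  obtain ⟨v, -, -, hesc, hmin⟩ := exists_escapeProb_eq β (meanFieldHamiltonian (N := N) (q := q))
    (A := M) (B := (⋃ i ∈ indexSet q β, metastableSet m N i) \ M) ⟨τ, hτ⟩
    Set.disjoint_sdiff_right
  -- One flip moves each frequency by at most 1/N, less than r/2, so it cannot leave the ball
  -- without starting in the shell.
  have hflip : ∀ σ ∈ A, ∀ η ∉ A, hammingDist σ η = 1 → σ ∈ S := by
    intro σ hσ η hη h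
    have hσ : dist (empirical σ) x < r := hσ
    have hη : r ≤ dist (empirical η) x := not_lt.1 hη
    have h1 : dist (empirical σ) (empirical η) ≤ (q : ℝ) ^ 2 / N := by
      refine (dist_pi_le_iff (by positivity)).2 fun k => ?_
      rw [Real.dist_eq, empirical_eq, empirical_eq, ← sub_div, abs_div, abs_of_pos hN']
      refine div_le_div_of_nonneg_right ?_ hN'.le
      refine le_trans ?_ (by nlinarith : (1 : ℝ) ≤ (q : ℝ) ^ 2)
      exact abs_colourCount_sub_le h k
    have h2 := dist_triangle (empirical η) (empirical σ) x
    rw [dist_comm (empirical η) (empirical σ)] at h2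
    exact ⟨by linarith, hσ.le⟩
  have hD : dirichletForm β meanFieldHamiltonian v ≤ setWeight β meanFieldHamiltonian S := by
    refine (hmin (A.indicator 1) (fun σ hσ => ?_) (fun σ hσ => ?_)).trans
      (dirichletForm_indicator_le β hflip)
    · rw [Set.indicator_of_mem (hMA σ hσ), Pi.one_apply]
    · refine Set.indicator_of_notMem (fun hσA => ?_) _
      obtain ⟨i, hi, hσi⟩ := Set.mem_iUnion₂.1 hσ.1
      have hσi : empirical σ = m N i := hσi
      have hij : i ≠ j := fun h => hσ.2 (by rw [h] at hσi; exact hσi)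
      have h1 : dist (empirical σ) x < r := hσA
      rw [hσi] at h1
      linarith [hfar i hi hij]
  set E := entropyError β q N with hE
  have hW : ∀ τ : Config N q, |Real.log (classWeight β τ) +
      β * N * freeEnergy β (empirical τ)| ≤ E := fun τ => abs_log_classWeight hN hβ0 τ
  have hSw : setWeight β meanFieldHamiltonian S ≤
      ((N : ℝ) + 1) ^ q * Real.exp (-(β * N * (freeEnergy β x + c)) + E) := by
    refine setWeight_le_of_class_le β (Real.exp_pos _).le fun σ hσ => ?_
    refine (class_sum_le_classWeight β hN S σ).trans ?_
    rw [← Real.log_le_iff_le_exp (classWeight_pos β σ)]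
    have h1 := hshell _ (empirical_mem hN σ) hσ.1 hσ.2
    have h2 := (abs_le.1 (hW σ)).2
    have h3 : (β : ℝ) * N * (freeEnergy β x + c) ≤ β * N * freeEnergy β (empirical σ) := by gcongr
    linarith
  have hMw : Real.exp (-(β * N * (freeEnergy β x + c / 2)) - E) ≤
      setWeight β meanFieldHamiltonian M := by
    have e : M = {η | empirical η = empirical τ} := by rw [hτ]; rfl
    rw [e, setWeight_class β hN, ← Real.le_log_iff_exp_le (classWeight_pos β τ)]
    have h1 := hcont (empirical τ) (by rw [hτ]; linarith)
    rw [Real.dist_eq] at h1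
    have h2 := (abs_le.1 (hW τ)).1
    have h3 : (β : ℝ) * N * freeEnergy β (empirical τ) ≤ β * N * (freeEnergy β x + c / 2) := by
      gcongr
      linarith [(abs_lt.1 h1).2]
    linarith
  rw [hesc]
  refine ENNReal.ofReal_le_ofReal ?_
  rw [div_le_iff₀ (setWeight_pos β _ ⟨τ, hτ⟩)]
  refine (hD.trans hSw).trans ?_
  have e : ((N : ℝ) + 1) ^ q * Real.exp (-(β * N * (freeEnergy β x + c)) + E) =
      ((N : ℝ) + 1) ^ q * Real.exp (-(β * N * (c / 2)) + 2 * E) *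
        Real.exp (-(β * N * (freeEnergy β x + c / 2)) - E) := by
    rw [mul_assoc (((N : ℝ) + 1) ^ q), ← Real.exp_add]
    ring_nf
  rw [e]
  gcongr

theorem eventually_log_le (A B : ℝ) {δ : ℝ} (hδ : 0 < δ) :
    ∀ᶠ N : ℕ in atTop, A * Real.log ((N : ℝ) + 1) + B ≤ δ * N := by
  have h1 : Tendsto (fun N : ℕ => Real.log ((N : ℝ) + 1) / ((N : ℝ) + 1)) atTop (nhds 0) := by
    have := Real.isLittleO_log_id_atTop.tendsto_div_nhds_zero.comp
      (tendsto_natCast_atTop_atTop.atTop_add (tendsto_const_nhds (x := (1 : ℝ))))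
    exact this
  have h2 : Tendsto (fun N : ℕ => B / ((N : ℝ) + 1)) atTop (nhds 0) :=
    tendsto_const_nhds.div_atTop
      (tendsto_natCast_atTop_atTop.atTop_add (tendsto_const_nhds (x := (1 : ℝ))))
  have h3 := (h1.const_mul A).add h2
  rw [mul_zero, zero_add] at h3
  filter_upwards [h3.eventually_lt_const (half_pos hδ), eventually_ge_atTop 1] with N hN hN1
  have hN1 : (1 : ℝ) ≤ N := by exact_mod_cast hN1
  have hp : (0 : ℝ) < (N : ℝ) + 1 := by positivity
  rw [mul_div_assoc', ← add_div, div_lt_iff₀ hp] at hN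
  nlinarith

/-- The numerator decays with rate βc, and the denominator with at most βc/2 for the choice ε = c/2.
Half of the difference, βc/4, is kept as `k₁` and the rest absorbs polynomial factors. All bounds
are uniform in `m`, so `k₁` is chosen before it. -/
theorem exists_meanFieldMetastable {q : ℕ} (hq : 2 ≤ q) {β : ℝ≥0} (hβ : betaOne q < β) :
    ∃ k₁ : ℝ, 0 < k₁ ∧ ∀ m : ℕ → Fin (q + 1) → Fin q → ℝ, IsLatticeApprox q β m →
      MeanFieldMetastable q β m k₁ := by
  have hβ0 : (0 : ℝ) < β := (exists_orderEq_neg hq hβ).1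
  have hq0 : (0 : ℝ) < q := by exact_mod_cast (by omega : 0 < q)
  obtain ⟨c, hc, hnum⟩ : ∃ c : ℝ, 0 < c ∧ ∀ j ∈ indexSet q β, ∀ᶠ N : ℕ in atTop,
      ∀ m, IsLatticeApprox q β m → (∀ i ∈ indexSet q β, i ≠ j → m N i ≠ m N j) ∧
      escapeProb β meanFieldHamiltonian (metastableSet m N j)
        ((⋃ i ∈ indexSet q β, metastableSet m N i) \ metastableSet m N j) ≤
        ENNReal.ofReal (((N : ℝ) + 1) ^ q *
          Real.exp (-(β * N * c) + 2 * entropyError β q N)) := by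
    have hev : ∀ᶠ c in nhdsWithin (0 : ℝ) (Set.Ioi 0), ∀ j ∈ indexSet q β, ∀ᶠ N : ℕ in atTop,
        ∀ m, IsLatticeApprox q β m → (∀ i ∈ indexSet q β, i ≠ j → m N i ≠ m N j) ∧
        escapeProb β meanFieldHamiltonian (metastableSet m N j)
          ((⋃ i ∈ indexSet q β, metastableSet m N i) \ metastableSet m N j) ≤
          ENNReal.ofReal (((N : ℝ) + 1) ^ q *
            Real.exp (-(β * N * c) + 2 * entropyError β q N)) := by
      rw [eventually_all_finset]
      intro j hj
      obtain ⟨c', hc', h⟩ := exists_eventually_escapeProb_le hq hβ hj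
      filter_upwards [(eventually_lt_nhds hc').filter_mono nhdsWithin_le_nhds] with c hcc
      filter_upwards [h] with N hN m hm
      refine ⟨(hN m hm).1, (hN m hm).2.trans (ENNReal.ofReal_le_ofReal ?_)⟩
      gcongr
    obtain ⟨c, h1, h2⟩ := (hev.and self_mem_nhdsWithin).exists
    exact ⟨c, h2, h1⟩
  refine ⟨β * c / 4, by positivity, fun m hm => ?_⟩
  have hδ : 0 < β * c / 4 := by positivity
  -- The power of N + 1 is q + 3q + 1, from the two escape bounds and the factor `N`. The remaining
  -- constants come from the four entropy errors and the prefactor.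
  have hpoly := eventually_log_le (4 * q + 1 + 4 * (q + 1))
    (Real.log ((q + 1) * (2 * q)) + 4 * (q + 1) + 2 * β) hδ
  have hmain : ∀ᶠ N : ℕ in atTop, IsMetastable β (meanFieldHamiltonian (N := N) (q := q))
      (indexSet q β) (metastableSet m N) (Real.exp (-(β * c / 4) * N)) := by
    filter_upwards [(eventually_all_finset _).2 hnum,
      eventually_le_escapeProb hq hβ (half_pos hc), hpoly, eventually_gt_atTop 0]
      with N hn hd hp hN
    have hN' : (0 : ℝ) < N := by exact_mod_cast hN
    set E := entropyError β q N with hE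
    refine ⟨fun i hi => ?_, fun i hi j hj hij => ?_, ?_⟩
    · obtain ⟨τ, hτ⟩ := exists_config_of_mem_latticeSimplex hN (hm N hN i hi).1
      exact ⟨τ, hτ⟩
    · refine Set.disjoint_left.2 fun σ h1 h2 => ?_
      have h1 : empirical σ = m N i := h1
      have h2 : empirical σ = m N j := h2
      exact (hn j hj m hm).1 i hi hij (h1.symm.trans h2)
    set U := ⋃ i ∈ indexSet q β, metastableSet m N i with hU
    set d : ℝ := 2 * N * q * ((N : ℝ) + 1) ^ (3 * q) *
        Real.exp (β * N * (c / 2) + 2 * E) with hdd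
    set n : ℝ := ((N : ℝ) + 1) ^ q * Real.exp (-(β * N * c) + 2 * E) with hnn
    have hd0 : 0 < d := by positivity
    have h1 : (⨆ j ∈ indexSet q β, escapeProb β meanFieldHamiltonian (metastableSet m N j)
        (U \ metastableSet m N j)) ≤ ENNReal.ofReal n := iSup₂_le fun j hj => (hn j hj m hm).2
    have h2 : ENNReal.ofReal d⁻¹ ≤ ⨅ (X : Set (Config N q)) (_ : X.Nonempty ∧ X ⊆ Uᶜ),
        escapeProb β meanFieldHamiltonian X U := le_iInf₂ fun X hX => hd m hm X hX.1 hX.2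
    have h3 : ((indexSet q β).card : ℝ≥0∞) ≤ ENNReal.ofReal ((q : ℝ) + 1) := by
      have : (indexSet q β).card ≤ q + 1 := (Finset.card_le_univ _).trans (by simp)
      rw [show (q : ℝ) + 1 = ((q + 1 : ℕ) : ℝ) by push_cast; rfl, ENNReal.ofReal_natCast]
      exact_mod_cast this
    calc _ ≤ ENNReal.ofReal ((q : ℝ) + 1) * ENNReal.ofReal n / ENNReal.ofReal d⁻¹ := by gcongr
      _ = ENNReal.ofReal (((q : ℝ) + 1) * n * d) := by
          rw [← ENNReal.ofReal_mul (by positivity), ← ENNReal.ofReal_div_of_pos (by positivity),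
            div_inv_eq_mul]
      _ ≤ _ := ENNReal.ofReal_le_ofReal ?_
    have hpq : (0 : ℝ) < ((q : ℝ) + 1) * (2 * q) := by positivity
    have e1 : ((q : ℝ) + 1) * n * d ≤
        (((q : ℝ) + 1) * (2 * q)) * ((N : ℝ) + 1) ^ (4 * q + 1) *
          Real.exp (-(β * N * (c / 2)) + 4 * E) := by
      have e : ((q : ℝ) + 1) * n * d = (((q : ℝ) + 1) * (2 * q)) * (((N : ℝ) + 1) ^ (4 * q) * N) *
          Real.exp (-(β * N * (c / 2)) + 4 * E) := by
        have hexp : Real.exp (-(β * N * (c / 2)) + 4 * E) =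
            Real.exp (-(β * N * c) + 2 * E) * Real.exp (β * N * (c / 2) + 2 * E) := by
          rw [← Real.exp_add]; congr 1; ring
        have hpow : ((N : ℝ) + 1) ^ (4 * q) = ((N : ℝ) + 1) ^ q * ((N : ℝ) + 1) ^ (3 * q) := by
          rw [← pow_add]; congr 1; ring
        rw [hnn, hdd, hexp, hpow]; ring
      rw [e, pow_succ]
      gcongr
      linarith
    refine e1.trans ?_
    rw [← Real.log_le_iff_le_exp (by positivity), Real.log_mul (by positivity)
      (Real.exp_pos _).ne', Real.log_exp, Real.log_mul hpq.ne' (by positivity), Real.log_pow]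
    rw [hE, entropyError]
    push_cast
    linarith
  obtain ⟨N₀, hN₀⟩ := eventually_atTop.1 hmain
  exact ⟨N₀, fun N hN => hN₀ N hN.le⟩

end Potts

end

theorem theorem2 {Ω : Type*} [MeasurableSpace Ω] (P : Measure Ω) [IsProbabilityMeasure P]
    (J : ℕ → ℕ → Ω → ℝ)
    (hJ_meas : ∀ i j, i < j → Measurable (J i j))
    (hJ_indep : iIndepFun (fun p : {p : ℕ × ℕ // p.1 < p.2} => J p.1.1 p.1.2) P)
    (hJ_ident : ∀ i j, i < j → IdentDistrib (J i j) (J 0 1) P P)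
    (hJ_mean : ∫ ω, J 0 1 ω ∂P = 1)
    (hJ_exp : (0 : ℝ) ∈ interior (integrableExpSet (J 0 1) P))
    (q : ℕ) (hq : 2 ≤ q) (β : ℝ≥0) (hβ : Potts.betaOne q < β) :
    (∃ k₁ : ℝ, 0 < k₁ ∧ ∀ m : ℕ → Fin (q + 1) → Fin q → ℝ, Potts.IsLatticeApprox q β m →
      Potts.MeanFieldMetastable q β m k₁) ∧
    ∀ m : ℕ → Fin (q + 1) → Fin q → ℝ, Potts.IsLatticeApprox q β m →
      ∀ k₁ : ℝ, 0 < k₁ → Potts.MeanFieldMetastable q β m k₁ →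
        ∀ k₂ : ℝ, 0 < k₂ → k₂ < k₁ →
          ∀ᵐ ω ∂P, ∀ᶠ N : ℕ in atTop, ω ∈ Potts.metastableEvent J q β m k₂ N := by
  refine ⟨Potts.exists_meanFieldMetastable hq hβ, fun m _ k₁ _ hmf k₂ _ hk => ?_⟩
  exact Potts.ae_eventually_metastableEvent P J hJ_meas hJ_indep hJ_ident hJ_mean hJ_exp hk hmf
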